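/- **Setting.** Let $T>0$, let $\mathbb A\subset\mathbb R$ be compact, $\nu$ a probability measure on $\mathbb R$, let $b^1,b^2:\mathbb R\times\mathbb A\times\mathbb R\to\mathbb R$ be bounded and measurable, $r:\mathbb R\times\mathbb A\to\mathbb R$ bounded, with $r$ and, for every $e$, $b^1(\cdot,\cdot,e)$, $b^2(\cdot,\cdot,e)$ continuous. Assume $\int b^2(x,a,e)\,\nu(de)=0$ for all $(x,a)$ and $\inf_{x,a}\int|b^2(x,a,e)|^2\nu(de)>0$. Put $\mu(x,a)=\int b^1(x,a,e)\,\nu(de)$, $\sigma(x,a)=(\int|b^2(x,a,e)|^2\nu(de))^{1/2}$, and assume that $\mu,\sigma,r$ are Lipschitz in $x$, uniformly in $a\in\mathbb A$. For $\epsilon\in(0,1)$ let $b^\epsilon=\epsilon b^1+\sqrt\epsilon\,b^2$, $\lambda_\epsilon=\epsilon^{-1}$, and let $N$ be the random jump measure of a marked Poisson process with compensator $\lambda_\epsilon\nu(de)dt$; write $N_t=N([0,t]\times\mathbb R)$. Let $\mathcal A^t$ be the set of $\mathbb A$-valued processes that are predictable for the augmented filtration generated by $N$ restricted to $(t,\cdot]\times\mathbb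 R$. For $\alpha\in\mathcal A^t$ let $X^{t,x,\alpha}_s=x+\int_{(t,s]}\int b^\epsilon(X^{t,x,\alpha}_{u-},\alpha_u,e)\,N(de,du)$, $s\ge t$, and $$J^\epsilon(t,x;\alpha)=\frac1{\lambda_\epsilon}\mathbb E\Big[\int_{(t,T]}r(X^{t,x,\alpha}_{s-},\alpha_s)\,dN_s\Big],\qquad V^\epsilon(t,x)=\sup_{\alpha\in\mathcal A^t}J^\epsilon(t,x;\alpha).$$ **Assumption.** Let $i_\circ\ge0$, $\delta\beta_0,\dots,\delta\beta_{i_\circ}\in(0,1]$, $\beta_i=\sum_{j=0}^i\delta\beta_j$, and $\beta_{-1}=\delta\beta_{-1}=0$. Let $\delta\bar V^i\in C^{1,2}([0,T)\times\mathbb R)\cap C^0([0,T]\times\mathbb R)$, $i\le i_\circ$, be such that $\partial^2_{xx}\delta\bar V^i$ is $\delta\beta_i$-Hölder in space, uniformly in time. With $\delta r^{-1,\epsilon}:=r$, put successively for $i=0,\dots,i_\circ$, on $[0,T)\times\mathbb R\times\mathbb A$ (and for $e\in\mathbb R$), $$r^i=\lim_{\epsilon\downarrow0}\int\epsilon^{-\delta\beta_{i-1}/2}\delta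 r^{i-1,\epsilon}(\cdot,e)\,\nu(de),$$ $$\delta r^{i,\epsilon}=\tfrac1\epsilon\big(\delta\bar V^i(\cdot,\cdot+b^\epsilon)-\delta\bar V^i\big)+\epsilon^{-\delta\beta_{i-1}/2}\delta r^{i-1,\epsilon}-b^1\partial_x\delta\bar V^i-\tfrac12|b^2|^2\partial^2_{xx}\delta\bar V^i-r^i ,$$ where the limits are assumed to exist pointwise (so $r^0=r$). Let $$\bar V^{i_\circ,\epsilon}=\sum_{j=0}^{i_\circ}\epsilon^{\beta_{j-1}/2}\,\delta\bar V^j,\qquad \mathbb A^{i_\circ,\epsilon}=\underset{a\in\mathbb A}{\rm argmax}\Big\{\mu(\cdot,a)\partial_x\bar V^{i_\circ,\epsilon}+\tfrac12\sigma^2(\cdot,a)\partial^2_{xx}\bar V^{i_\circ,\epsilon}+\sum_{j=0}^{i_\circ}\epsilon^{\beta_{j-1}/2}r^j(\cdot,a)\Big\}.$$ Assume that for every $\epsilon\in(0,1)$ there is a Borel map $\bar{\rm a}^\epsilon$ with $\bar{\rm a}^\epsilon\in\mathbb A^{i_\circ,\epsilon}$ on $[0,T)\times\mathbb R$ such that for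 every $i\le i_\circ$ $$\partial_t\delta\bar V^i+\mu(\cdot,\bar{\rm a}^\epsilon)\partial_x\delta\bar V^i+\tfrac12\sigma(\cdot,\bar{\rm a}^\epsilon)^2\partial^2_{xx}\delta\bar V^i+r^i(\cdot,\bar{\rm a}^\epsilon)=0\ \text{ on }[0,T)\times\mathbb R,\qquad \delta\bar V^i(T,\cdot)=0,$$ and that $$\limsup_{\epsilon\downarrow0}\ \epsilon^{-\delta\beta_{i_\circ}/2}\Big\|\int\big(\epsilon^{-\delta\beta_{i_\circ-1}/2}\delta r^{i_\circ-1,\epsilon}-r^{i_\circ}\big)(\cdot,e)\,\nu(de)\Big\|_\infty<\infty$$ (supremum norm over $[0,T)\times\mathbb R\times\mathbb A$). **Conclusion.** For all $(t,x)\in[0,T]\times\mathbb R$, $$\limsup_{\epsilon\downarrow0}\ \epsilon^{-\beta_{i_\circ}/2}\,\big|V^\epsilon-\bar V^{i_\circ,\epsilon}\big|(t,x)<\infty .$$ Moreover there is a constant $C>0$ such that for every $\epsilon\in(0,1)$, every Borel map $\check{\rm a}^\epsilon$ with values in $\mathbb A$ and $\check{\rm a}^\epsilon\in\mathbb A^{i_\circ,\epsilon}$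 on $[0,T)\times\mathbb R$ (in particular every one that moreover maximises $\mu\,\partial_x\delta\bar V^{i_\circ}+\frac12\sigma^2\partial^2_{xx}\delta\bar V^{i_\circ}+r^{i_\circ}$ over $\mathbb A^{i_\circ,\epsilon}$), and every $(t,x)\in[0,T]\times\mathbb R$, the feedback control $\check\alpha^{t,x}_s=\check{\rm a}^\epsilon(s,X^{t,x,\check\alpha^{t,x}}_{s-})$, $s\in(t,T]$, exists in $\mathcal A^t$ and satisfies $$J^\epsilon(t,x;\check\alpha^{t,x})\ \ge\ V^\epsilon(t,x)-C\,\epsilon^{\beta_{i_\circ}/2}.$$ -/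

import Mathlib

open MeasureTheory ProbabilityTheory Filter Topology Set

noncomputable section

namespace PureJump

/-! ### Data of the control problem and standing assumptions -/

/-- Data: horizon `T`, action set `A ⊆ ℝ`, mark law `ν`, jump coefficients `b₁`, `b₂` as functions
of (state, action, mark), and reward `r` as a function of (state, action). -/
structure Data where
  T : ℝ
  A : Set ℝ
  ν : Measure ℝ
  b₁ : ℝ → A → ℝ → ℝ
  b₂ : ℝ → A → ℝ → ℝ
  r : ℝ → A → ℝ

namespace Data

variable (M : Data)

/-- The jump coefficient `b^ε = ε b₁ + √ε b₂`. -/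
def bEps (ε : ℝ) (x : ℝ) (a : M.A) (e : ℝ) : ℝ := ε * M.b₁ x a e + √ε * M.b₂ x a e

/-- `μ(x,a) = ∫ b₁(x,a,e) ν(de)`. -/
def drift (x : ℝ) (a : M.A) : ℝ := ∫ e, M.b₁ x a e ∂M.ν

/-- `σ(x,a) = (∫ |b₂(x,a,e)|² ν(de))^{1/2}`. -/
def vol (x : ℝ) (a : M.A) : ℝ := √(∫ e, |M.b₂ x a e| ^ 2 ∂M.ν)

/-- The standing assumptions on the data. -/
structure Standing : Prop where
  T_pos : 0 < M.T
  isCompact_A : IsCompact M.A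
  isProbabilityMeasure_ν : IsProbabilityMeasure M.ν
  measurable_b₁ : Measurable fun p : ℝ × M.A × ℝ => M.b₁ p.1 p.2.1 p.2.2
  measurable_b₂ : Measurable fun p : ℝ × M.A × ℝ => M.b₂ p.1 p.2.1 p.2.2
  bounded_b₁ : ∃ K, ∀ x a e, |M.b₁ x a e| ≤ K
  bounded_b₂ : ∃ K, ∀ x a e, |M.b₂ x a e| ≤ K
  bounded_r : ∃ K, ∀ x a, |M.r x a| ≤ K
  continuous_b₁ : ∀ e, Continuous fun p : ℝ × M.A => M.b₁ p.1 p.2 e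
  continuous_b₂ : ∀ e, Continuous fun p : ℝ × M.A => M.b₂ p.1 p.2 e
  continuous_r : Continuous fun p : ℝ × M.A => M.r p.1 p.2
  centred : ∀ x a, ∫ e, M.b₂ x a e ∂M.ν = 0
  elliptic : ∃ η > 0, ∀ x a, η ≤ ∫ e, |M.b₂ x a e| ^ 2 ∂M.ν
  lipschitz_drift : ∃ L, ∀ a x y, |M.drift x a - M.drift y a| ≤ L * |x - y|
  lipschitz_vol : ∃ L, ∀ a x y, |M.vol x a - M.vol y a| ≤ L * |x - y|
  lipschitz_r : ∃ L, ∀ a x y, |M.r x a - M.r y a| ≤ L * |x - y|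

end Data

/-! ### The driving marked Poisson process

An outcome is a sequence of pairs (waiting time, mark). Under `jumpLaw` the waiting times are
i.i.d. exponential with rate `1/ε`, the marks are i.i.d. with law `ν`, and both are independent, so
that `jumpMeasure` is a Poisson random measure with compensator `ε⁻¹ ν(de) dt`. -/

/-- Outcomes: waiting times and marks. -/
abbrev Outcome : Type := ℕ → ℝ × ℝ

/-- The intensity `λ_ε = ε⁻¹`. -/
def intensity (ε : ℝ) : ℝ := ε⁻¹

/-- The time of the `(n+1)`-st jump. -/
def jumpTime (n : ℕ) (ω : Outcome) : ℝ := ∑ k ∈ Finset.range (n + 1), (ω k).1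

/-- The mark of the `(n+1)`-st jump. -/
def mark (n : ℕ) (ω : Outcome) : ℝ := (ω n).2

/-- The random measure `N(ds, de)`, one atom (jump time, mark) for each jump. -/
def jumpMeasure (ω : Outcome) : Measure (ℝ × ℝ) :=
  Measure.sum fun n => Measure.dirac (jumpTime n ω, mark n ω)

/-- The probability measure on outcomes with jump intensity `λ_ε` and mark law `ν`. -/
def jumpLaw (ν : Measure ℝ) (ε : ℝ) : Measure Outcome :=
  Measure.infinitePi fun _ : ℕ => (expMeasure (intensity ε)).prod ν

lemma measurable_jumpMeasure {B : Set (ℝ × ℝ)} (hB : MeasurableSet B) :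
    Measurable fun ω => jumpMeasure ω B := by
  have h : (fun ω => jumpMeasure ω B) =
      fun ω => ∑' n, B.indicator (1 : ℝ × ℝ → ENNReal) (jumpTime n ω, mark n ω) := by
    funext ω
    simp only [jumpMeasure, Measure.sum_apply _ hB, Measure.dirac_apply' _ hB]
  rw [h]
  refine Measurable.tsum fun n => (measurable_one.indicator hB).comp ?_
  unfold jumpTime mark
  fun_prop

/-- The filtration `𝔽^t = (ℱ^t_s)_{s ≥ t}`: generated by the restriction of the jump measure to
`(t, s] × ℝ`, and augmented by the null sets. -/
def filt (ν : Measure ℝ) (ε t : ℝ) :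
    Filtration (Ici t) (inferInstance : MeasurableSpace Outcome) where
  seq s := MeasurableSpace.generateFrom
    ({E | ∃ u ≤ (s : ℝ), ∃ B : Set ℝ, MeasurableSet B ∧ ∃ D : Set ENNReal, MeasurableSet D ∧
        E = (fun ω => jumpMeasure ω (Ioc t u ×ˢ B)) ⁻¹' D} ∪
      {E | MeasurableSet E ∧ jumpLaw ν ε E = 0})
  mono' := by
    intro s s' hss'
    refine MeasurableSpace.generateFrom_mono (union_subset_union_left _ ?_)
    rintro E ⟨u, hu, B, hB, D, hD, rfl⟩
    exact ⟨u, hu.trans hss', B, hB, D, hD, rfl⟩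
  le' := by
    intro s
    refine MeasurableSpace.generateFrom_le ?_
    rintro E (⟨u, -, B, hB, D, hD, rfl⟩ | ⟨hE, -⟩)
    · exact measurable_jumpMeasure (measurableSet_Ioc.prod hB) hD
    · exact hE

/-! ### The control problem -/

variable (M : Data)

/-- The class `𝒜^t`: `A`-valued `𝔽^t`-predictable processes. Only the values at times `s ≥ t`
matter. -/
def IsControl (ε t : ℝ) (α : ℝ → Outcome → M.A) : Prop :=
  IsStronglyPredictable (filt M.ν ε t) fun s : Ici t => α s

/-- The value `X_{s-}` of the path `X(ω)` just before time `s`. -/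
def before (X : ℝ → Outcome → ℝ) (s : ℝ) (ω : Outcome) : ℝ := Function.leftLim (fun u => X u ω) s

/-- `X` is the controlled state: almost surely, for all `s ≥ t`,
`X_s = x + ∫_{(t,s]} ∫ b^ε(X_{u-}, α_u, e) N(du, de)`. As the integral is a finite sum over jumps,
such an `X` is almost surely càdlàg on `[t, ∞)`. -/
def IsState (ε t x : ℝ) (α : ℝ → Outcome → M.A) (X : ℝ → Outcome → ℝ) : Prop :=
  ∀ᵐ ω ∂jumpLaw M.ν ε, ∀ s, t ≤ s →
    X s ω = x + ∫ z in Ioc t s ×ˢ (univ : Set ℝ),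
      M.bEps ε (before X z.1 ω) (α z.1 ω) z.2 ∂jumpMeasure ω

/-- The scaled expected gain `λ_ε⁻¹ 𝔼[∫_{(t,T]} r(X_{s-}, α_s) dN_s]`. -/
def gain (ε t : ℝ) (α : ℝ → Outcome → M.A) (X : ℝ → Outcome → ℝ) : ℝ :=
  (intensity ε)⁻¹ * ∫ ω, (∫ z in Ioc t M.T ×ˢ (univ : Set ℝ),
    M.r (before X z.1 ω) (α z.1 ω) ∂jumpMeasure ω) ∂jumpLaw M.ν ε

/-- The value function `V^ε(t,x)` of the pure-jump problem. -/
def value (ε t x : ℝ) : ℝ :=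
  sSup {v | ∃ α X, IsControl M ε t α ∧ IsState M ε t x α X ∧ v = gain M ε t α X}

/-- `(α, X)` is a control in `𝒜^t` in feedback form `α_s = a(s, X_{s-})`, `s ∈ (t,T]`, together
with its state process started from `x` at time `t`. -/
def IsFeedbackPair (ε t x : ℝ) (a : ℝ → ℝ → M.A) (α : ℝ → Outcome → M.A)
    (X : ℝ → Outcome → ℝ) : Prop :=
  IsControl M ε t α ∧ IsState M ε t x α X ∧
    ∀ᵐ ω ∂jumpLaw M.ν ε, ∀ s ∈ Ioc t M.T, α s ω = a s (before X s ω)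

/-! ### Regularity of functions of (time, state) -/

/-- Time derivative (one-sided at time `0`). -/
def dt (f : ℝ → ℝ → ℝ) (t x : ℝ) : ℝ := derivWithin (fun s => f s x) (Ici 0) t

/-- First space derivative. -/
def dx (f : ℝ → ℝ → ℝ) (t x : ℝ) : ℝ := deriv (f t) x

/-- Second space derivative. -/
def dxx (f : ℝ → ℝ → ℝ) (t x : ℝ) : ℝ := deriv (deriv (f t)) x

/-- `f ∈ C^{1,2}([0,T) × ℝ)`. -/
structure IsC12 (T : ℝ) (f : ℝ → ℝ → ℝ) : Prop where
  diff_t : ∀ t ∈ Ico 0 T, ∀ x, DifferentiableWithinAt ℝ (fun s => f s x) (Ici 0) t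
  diff_x : ∀ t ∈ Ico 0 T, Differentiable ℝ (f t)
  diff_xx : ∀ t ∈ Ico 0 T, Differentiable ℝ (deriv (f t))
  cont : ContinuousOn (Function.uncurry f) (Ico 0 T ×ˢ univ)
  cont_dt : ContinuousOn (Function.uncurry (dt f)) (Ico 0 T ×ˢ univ)
  cont_dx : ContinuousOn (Function.uncurry (dx f)) (Ico 0 T ×ˢ univ)
  cont_dxx : ContinuousOn (Function.uncurry (dxx f)) (Ico 0 T ×ˢ univ)

/-- `g` is `β`-Hölder in space on `[0,T) × ℝ`, with a constant uniform in time. -/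
def IsHolderInSpace (T β : ℝ) (g : ℝ → ℝ → ℝ) : Prop :=
  ∃ K, ∀ t ∈ Ico 0 T, ∀ x y, |g t x - g t y| ≤ K * |x - y| ^ β

/-! ### The expansion

Indices: `δβ i`, `δV i`, `ρ i` stand for `δβ_i`, `δV̄^i`, `r^i`. -/

/-- `δβ_{i-1}`, with the convention `δβ_{-1} = 0`. -/
def lagExp (δβ : ℕ → ℝ) : ℕ → ℝ
  | 0 => 0
  | i + 1 => δβ i

/-- `∑_{j < i} δβ_j`; so `β_i = partialSum δβ (i + 1)`, and `β_{-1} = partialSum δβ 0 = 0`. -/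
def partialSum (δβ : ℕ → ℝ) (i : ℕ) : ℝ := ∑ j ∈ Finset.range i, δβ j

/-- `V̄^{i₀,ε} = ∑_{j ≤ i₀} ε^{β_{j-1}/2} δV̄^j = δV̄^0 + ∑_{1 ≤ j ≤ i₀} ε^{β_{j-1}/2} δV̄^j`. -/
def expansion (i₀ : ℕ) (δβ : ℕ → ℝ) (δV : ℕ → ℝ → ℝ → ℝ) (ε t x : ℝ) : ℝ :=
  ∑ j ∈ Finset.range (i₀ + 1), ε ^ (partialSum δβ j / 2) * δV j t x

/-- The total running reward `∑_{j ≤ i₀} ε^{β_{j-1}/2} r^j` of the expansion. -/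
def expansionReward (i₀ : ℕ) (δβ : ℕ → ℝ) (ρ : ℕ → ℝ → ℝ → M.A → ℝ) (ε t x : ℝ) (a : M.A) : ℝ :=
  ∑ j ∈ Finset.range (i₀ + 1), ε ^ (partialSum δβ j / 2) * ρ j t x a

/-- `μ(x,a) ∂_x f(t,x) + ½ σ(x,a)² ∂²_{xx} f(t,x)`. -/
def diffusionOp (f : ℝ → ℝ → ℝ) (t x : ℝ) (a : M.A) : ℝ :=
  M.drift x a * dx f t x + 1 / 2 * M.vol x a ^ 2 * dxx f t x

/-- The remainders, shifted by one index: `remainder (i + 1)` is `δr^{i,ε}(t,x,a,e)`, and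
`remainder 0` is `δr^{-1,ε} = r`. -/
def remainder (δβ : ℕ → ℝ) (δV : ℕ → ℝ → ℝ → ℝ) (ρ : ℕ → ℝ → ℝ → M.A → ℝ) (ε : ℝ) :
    ℕ → ℝ → ℝ → M.A → ℝ → ℝ
  | 0, _, x, a, _ => M.r x a
  | i + 1, t, x, a, e =>
      ε⁻¹ * (δV i t (x + M.bEps ε x a e) - δV i t x)
        + ε ^ (-(lagExp δβ i) / 2) * remainder δβ δV ρ ε i t x a e
        - M.b₁ x a e * dx (δV i) t x
        - 1 / 2 * |M.b₂ x a e| ^ 2 * dxx (δV i) t x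
        - ρ i t x a

/-- The set of maximisers over `A` of `μ ∂_x V̄^{i₀,ε} + ½ σ² ∂²_{xx} V̄^{i₀,ε} + ∑_j ε^{β_{j-1}/2} r^j`
at the point `(t,x)`. -/
def maximisers (i₀ : ℕ) (δβ : ℕ → ℝ) (δV : ℕ → ℝ → ℝ → ℝ) (ρ : ℕ → ℝ → ℝ → M.A → ℝ)
    (ε t x : ℝ) : Set M.A :=
  {a | ∀ a' : M.A,
    diffusionOp M (expansion i₀ δβ δV ε) t x a' + expansionReward M i₀ δβ ρ ε t x a' ≤
      diffusionOp M (expansion i₀ δβ δV ε) t x a + expansionReward M i₀ δβ ρ ε t x a}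

/-- The system of equations, with its regularity and rate conditions, that
`(δV^i)_{i ≤ i₀}`, `(r^i)_{i ≤ i₀}` and the maximising maps `abar ε = ā^ε` are assumed to solve. -/
structure SolvesSystem (i₀ : ℕ) (δβ : ℕ → ℝ) (δV : ℕ → ℝ → ℝ → ℝ)
    (ρ : ℕ → ℝ → ℝ → M.A → ℝ) (abar : ℝ → ℝ → ℝ → M.A) : Prop where
  exponents : ∀ i ≤ i₀, δβ i ∈ Ioc 0 1
  isC12 : ∀ i ≤ i₀, IsC12 M.T (δV i)
  continuous : ∀ i ≤ i₀, ContinuousOn (Function.uncurry (δV i)) (Icc 0 M.T ×ˢ univ)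
  holder : ∀ i ≤ i₀, IsHolderInSpace M.T (δβ i) (dxx (δV i))
  measurable_abar : ∀ ε ∈ Ioo (0 : ℝ) 1, Measurable (Function.uncurry (abar ε))
  abar_mem : ∀ ε ∈ Ioo (0 : ℝ) 1, ∀ t ∈ Ico 0 M.T, ∀ x, abar ε t x ∈ maximisers M i₀ δβ δV ρ ε t x
  equation : ∀ ε ∈ Ioo (0 : ℝ) 1, ∀ i ≤ i₀, ∀ t ∈ Ico 0 M.T, ∀ x,
    dt (δV i) t x + diffusionOp M (δV i) t x (abar ε t x) + ρ i t x (abar ε t x) = 0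
  terminal : ∀ i ≤ i₀, ∀ x, δV i M.T x = 0
  /-- `r^i = lim_{ε → 0} ∫ ε^{-δβ_{i-1}/2} δr^{i-1,ε}(·,e) ν(de)`; for `i = 0` this says `r^0 = r`. -/
  limits : ∀ i ≤ i₀, ∀ t ∈ Ico 0 M.T, ∀ x a,
    Tendsto (fun ε : ℝ => ∫ e, ε ^ (-(lagExp δβ i) / 2) * remainder M δβ δV ρ ε i t x a e ∂M.ν)
      (𝓝[>] 0) (𝓝 (ρ i t x a))
  /-- `limsup_{ε → 0} ε^{-δβ_{i₀}/2} ‖∫ (ε^{-δβ_{i₀-1}/2} δr^{i₀-1,ε} - r^{i₀})(·,e) ν(de)‖_∞ < ∞`. -/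
  rate : limsup (fun ε : ℝ => ENNReal.ofReal (ε ^ (-(δβ i₀) / 2)) *
      ⨆ t ∈ Ico 0 M.T, ⨆ x : ℝ, ⨆ a : M.A, ENNReal.ofReal
        |∫ e, (ε ^ (-(lagExp δβ i₀) / 2) * remainder M δβ δV ρ ε i₀ t x a e - ρ i₀ t x a) ∂M.ν|)
      (𝓝[>] 0) < ⊤

end PureJump

end

/-! The proof is a verification argument in which the expansion itself is the test function. The
drift of a function W is the reward plus ∂_t W plus the jump generator applied to W. Taylor's
formula replaces the jump generator of each δV̄^j by the diffusion generator, up to an error. The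
recursion for δr^{i,ε} is built so that these errors, weighted by ε^{β_{j-1}/2}, telescope: they
turn r into ∑ ε^{β_{j-1}/2} r^j and leave only ε^{β_{i₀-1}/2} times the sum of the Taylor error of
δV̄^{i₀} and the quantity in the rate hypothesis. The equations replace ∂_t by minus the Hamiltonian
at ā^ε. Hence the drift at an action a is the Hamiltonian gap between a and ā^ε, which is
nonpositive and vanishes at maximisers, plus O(ε^{β_{i₀}/2}) (`driftTerm_expansion`,
`exists_driftTerm_bound`). Integrated along controlled paths (`gain_sub_mem_Icc`), this bounds every
gain from above by the expansion plus that order, and the gain of a maximising feedback from below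
by the expansion minus that order.

The analytic difficulty is that the last Taylor error contains √ε ∂²_{xx} δV̄^{i₀} ∫ b₁ b₂ dν, while
no corrector is assumed bounded. Boundedness is recovered in `exists_uniform_bound`. For each small
ε the rate hypothesis bounds, over all (t,x,a), a finite sum of powers of ε whose coefficients are
the r^j and multiples of ∂²_{xx} δV̄^j; the coefficients of distinct powers are then bounded
separately (`bounded_of_sum_rpow`). In the power that carries r^m, the other terms come from
correctors of index below m, which allows an induction: r^m is bounded, so δV̄^m is bounded by a
maximum principle, and its derivatives by interpolation.

The probabilistic part uses no stochastic calculus. Between jumps the state is constant and a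
predictable control is a function of time and of the past jumps (`exists_past_control`), so
everything reduces to the exponential law of one waiting time (`lintegral_jump`) and to a sum over
jumps. Predictability of the feedback control comes from an Euler scheme that is eventually exact on
each path (`exists_isFeedbackPair`). -/

noncomputable section

namespace PureJump

section

/-! ### Taylor expansion and interpolation for functions with Hölder second derivative -/

/-- The mean value inequality is applied twice on the segment from `x` to `x + h`, first to the
derivative and then to the function, each time after subtracting the Taylor polynomial. No sharp
constant is needed. -/
lemma abs_taylor_sub_le {f : ℝ → ℝ} (hf : Differentiable ℝ f) (hf' : Differentiable ℝ (deriv f))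
    {K β : ℝ} (hβ : 0 < β)
    (hK : ∀ x y, |deriv (deriv f) x - deriv (deriv f) y| ≤ K * |x - y| ^ β) (x h : ℝ) :
    |f (x + h) - f x - h * deriv f x - 1 / 2 * h ^ 2 * deriv (deriv f) x| ≤ K * |h| ^ (2 + β) := by
  have hK0 : 0 ≤ K := by
    have := (abs_nonneg _).trans (hK 1 0)
    simpa using this
  rcases eq_or_ne h 0 with rfl | hh
  · simp [Real.zero_rpow (by linarith : 2 + β ≠ 0)]
  have hh' : 0 < |h| := abs_pos.2 hh
  have hseg : ∀ u ∈ uIcc x (x + h), |u - x| ≤ |h| := fun u hu => by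
    have := abs_sub_left_of_mem_uIcc hu
    simpa using this
  have hconv : Convex ℝ (uIcc x (x + h)) := convex_uIcc _ _
  have h1 : ∀ u ∈ uIcc x (x + h),
      |deriv f u - deriv f x - (u - x) * deriv (deriv f) x| ≤ K * |h| ^ β * |h| := by
    intro u hu
    have hd : ∀ v ∈ uIcc x (x + h), HasDerivWithinAt
        (fun v => deriv f v - (v - x) * deriv (deriv f) x)
        (deriv (deriv f) v - deriv (deriv f) x) (uIcc x (x + h)) v := by
      intro v _
      have := (hf' v).hasDerivAt.sub
        (((hasDerivAt_id v).sub_const x).mul_const (deriv (deriv f) x))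
      exact (this.congr_deriv (by simp)).hasDerivWithinAt
    have := hconv.norm_image_sub_le_of_norm_hasDerivWithin_le (C := K * |h| ^ β) hd
      (fun v hv => ?_) left_mem_uIcc hu
    · have h2 := hseg u hu
      simp only [Real.norm_eq_abs, sub_self, zero_mul, sub_zero] at this
      calc _ = |deriv f u - (u - x) * deriv (deriv f) x - deriv f x| := by congr 1; ring
        _ ≤ K * |h| ^ β * |u - x| := this
        _ ≤ _ := by gcongr
    · refine (hK v x).trans ?_
      have := hseg v hv
      gcongr
  have hd : ∀ v ∈ uIcc x (x + h), HasDerivWithinAt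
      (fun v => f v - (v - x) * deriv f x - 1 / 2 * (v - x) ^ 2 * deriv (deriv f) x)
      (deriv f v - deriv f x - (v - x) * deriv (deriv f) x) (uIcc x (x + h)) v := by
    intro v _
    have h3 := ((hf v).hasDerivAt.sub (((hasDerivAt_id v).sub_const x).mul_const (deriv f x))).sub
      (((((hasDerivAt_id v).sub_const x).pow 2).const_mul (1 / 2)).mul_const (deriv (deriv f) x))
    refine (h3.congr_deriv ?_).hasDerivWithinAt
    simp
  have := hconv.norm_image_sub_le_of_norm_hasDerivWithin_le (C := K * |h| ^ β * |h|) hd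
      (fun v hv => h1 v hv) left_mem_uIcc right_mem_uIcc
  simp only [Real.norm_eq_abs, sub_self, zero_mul, sub_zero, add_sub_cancel_left] at this
  calc _ = _ := by congr 1; ring
    _ ≤ _ := this
    _ = K * |h| ^ (2 + β) := by
      rw [Real.rpow_add hh']
      rw [show |h| ^ (2 : ℝ) = |h| ^ 2 from Real.rpow_two _]
      ring

/-- Adding the Taylor estimates at steps 1 and -1 isolates the second derivative; subtracting them
isolates the first. -/
lemma abs_deriv_deriv_le {f : ℝ → ℝ} (hf : Differentiable ℝ f) (hf' : Differentiable ℝ (deriv f))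
    {K β B : ℝ} (hβ : 0 < β)
    (hK : ∀ x y, |deriv (deriv f) x - deriv (deriv f) y| ≤ K * |x - y| ^ β) {x : ℝ}
    (hB : ∀ y, |y - x| ≤ 1 → |f y| ≤ B) :
    |deriv (deriv f) x| ≤ 4 * B + 2 * K ∧ |deriv f x| ≤ 4 * B + 2 * K := by
  have h1 := abs_taylor_sub_le hf hf' hβ hK x 1
  have h2 := abs_taylor_sub_le hf hf' hβ hK x (-1)
  have h3 := hB x (by simp)
  have h4 := hB (x + 1) (by simp)
  have h5 := hB (x + -1) (by simp)
  simp only [abs_one, Real.one_rpow, abs_neg, abs_le] at h1 h2 h3 h4 h5 ⊢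
  constructor <;> constructor <;> linarith [h1.1, h1.2]

/-! ### Boundedness of coefficients of sums of powers -/

/-- Induction on the number of exponents. With F(ε) the whole sum, F(ε) - 2^p F(ε/2) eliminates the
power p and multiplies the coefficient of every other q by 1 - 2^{p-q}, which is nonzero. The bound
may depend on ε in an arbitrary way, since only finitely many values of ε enter. -/
lemma bounded_of_sum_rpow {S : Type*} (Q : Finset ℝ) :
    ∀ (U : ℝ → S → ℝ) (ε₀ : ℝ), 0 < ε₀ →
      (∀ ε, 0 < ε → ε < ε₀ → ∃ C, ∀ s, |∑ q ∈ Q, ε ^ q * U q s| ≤ C) →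
      ∀ q ∈ Q, ∃ C, ∀ s, |U q s| ≤ C := by
  induction Q using Finset.induction_on with
  | empty => simp
  | insert p Q hp ih =>
    intro U ε₀ hε₀ H
    have hQ : ∀ q ∈ Q, ∃ C, ∀ s, |U q s| ≤ C := by
      intro q hq
      have hqp : p - q ≠ 0 := fun h => hp (by rwa [sub_eq_zero.1 h])
      obtain ⟨C, hC⟩ := ih (fun q s => (1 - 2 ^ (p - q)) * U q s) ε₀ hε₀ (fun ε h0 h1 => by
        obtain ⟨C₁, h₁⟩ := H ε h0 h1
        obtain ⟨C₂, h₂⟩ := H (ε / 2) (by positivity) (by linarith)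
        refine ⟨C₁ + 2 ^ p * C₂, fun s => ?_⟩
        have key : ∑ q ∈ Q, ε ^ q * ((1 - 2 ^ (p - q)) * U q s) =
            ∑ q ∈ insert p Q, ε ^ q * U q s
              - 2 ^ p * ∑ q ∈ insert p Q, (ε / 2) ^ q * U q s := by
          rw [Finset.sum_insert hp, Finset.sum_insert hp, mul_add, Finset.mul_sum]
          have h3 : (2 : ℝ) ^ p * ((ε / 2) ^ p * U p s) = ε ^ p * U p s := by
            rw [← mul_assoc, ← Real.mul_rpow (by norm_num) (by positivity)]
            congr 2
            ring
          rw [h3, add_sub_add_left_eq_sub, ← Finset.sum_sub_distrib]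
          refine Finset.sum_congr rfl fun q _ => ?_
          rw [Real.div_rpow h0.le (by norm_num), Real.rpow_sub (by norm_num)]
          ring
        rw [key]
        refine (abs_sub _ _).trans (add_le_add (h₁ s) ?_)
        rw [abs_mul, abs_of_pos (by positivity : (0 : ℝ) < 2 ^ p)]
        exact mul_le_mul_of_nonneg_left (h₂ s) (by positivity)) q hq
      have hne : (1 - 2 ^ (p - q) : ℝ) ≠ 0 := by
        intro h
        have : (2 : ℝ) ^ (p - q) = 2 ^ (0 : ℝ) := by rw [Real.rpow_zero]; linarith
        exact hqp ((Real.rpow_right_inj (by norm_num) (by norm_num)).1 this)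
      refine ⟨C / |1 - 2 ^ (p - q)|, fun s => ?_⟩
      rw [le_div_iff₀ (abs_pos.2 hne), mul_comm, ← abs_mul]
      exact hC s
    intro q hq
    rcases Finset.mem_insert.1 hq with rfl | hq
    -- With all other coefficients bounded, a single value of ε recovers the eliminated one.
    · obtain ⟨C, hC⟩ := H (ε₀ / 2) (by positivity) (by linarith)
      choose! B hB using hQ
      refine ⟨(C + ∑ k ∈ Q, (ε₀ / 2) ^ k * B k) / (ε₀ / 2) ^ q, fun s => ?_⟩
      have hpos : 0 < (ε₀ / 2) ^ q := by positivity
      rw [le_div_iff₀ hpos, mul_comm, ← abs_of_pos hpos, ← abs_mul]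
      have h1 := hC s
      rw [Finset.sum_insert hp] at h1
      have h2 : |∑ k ∈ Q, (ε₀ / 2) ^ k * U k s| ≤ ∑ k ∈ Q, (ε₀ / 2) ^ k * B k := by
        refine (Finset.abs_sum_le_sum_abs _ _).trans (Finset.sum_le_sum fun k hk => ?_)
        rw [abs_mul, abs_of_pos (by positivity : 0 < (ε₀ / 2) ^ k)]
        exact mul_le_mul_of_nonneg_left (hB k hk s) (by positivity)
      rw [abs_le] at h1 h2 ⊢
      constructor <;> linarith [h1.1, h1.2, h2.1, h2.2]
    · exact hQ q hq

/-- Different indices may share an exponent, so only the sum over each fibre of `p` can be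
controlled. -/
lemma bounded_of_sum_rpow' {S ι : Type*} (I : Finset ι) (p : ι → ℝ) (U : ι → S → ℝ) {ε₀ : ℝ}
    (hε₀ : 0 < ε₀)
    (H : ∀ ε, 0 < ε → ε < ε₀ → ∃ C, ∀ s, |∑ i ∈ I, ε ^ p i * U i s| ≤ C) (i : ι) (hi : i ∈ I) :
    ∃ C, ∀ s, |∑ j ∈ I with p j = p i, U j s| ≤ C := by
  classical
  refine bounded_of_sum_rpow (I.image p) (fun q s => ∑ j ∈ I with p j = q, U j s) ε₀ hε₀
    (fun ε h0 h1 => ?_) (p i) (Finset.mem_image_of_mem p hi)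
  obtain ⟨C, hC⟩ := H ε h0 h1
  refine ⟨C, fun s => ?_⟩
  convert hC s using 2
  rw [← Finset.sum_fiberwise_of_maps_to (g := p) (t := I.image p)
    (fun j hj => Finset.mem_image_of_mem p hj)]
  refine Finset.sum_congr rfl fun q _ => ?_
  rw [Finset.mul_sum]
  refine Finset.sum_congr rfl fun j hj => ?_
  rw [(Finset.mem_filter.1 hj).2]

end

section

/-! ### A maximum principle on `[0,T] × ℝ` -/

/-- If the second derivative were positive, the point would also be a local minimum, so `f` would be
locally constant and its second derivative zero. -/
lemma deriv_deriv_nonpos_of_forall_le {f : ℝ → ℝ} (hf : Differentiable ℝ f) {x : ℝ} (h : ∀ y, f y ≤ f x) :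
    deriv f x = 0 ∧ deriv (deriv f) x ≤ 0 := by
  have hmax : IsLocalMax f x := Eventually.of_forall h
  have h0 := hmax.deriv_eq_zero
  refine ⟨h0, ?_⟩
  by_contra hpos
  push Not at hpos
  have hmin := isLocalMin_of_deriv_deriv_pos hpos h0 (hf x).continuousAt
  have heq : f =ᶠ[𝓝 x] fun _ => f x := by
    filter_upwards [hmin] with y hy using le_antisymm (h y) hy
  have h1 : deriv f =ᶠ[𝓝 x] deriv (fun _ => f x) := heq.deriv
  have h2 := h1.deriv_eq
  simp at h2
  linarith

lemma le_of_forall_small_mul {a b c : ℝ} (h : ∀ δ > 0, a ≤ b + δ * c) : a ≤ b := by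
  refine le_of_tendsto_of_tendsto (b := 𝓝[>] (0 : ℝ)) (f := fun _ => a) (g := fun δ => b + δ * c)
    tendsto_const_nhds ?_ (eventually_nhdsWithin_of_forall fun δ hδ => h δ hδ)
  have : Tendsto (fun δ : ℝ => b + δ * c) (𝓝 0) (𝓝 (b + 0 * c)) := by
    apply Continuous.tendsto
    fun_prop
  simpa using this.mono_left nhdsWithin_le_nhds

/-- Barrier argument: G(T-t) absorbs the source, and δ e^{l(T-t)}(1+x²)² is quartic, hence beats the
cubic growth and confines any positive maximum of the difference to a compact set. At such a maximum
the first and second order conditions contradict the equation; then δ tends to 0. No continuity of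
the coefficients is used, which matters because they will contain a merely Borel feedback map. -/
lemma le_mul_of_supersolution {T : ℝ} {f μ s g : ℝ → ℝ → ℝ} (hf : IsC12 T f)
    (hc : ContinuousOn (Function.uncurry f) (Icc 0 T ×ˢ univ)) {K G C : ℝ}
    (hμ : ∀ t ∈ Ico 0 T, ∀ x, |μ t x| ≤ K)
    (hs : ∀ t ∈ Ico 0 T, ∀ x, 0 ≤ s t x ∧ s t x ≤ K)
    (hg : ∀ t ∈ Ico 0 T, ∀ x, g t x ≤ G) (hG : 0 ≤ G)
    (hgrowth : ∀ t ∈ Icc 0 T, ∀ x, f t x ≤ C * (1 + |x| ^ 3))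
    (heq : ∀ t ∈ Ico 0 T, ∀ x, dt f t x + μ t x * dx f t x + s t x * dxx f t x + g t x = 0)
    (hterm : ∀ x, f T x ≤ 0) : ∀ t ∈ Icc 0 T, ∀ x, f t x ≤ G * T := by
  intro t₁ ht₁ x₁
  have hT : 0 ≤ T := ht₁.1.trans ht₁.2
  have hC : 0 ≤ C ∨ C < 0 := le_or_gt _ _
  rcases hC with hC | hC
  swap
  · refine (hgrowth t₁ ht₁ x₁).trans ?_
    have h1 : 0 ≤ 1 + |x₁| ^ 3 := by positivity
    nlinarith [mul_nonneg hG hT]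
  rcases hT.eq_or_lt with hT0 | hTpos
  · have : t₁ = T := le_antisymm ht₁.2 (hT0 ▸ ht₁.1)
    rw [this, show G * T = 0 by rw [← hT0, mul_zero]]
    exact hterm x₁
  have hK : 0 ≤ K := (abs_nonneg _).trans (hμ 0 ⟨le_rfl, hTpos⟩ 0)
  -- The first order term costs at most 4K and the second order term at most 6K times the barrier;
  -- the extra 1 makes the contradiction strict.
  set l : ℝ := 10 * K + 1 with hl
  suffices hmain : ∀ δ > 0, f t₁ x₁ ≤ G * T + δ * (Real.exp (l * (T - t₁)) * (1 + x₁ ^ 2) ^ 2) from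
    le_of_forall_small_mul hmain
  intro δ hδ
  set w : ℝ → ℝ → ℝ := fun t x =>
    f t x - G * (T - t) - δ * (Real.exp (l * (T - t)) * (1 + x ^ 2) ^ 2) with hw
  suffices hw1 : w t₁ x₁ ≤ 0 by
    have : G * (T - t₁) ≤ G * T := by nlinarith [ht₁.1]
    simp only [hw] at hw1
    linarith
  by_contra hneg
  push Not at hneg
  -- `w` is negative outside a compact set
  set R : ℝ := 2 * C / δ + 1 + |x₁| with hR
  have hR1 : 1 ≤ R := by
    have : 0 ≤ 2 * C / δ := by positivity
    have := abs_nonneg x₁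
    linarith
  have hout : ∀ t ∈ Icc 0 T, ∀ x, R ≤ |x| → w t x ≤ 0 := by
    intro t ht x hx
    have h1 := hgrowth t ht x
    have he : 1 ≤ Real.exp (l * (T - t)) := by
      apply Real.one_le_exp
      have := ht.2
      have : 0 ≤ T - t := by linarith
      positivity
    have hx1 : 1 ≤ |x| := hR1.trans hx
    have h2 : (1 + x ^ 2) ^ 2 ≤ Real.exp (l * (T - t)) * (1 + x ^ 2) ^ 2 :=
      le_mul_of_one_le_left (by positivity) he
    have h3 : C * (1 + |x| ^ 3) ≤ δ * (1 + x ^ 2) ^ 2 := by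
      have h4 : 2 * C ≤ δ * |x| := by
        have : 2 * C / δ ≤ |x| := by
          have := abs_nonneg x₁
          linarith
        rwa [div_le_iff₀ hδ, mul_comm |x|] at this
      have h5 : 1 ≤ |x| ^ 3 := one_le_pow₀ hx1
      have h6 : C * (1 + |x| ^ 3) ≤ 2 * C * |x| ^ 3 := by nlinarith
      have h7 : 2 * C * |x| ^ 3 ≤ δ * |x| * |x| ^ 3 :=
        mul_le_mul_of_nonneg_right h4 (by positivity)
      have h8 : δ * |x| * |x| ^ 3 = δ * (x ^ 2) ^ 2 := by
        rw [← sq_abs x]; ring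
      have h9 : δ * (x ^ 2) ^ 2 ≤ δ * (1 + x ^ 2) ^ 2 := by
        gcongr
        linarith
      linarith
    have h10 : 0 ≤ G * (T - t) := mul_nonneg hG (by linarith [ht.2])
    simp only [hw]
    have := mul_le_mul_of_nonneg_left h2 hδ.le
    linarith
  have hwc : ContinuousOn (Function.uncurry w) (Icc 0 T ×ˢ Icc (-R) R) := by
    have h1 : ContinuousOn (Function.uncurry f) (Icc 0 T ×ˢ Icc (-R) R) :=
      hc.mono (prod_mono le_rfl (subset_univ _))
    have h2 : Continuous fun p : ℝ × ℝ => G * (T - p.1) := by fun_prop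
    have h3 : Continuous fun p : ℝ × ℝ =>
        δ * (Real.exp (l * (T - p.1)) * (1 + p.2 ^ 2) ^ 2) := by fun_prop
    exact (h1.sub h2.continuousOn).sub h3.continuousOn
  have hx₁R : x₁ ∈ Icc (-R) R := by
    rw [mem_Icc, ← abs_le]
    have : 0 ≤ 2 * C / δ := by positivity
    linarith
  obtain ⟨⟨t, x⟩, ⟨ht, hx⟩, hmax⟩ := (isCompact_Icc.prod isCompact_Icc).exists_isMaxOn
    ⟨(t₁, x₁), ⟨ht₁, hx₁R⟩⟩ hwc
  simp only at ht hx
  have hwpos : 0 < w t x := hneg.trans_le (hmax (show (t₁, x₁) ∈ _ from ⟨ht₁, hx₁R⟩))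
  have hglob : ∀ s ∈ Icc 0 T, ∀ y, w s y ≤ w t x := by
    intro s hs y
    rcases le_or_gt R |y| with hy | hy
    · exact (hout s hs y hy).trans hwpos.le
    · exact hmax (show (s, y) ∈ _ from ⟨hs, abs_le.1 hy.le⟩)
  have htT : t < T := by
    refine lt_of_le_of_ne ht.2 fun h => ?_
    have h1 : w t x ≤ 0 := by
      have h2 := hterm x
      have h3 : 0 ≤ δ * (Real.exp (l * (T - t)) * (1 + x ^ 2) ^ 2) := by positivity
      simp only [hw, h] at h3 ⊢
      linarith
    linarith
  have htI : t ∈ Ico 0 T := ⟨ht.1, htT⟩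
  set E := Real.exp (l * (T - t)) with hE
  have hEpos : 0 < E := Real.exp_pos _
  -- space derivatives at the maximum
  have hψ : ∀ y : ℝ, HasDerivAt (fun y : ℝ => (1 + y ^ 2) ^ 2) (4 * y * (1 + y ^ 2)) y := by
    intro y
    have := (((hasDerivAt_id y).pow 2).const_add 1).pow 2
    refine this.congr_deriv ?_
    simp
    ring
  have hψ' : ∀ y : ℝ, HasDerivAt (fun y : ℝ => 4 * y * (1 + y ^ 2)) (4 + 12 * y ^ 2) y := by
    intro y
    have := ((hasDerivAt_id y).const_mul 4).mul (((hasDerivAt_id y).pow 2).const_add 1)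
    refine this.congr_deriv ?_
    simp
    ring
  have hwx : ∀ y, HasDerivAt (w t) (deriv (f t) y - δ * (E * (4 * y * (1 + y ^ 2)))) y := by
    intro y
    exact ((hf.diff_x t htI y).hasDerivAt.sub_const _).sub (((hψ y).const_mul E).const_mul δ)
  have hwx' : deriv (w t) = fun y => deriv (f t) y - δ * (E * (4 * y * (1 + y ^ 2))) :=
    funext fun y => (hwx y).deriv
  have hwxx : ∀ y, HasDerivAt (deriv (w t))
      (deriv (deriv (f t)) y - δ * (E * (4 + 12 * y ^ 2))) y := by
    intro y
    rw [hwx']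
    exact (hf.diff_xx t htI y).hasDerivAt.sub (((hψ' y).const_mul E).const_mul δ)
  obtain ⟨hd1, hd2⟩ := deriv_deriv_nonpos_of_forall_le (f := w t) (x := x)
    (fun y => (hwx y).differentiableAt) (fun y => hglob t ht y)
  rw [(hwx x).deriv] at hd1
  rw [(hwxx x).deriv] at hd2
  -- time derivative at the maximum
  have hwt : HasDerivWithinAt (fun s => w s x)
      (dt f t x + G + δ * (l * E * (1 + x ^ 2) ^ 2)) (Ici 0) t := by
    have h1 := (hf.diff_t t htI x).hasDerivWithinAt
    have h2 : HasDerivAt (fun s => G * (T - s)) (-G) t := by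
      have := ((hasDerivAt_id t).const_sub T).const_mul G
      simpa using this
    have h3 : HasDerivAt (fun s => δ * (Real.exp (l * (T - s)) * (1 + x ^ 2) ^ 2))
        (-(δ * (l * E * (1 + x ^ 2) ^ 2))) t := by
      have := (((((hasDerivAt_id t).const_sub T).const_mul l).exp).mul_const
        ((1 + x ^ 2) ^ 2)).const_mul δ
      refine this.congr_deriv ?_
      simp only [id]
      ring
    have := (h1.sub h2.hasDerivWithinAt).sub h3.hasDerivWithinAt
    refine this.congr_deriv ?_
    simp only [dt]
    ring
  -- Only later times are compared, so a maximum at time 0 is covered too.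
  have hd3 : dt f t x + G + δ * (l * E * (1 + x ^ 2) ^ 2) ≤ 0 := by
    have h1 := (hwt.mono (Ioi_subset_Ici ht.1 : Ioi t ⊆ Ici 0))
    rw [hasDerivWithinAt_iff_tendsto_slope' (by simp)] at h1
    refine le_of_tendsto h1 ?_
    have : Ioo t T ∈ 𝓝[>] t := Ioo_mem_nhdsGT htT
    filter_upwards [this] with s hs
    rw [slope_def_field]
    refine div_nonpos_of_nonpos_of_nonneg ?_ (by linarith [hs.1])
    have := hglob s ⟨ht.1.trans hs.1.le, hs.2.le⟩ x
    linarith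
  have he := heq t htI x
  have hm := hμ t htI x
  have hss := hs t htI x
  have hgg := hg t htI x
  simp only [dx, dxx] at he
  have hfx : deriv (f t) x = δ * (E * (4 * x * (1 + x ^ 2))) := by linarith
  have hbound1 : μ t x * deriv (f t) x ≤ δ * E * (4 * K * (1 + x ^ 2) ^ 2) := by
    rw [hfx]
    have h1 : μ t x * x ≤ K * (1 + x ^ 2) := by
      calc μ t x * x ≤ |μ t x| * |x| := by rw [← abs_mul]; exact le_abs_self _
        _ ≤ K * (1 + x ^ 2) := by
          refine mul_le_mul hm ?_ (abs_nonneg _) hK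
          rw [← sq_abs]
          nlinarith [sq_nonneg (|x| - 1)]
    calc _ = δ * E * (4 * (1 + x ^ 2)) * (μ t x * x) := by ring
      _ ≤ δ * E * (4 * (1 + x ^ 2)) * (K * (1 + x ^ 2)) := by gcongr
      _ = _ := by ring
  have hbound2 : s t x * deriv (deriv (f t)) x ≤ δ * E * (6 * K * (1 + x ^ 2) ^ 2) := by
    calc s t x * deriv (deriv (f t)) x ≤ s t x * (δ * (E * (4 + 12 * x ^ 2))) :=
          mul_le_mul_of_nonneg_left (by linarith) hss.1
      _ ≤ K * (δ * (E * (4 + 12 * x ^ 2))) := by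
          refine mul_le_mul_of_nonneg_right hss.2 (by positivity)
      _ = δ * E * (K * (4 + 12 * x ^ 2)) := by ring
      _ ≤ δ * E * (K * (6 * (1 + x ^ 2) ^ 2)) := by
          gcongr
          nlinarith [sq_nonneg (x ^ 2)]
      _ = _ := by ring
  have hfinal : 0 < δ * E * (1 + x ^ 2) ^ 2 := by positivity
  have : δ * (l * E * (1 + x ^ 2) ^ 2) = δ * E * (4 * K * (1 + x ^ 2) ^ 2)
    + δ * E * (6 * K * (1 + x ^ 2) ^ 2) + δ * E * (1 + x ^ 2) ^ 2 := by rw [hl]; ring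
  linarith

lemma abs_le_mul_of_linear_equation {T : ℝ} {f μ s g : ℝ → ℝ → ℝ} (hf : IsC12 T f)
    (hc : ContinuousOn (Function.uncurry f) (Icc 0 T ×ˢ univ)) {K G C : ℝ}
    (hμ : ∀ t ∈ Ico 0 T, ∀ x, |μ t x| ≤ K)
    (hs : ∀ t ∈ Ico 0 T, ∀ x, 0 ≤ s t x ∧ s t x ≤ K)
    (hg : ∀ t ∈ Ico 0 T, ∀ x, |g t x| ≤ G) (hG : 0 ≤ G)
    (hgrowth : ∀ t ∈ Icc 0 T, ∀ x, |f t x| ≤ C * (1 + |x| ^ 3))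
    (heq : ∀ t ∈ Ico 0 T, ∀ x, dt f t x + μ t x * dx f t x + s t x * dxx f t x + g t x = 0)
    (hterm : ∀ x, f T x = 0) : ∀ t ∈ Icc 0 T, ∀ x, |f t x| ≤ G * T := by
  intro t ht x
  rw [abs_le']
  refine ⟨le_mul_of_supersolution hf hc hμ hs (fun t ht x => (le_abs_self _).trans (hg t ht x)) hG
    (fun t ht x => (le_abs_self _).trans (hgrowth t ht x)) heq (fun x => (hterm x).le) t ht x, ?_⟩
  set f' : ℝ → ℝ → ℝ := fun t x => -f t x with hf'
  have e1 : dt f' = fun t x => -dt f t x := by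
    funext t x
    exact derivWithin.fun_neg
  have e2 : ∀ t, deriv (f' t) = fun x => -deriv (f t) x := fun t => funext fun x => deriv.fun_neg
  have e3 : ∀ t, deriv (deriv (f' t)) = fun x => -deriv (deriv (f t)) x := fun t => by
    rw [e2]; exact funext fun x => deriv.fun_neg
  have h12 : IsC12 T f' := by
    refine ⟨fun t ht x => (hf.diff_t t ht x).neg, fun t ht => (hf.diff_x t ht).neg, fun t ht => ?_,
      hf.cont.neg, ?_, ?_, ?_⟩
    · rw [e2]; exact (hf.diff_xx t ht).neg
    · rw [e1]; exact hf.cont_dt.neg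
    · have : dx f' = fun t x => -dx f t x := funext fun t => e2 t
      rw [this]; exact hf.cont_dx.neg
    · have : dxx f' = fun t x => -dxx f t x := funext fun t => e3 t
      rw [this]; exact hf.cont_dxx.neg
  refine le_mul_of_supersolution (f := f') (μ := μ) (s := s) (g := fun t x => -g t x) h12 hc.neg
    hμ hs (fun t ht x => (neg_le_abs _).trans (hg t ht x)) hG
    (fun t ht x => (neg_le_abs _).trans (hgrowth t ht x)) (fun t ht x => ?_)
    (fun x => by simp [hf', hterm x]) t ht x
  have := heq t ht x
  simp only [dx, dxx, e3, e1] at this ⊢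
  rw [e2]
  linarith

/-! ### Growth of functions with Hölder second space derivative -/

/-- Compactness bounds `f` on [0,T] × [-1,1], interpolation then bounds its first two space
derivatives at 0, and Taylor's formula from 0 has a remainder of order 2 + β ≤ 3. This supplies the
growth required by the maximum principle. -/
lemma exists_cubic_growth {T β : ℝ} {f : ℝ → ℝ → ℝ} (hβ : β ∈ Ioc (0 : ℝ) 1) (hf : IsC12 T f)
    (hc : ContinuousOn (Function.uncurry f) (Icc 0 T ×ˢ univ))
    (hh : IsHolderInSpace T β (dxx f)) (hterm : ∀ x, f T x = 0) :
    ∃ C, ∀ t ∈ Icc 0 T, ∀ x, |f t x| ≤ C * (1 + |x| ^ 3) := by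
  obtain ⟨K, hK⟩ := hh
  obtain ⟨B, hB⟩ := (isCompact_Icc.prod (isCompact_Icc (a := (-1 : ℝ)) (b := 1))).exists_bound_of_continuousOn
    (hc.mono (prod_mono le_rfl (subset_univ _)))
  set D := 4 * |B| + 2 * |K| with hD
  refine ⟨|B| + 2 * D + |K|, fun t ht x => ?_⟩
  rcases ht.2.eq_or_lt with rfl | hlt
  · rw [hterm x, abs_zero]
    positivity
  have htI : t ∈ Ico 0 T := ⟨ht.1, hlt⟩
  have hK' : ∀ x y, |deriv (deriv (f t)) x - deriv (deriv (f t)) y| ≤ |K| * |x - y| ^ β :=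
    fun x y => (hK t htI x y).trans
      (mul_le_mul_of_nonneg_right (le_abs_self K) (by positivity))
  have hB' : ∀ y, |y - 0| ≤ 1 → |f t y| ≤ |B| := fun y hy => by
    rw [sub_zero, abs_le] at hy
    exact (hB (t, y) ⟨ht, hy⟩).trans (le_abs_self B)
  obtain ⟨h2, h1⟩ := abs_deriv_deriv_le (hf.diff_x t htI) (hf.diff_xx t htI) hβ.1 hK' hB'
  have h0 := hB' 0 (by simp)
  have h3 := abs_taylor_sub_le (hf.diff_x t htI) (hf.diff_xx t htI) hβ.1 hK' 0 x
  rw [zero_add] at h3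
  set X := |x| with hX
  have hX0 : 0 ≤ X := abs_nonneg x
  have hp : X ^ (2 + β) ≤ 1 + X ^ 3 := by
    rcases le_total X 1 with h | h
    · have : X ^ (2 + β) ≤ 1 := Real.rpow_le_one hX0 h (by linarith [hβ.1])
      have : 0 ≤ X ^ 3 := by positivity
      linarith
    · have : X ^ (2 + β) ≤ X ^ (3 : ℝ) := Real.rpow_le_rpow_of_exponent_le h (by linarith [hβ.2])
      rw [show X ^ (3 : ℝ) = X ^ 3 by norm_cast] at this
      linarith
  have hp1 : X ≤ 1 + X ^ 3 := by
    rcases le_total X 1 with h | h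
    · have : 0 ≤ X ^ 3 := by positivity
      linarith
    · nlinarith [mul_nonneg hX0 (sub_nonneg.2 h), mul_nonneg (mul_nonneg hX0 hX0) (sub_nonneg.2 h)]
  have hp2 : X ^ 2 ≤ 1 + X ^ 3 := by
    rcases le_total X 1 with h | h
    · have : 0 ≤ X ^ 3 := by positivity
      nlinarith
    · nlinarith [mul_nonneg (mul_nonneg hX0 hX0) (sub_nonneg.2 h)]
  have hp0 : 1 ≤ 1 + X ^ 3 := by
    have : 0 ≤ X ^ 3 := by positivity
    linarith
  have hD0 : 0 ≤ D := by positivity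
  have e1 : |x * deriv (f t) 0| ≤ D * X := by
    rw [abs_mul, mul_comm]; exact mul_le_mul_of_nonneg_right h1 hX0
  have e2 : |1 / 2 * x ^ 2 * deriv (deriv (f t)) 0| ≤ D * X ^ 2 := by
    rw [abs_mul, abs_mul, abs_pow, abs_of_pos (by norm_num : (0 : ℝ) < 1 / 2)]
    have := mul_le_mul_of_nonneg_right h2 (by positivity : 0 ≤ X ^ 2)
    have h4 : 0 ≤ D * X ^ 2 := by positivity
    nlinarith
  have e3 : |f t x| ≤ |f t x - f t 0 - x * deriv (f t) 0 - 1 / 2 * x ^ 2 * deriv (deriv (f t)) 0|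
      + |f t 0| + |x * deriv (f t) 0| + |1 / 2 * x ^ 2 * deriv (deriv (f t)) 0| := by
    have := abs_add_le (f t x - f t 0 - x * deriv (f t) 0 - 1 / 2 * x ^ 2 * deriv (deriv (f t)) 0
      + f t 0 + x * deriv (f t) 0) (1 / 2 * x ^ 2 * deriv (deriv (f t)) 0)
    have h5 := abs_add_le (f t x - f t 0 - x * deriv (f t) 0
      - 1 / 2 * x ^ 2 * deriv (deriv (f t)) 0 + f t 0) (x * deriv (f t) 0)
    have h6 := abs_add_le (f t x - f t 0 - x * deriv (f t) 0
      - 1 / 2 * x ^ 2 * deriv (deriv (f t)) 0) (f t 0)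
    have h7 : f t x - f t 0 - x * deriv (f t) 0 - 1 / 2 * x ^ 2 * deriv (deriv (f t)) 0
      + f t 0 + x * deriv (f t) 0 + 1 / 2 * x ^ 2 * deriv (deriv (f t)) 0 = f t x := by ring
    rw [h7] at this
    linarith
  have e4 := mul_le_mul_of_nonneg_left hp (abs_nonneg K)
  have e5 := mul_le_mul_of_nonneg_left hp1 hD0
  have e6 := mul_le_mul_of_nonneg_left hp2 hD0
  have e7 := mul_le_mul_of_nonneg_left hp0 (abs_nonneg B)
  nlinarith

end

section

variable {M : Data}

/-! ### Integrability of the coefficients -/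

namespace Data.Standing

lemma exists_bound (hM : M.Standing) : ∃ K, 1 ≤ K ∧ (∀ x a e, |M.b₁ x a e| ≤ K) ∧
    (∀ x a e, |M.b₂ x a e| ≤ K) ∧ ∀ x a, |M.r x a| ≤ K := by
  obtain ⟨K₁, h₁⟩ := hM.bounded_b₁
  obtain ⟨K₂, h₂⟩ := hM.bounded_b₂
  obtain ⟨K₃, h₃⟩ := hM.bounded_r
  refine ⟨1 ⊔ K₁ ⊔ K₂ ⊔ K₃, by simp, fun x a e => (h₁ x a e).trans ?_,
    fun x a e => (h₂ x a e).trans ?_, fun x a => (h₃ x a).trans ?_⟩ <;> simp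

lemma measurable_b₁_mark (hM : M.Standing) (x : ℝ) (a : M.A) : Measurable (M.b₁ x a) :=
  hM.measurable_b₁.comp (measurable_const.prodMk (measurable_const.prodMk measurable_id))

lemma measurable_b₂_mark (hM : M.Standing) (x : ℝ) (a : M.A) : Measurable (M.b₂ x a) :=
  hM.measurable_b₂.comp (measurable_const.prodMk (measurable_const.prodMk measurable_id))

lemma measurable_bEps (hM : M.Standing) (ε : ℝ) :
    Measurable fun p : ℝ × M.A × ℝ => M.bEps ε p.1 p.2.1 p.2.2 :=
  (hM.measurable_b₁.const_mul ε).add (hM.measurable_b₂.const_mul √ε)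

lemma measurable_bEps_mark (hM : M.Standing) (ε x : ℝ) (a : M.A) : Measurable (M.bEps ε x a) :=
  ((hM.measurable_b₁_mark x a).const_mul ε).add ((hM.measurable_b₂_mark x a).const_mul √ε)

lemma integrable_of_abs_le (hM : M.Standing) {φ : ℝ → ℝ} (hφ : Measurable φ) {C : ℝ}
    (h : ∀ e, |φ e| ≤ C) : Integrable φ M.ν := by
  have := hM.isProbabilityMeasure_ν
  exact Integrable.of_bound hφ.aestronglyMeasurable C (ae_of_all _ h)

lemma abs_integral_le (hM : M.Standing) {φ : ℝ → ℝ} {C : ℝ} (h : ∀ e, |φ e| ≤ C) :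
    |∫ e, φ e ∂M.ν| ≤ C := by
  have := hM.isProbabilityMeasure_ν
  have := norm_integral_le_of_norm_le_const (μ := M.ν) (f := φ) (C := C) (ae_of_all _ h)
  simpa using this

lemma abs_drift_le (hM : M.Standing) {K : ℝ} (h : ∀ x a e, |M.b₁ x a e| ≤ K) (x : ℝ) (a : M.A) :
    |M.drift x a| ≤ K := hM.abs_integral_le (h x a)

lemma vol_sq (x : ℝ) (a : M.A) : M.vol x a ^ 2 = ∫ e, |M.b₂ x a e| ^ 2 ∂M.ν :=
  Real.sq_sqrt (integral_nonneg fun _ => by positivity)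

lemma vol_sq_le (hM : M.Standing) {K : ℝ} (h : ∀ x a e, |M.b₂ x a e| ≤ K) (x : ℝ) (a : M.A) :
    M.vol x a ^ 2 ≤ K ^ 2 := by
  rw [vol_sq]
  refine (le_abs_self _).trans (hM.abs_integral_le fun e => ?_)
  rw [abs_of_nonneg (by positivity)]
  exact pow_le_pow_left₀ (abs_nonneg _) (h x a e) 2

lemma abs_bEps_le {K ε : ℝ} (h₁ : ∀ x a e, |M.b₁ x a e| ≤ K) (h₂ : ∀ x a e, |M.b₂ x a e| ≤ K)
    (hε : ε ∈ Ioo (0 : ℝ) 1) (x : ℝ) (a : M.A) (e : ℝ) : |M.bEps ε x a e| ≤ √ε * (2 * K) := by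
  have hs : ε ≤ √ε := by
    rw [Real.le_sqrt hε.1.le hε.1.le]
    nlinarith [hε.1, hε.2]
  have h0 := Real.sqrt_nonneg ε
  calc |M.bEps ε x a e| ≤ |ε * M.b₁ x a e| + |√ε * M.b₂ x a e| := abs_add_le _ _
    _ = ε * |M.b₁ x a e| + √ε * |M.b₂ x a e| := by
      rw [abs_mul, abs_mul, abs_of_pos hε.1, abs_of_nonneg h0]
    _ ≤ √ε * K + √ε * K := by
      refine add_le_add (mul_le_mul hs (h₁ x a e) (abs_nonneg _) h0)
        (mul_le_mul_of_nonneg_left (h₂ x a e) h0)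
    _ = _ := by ring

/-- Jumps are bounded, so `f` is evaluated on a compact interval only and no growth condition is
needed. -/
lemma integrable_comp_jump (hM : M.Standing) {ε : ℝ} (hε : ε ∈ Ioo (0 : ℝ) 1) {f : ℝ → ℝ}
    (hf : Continuous f) (x : ℝ) (a : M.A) : Integrable (fun e => f (x + M.bEps ε x a e)) M.ν := by
  obtain ⟨K, hK1, h₁, h₂, -⟩ := hM.exists_bound
  obtain ⟨C, hC⟩ := (isCompact_Icc (a := x - √ε * (2 * K))
    (b := x + √ε * (2 * K))).exists_bound_of_continuousOn hf.continuousOn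
  refine hM.integrable_of_abs_le (C := C)
    (hf.measurable.comp ((hM.measurable_bEps_mark ε x a).const_add x)) fun e => hC _ ?_
  have := abs_le.1 (abs_bEps_le h₁ h₂ hε x a e)
  constructor <;> linarith [this.1, this.2]

end Data.Standing

/-! ### The error made when the jump generator is replaced by the diffusion generator -/

/-- The integrated Taylor error of `f` over one jump. -/
def jumpError (M : Data) (ε : ℝ) (f : ℝ → ℝ → ℝ) (t x : ℝ) (a : M.A) : ℝ :=
  ∫ e, (ε⁻¹ * (f t (x + M.bEps ε x a e) - f t x) - M.b₁ x a e * dx f t x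
    - 1 / 2 * |M.b₂ x a e| ^ 2 * dxx f t x) ∂M.ν

/-- `∫ b₁ b₂ dν`. -/
def crossMoment (M : Data) (x : ℝ) (a : M.A) : ℝ := ∫ e, M.b₁ x a e * M.b₂ x a e ∂M.ν

/-- `½ ∫ b₁² dν`. -/
def halfSecondMoment (M : Data) (x : ℝ) (a : M.A) : ℝ := 1 / 2 * ∫ e, M.b₁ x a e ^ 2 ∂M.ν

lemma integrable_sq_b₂ (hM : M.Standing) (x : ℝ) (a : M.A) : Integrable (fun e => |M.b₂ x a e| ^ 2) M.ν := by
  obtain ⟨K, hK1, h₁, h₂, -⟩ := hM.exists_bound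
  have := hM.measurable_b₂_mark x a
  refine hM.integrable_of_abs_le (C := K ^ 2) (by fun_prop) fun e => ?_
  rw [abs_of_nonneg (by positivity)]
  exact pow_le_pow_left₀ (abs_nonneg _) (h₂ x a e) 2

lemma integrable_b₁ (hM : M.Standing) (x : ℝ) (a : M.A) : Integrable (M.b₁ x a) M.ν := by
  obtain ⟨K, hK1, h₁, h₂, -⟩ := hM.exists_bound
  exact hM.integrable_of_abs_le (hM.measurable_b₁_mark x a) (h₁ x a)

lemma integrable_jumpError (hM : M.Standing) {ε : ℝ} (hε : ε ∈ Ioo (0 : ℝ) 1) {f : ℝ → ℝ → ℝ} {t : ℝ}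
    (hf : Continuous (f t)) (x : ℝ) (a : M.A) :
    Integrable (fun e => ε⁻¹ * (f t (x + M.bEps ε x a e) - f t x) - M.b₁ x a e * dx f t x
      - 1 / 2 * |M.b₂ x a e| ^ 2 * dxx f t x) M.ν := by
  have := hM.isProbabilityMeasure_ν
  exact ((((hM.integrable_comp_jump hε hf x a).sub (integrable_const _)).const_mul _).sub
    ((integrable_b₁ hM x a).mul_const _)).sub (((integrable_sq_b₂ hM x a).const_mul _).mul_const _)

lemma jumpError_eq (hM : M.Standing) {ε : ℝ} (hε : ε ∈ Ioo (0 : ℝ) 1) {f : ℝ → ℝ → ℝ} {t : ℝ}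
    (hf : Continuous (f t)) (x : ℝ) (a : M.A) :
    jumpError M ε f t x a = ε⁻¹ * ∫ e, (f t (x + M.bEps ε x a e) - f t x) ∂M.ν
      - diffusionOp M f t x a := by
  have := hM.isProbabilityMeasure_ν
  have i1 := ((hM.integrable_comp_jump hε hf x a).sub (integrable_const (f t x))).const_mul ε⁻¹
  have i2 := (integrable_b₁ hM x a).mul_const (dx f t x)
  have i3 := ((integrable_sq_b₂ hM x a).const_mul (1 / 2)).mul_const (dxx f t x)
  have e1 := integral_sub (i1.sub i2) i3
  have e2 := integral_sub i1 i2
  simp only [Pi.sub_apply] at e1 e2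
  rw [jumpError, e1, e2, integral_const_mul, integral_mul_const, integral_mul_const,
    integral_const_mul, diffusionOp, Data.drift, Data.Standing.vol_sq]
  ring

/-- In the second order Taylor polynomial, centring of b₂ removes the singular term ε^{-1/2} b₂ ∂_x
f, and expanding (εb₁ + √ε b₂)² leaves the two explicit terms subtracted here. They are kept apart
because ∂²_{xx} f is not known to be bounded at this stage. The Taylor remainder gives
ε⁻¹(2K√ε)^{2+β}, the right-hand side up to the factor H. -/
lemma abs_jumpError_sub_le (hM : M.Standing) {K : ℝ} (hK1 : 1 ≤ K) (h₁ : ∀ x a e, |M.b₁ x a e| ≤ K)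
    (h₂ : ∀ x a e, |M.b₂ x a e| ≤ K) {ε : ℝ} (hε : ε ∈ Ioo (0 : ℝ) 1) {f : ℝ → ℝ → ℝ} {t : ℝ}
    (hf : Differentiable ℝ (f t)) (hf' : Differentiable ℝ (deriv (f t))) {H β : ℝ} (hβ : 0 < β)
    (hH : ∀ x y, |dxx f t x - dxx f t y| ≤ H * |x - y| ^ β) (x : ℝ) (a : M.A) :
    |jumpError M ε f t x a - √ε * crossMoment M x a * dxx f t x
      - ε * halfSecondMoment M x a * dxx f t x| ≤ H * (2 * K) ^ (2 + β) * ε ^ (β / 2) := by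
  have := hM.isProbabilityMeasure_ν
  have hs : √ε * √ε = ε := Real.mul_self_sqrt hε.1.le
  have hs0 : 0 < √ε := Real.sqrt_pos.2 hε.1
  have hε0 : ε ≠ 0 := hε.1.ne'
  have hm1 := hM.measurable_b₁_mark x a
  have hm2 := hM.measurable_b₂_mark x a
  have i0 := integrable_jumpError hM hε hf.continuous x a
  have i12 : Integrable (fun e => M.b₁ x a e * M.b₂ x a e) M.ν :=
    hM.integrable_of_abs_le (C := K * K) (by fun_prop) fun e => by
      rw [abs_mul]
      exact mul_le_mul (h₁ x a e) (h₂ x a e) (abs_nonneg _) (by linarith)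
  have i11 : Integrable (fun e => M.b₁ x a e ^ 2) M.ν :=
    hM.integrable_of_abs_le (C := K ^ 2) (by fun_prop) fun e => by
      rw [abs_pow]
      exact pow_le_pow_left₀ (abs_nonneg _) (h₁ x a e) 2
  have i2 : Integrable (M.b₂ x a) M.ν := hM.integrable_of_abs_le hm2 (h₂ x a)
  have key : jumpError M ε f t x a - √ε * crossMoment M x a * dxx f t x
      - ε * halfSecondMoment M x a * dxx f t x =
      ∫ e, ε⁻¹ * (f t (x + M.bEps ε x a e) - f t x - M.bEps ε x a e * deriv (f t) x
        - 1 / 2 * M.bEps ε x a e ^ 2 * deriv (deriv (f t)) x) ∂M.ν := by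
    have e1 : ∀ e, ε⁻¹ * (f t (x + M.bEps ε x a e) - f t x - M.bEps ε x a e * deriv (f t) x
        - 1 / 2 * M.bEps ε x a e ^ 2 * deriv (deriv (f t)) x) =
        (ε⁻¹ * (f t (x + M.bEps ε x a e) - f t x) - M.b₁ x a e * dx f t x
          - 1 / 2 * |M.b₂ x a e| ^ 2 * dxx f t x)
        - M.b₁ x a e * M.b₂ x a e * (√ε * dxx f t x)
        - M.b₁ x a e ^ 2 * (ε / 2 * dxx f t x) - M.b₂ x a e * (ε⁻¹ * √ε * dx f t x) := by
      intro e
      have h3 : ε⁻¹ * ε = 1 := inv_mul_cancel₀ hε0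
      simp only [dx, dxx, Data.bEps, sq_abs]
      linear_combination (-(M.b₁ x a e * deriv (f t) x)
        - (1 / 2 * ε * M.b₁ x a e ^ 2 + √ε * M.b₁ x a e * M.b₂ x a e
          + 1 / 2 * M.b₂ x a e ^ 2) * deriv (deriv (f t)) x) * h3
        - ε⁻¹ * (1 / 2) * M.b₂ x a e ^ 2 * deriv (deriv (f t)) x * hs
    simp_rw [e1]
    have j1 := i12.mul_const (√ε * dxx f t x)
    have j2 := i11.mul_const (ε / 2 * dxx f t x)
    have j3 := i2.mul_const (ε⁻¹ * √ε * dx f t x)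
    have q1 := integral_sub ((i0.sub j1).sub j2) j3
    have q2 := integral_sub (i0.sub j1) j2
    have q3 := integral_sub i0 j1
    simp only [Pi.sub_apply] at q1 q2 q3
    rw [q1, q2, q3, integral_mul_const, integral_mul_const, integral_mul_const, hM.centred]
    simp only [jumpError, crossMoment, halfSecondMoment]
    ring
  rw [key]
  refine hM.abs_integral_le fun e => ?_
  have hH0 : 0 ≤ H := by
    have := (abs_nonneg _).trans (hH 1 0)
    simpa using this
  have h3 := abs_taylor_sub_le hf hf' hβ hH x (M.bEps ε x a e)
  have h4 := Data.Standing.abs_bEps_le h₁ h₂ hε x a e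
  rw [abs_mul, abs_of_pos (inv_pos.2 hε.1)]
  calc _ ≤ ε⁻¹ * (H * (√ε * (2 * K)) ^ (2 + β)) := by
        refine mul_le_mul_of_nonneg_left (h3.trans ?_) (inv_pos.2 hε.1).le
        gcongr
    _ = H * (2 * K) ^ (2 + β) * (ε⁻¹ * √ε ^ (2 + β)) := by
        rw [Real.mul_rpow hs0.le (by linarith)]
        ring
    _ = _ := by
        congr 1
        rw [Real.sqrt_eq_rpow, ← Real.rpow_mul hε.1.le, ← Real.rpow_neg_one, ← Real.rpow_add hε.1]
        congr 1
        ring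

lemma abs_crossMoment_le (hM : M.Standing) {K : ℝ} (h₁ : ∀ x a e, |M.b₁ x a e| ≤ K)
    (h₂ : ∀ x a e, |M.b₂ x a e| ≤ K) (x : ℝ) (a : M.A) : |crossMoment M x a| ≤ K ^ 2 := by
  refine hM.abs_integral_le fun e => ?_
  rw [abs_mul, sq]
  exact mul_le_mul (h₁ x a e) (h₂ x a e) (abs_nonneg _) ((abs_nonneg _).trans (h₁ x a e))

lemma abs_halfSecondMoment_le (hM : M.Standing) {K : ℝ} (h₁ : ∀ x a e, |M.b₁ x a e| ≤ K) (x : ℝ) (a : M.A) :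
    |halfSecondMoment M x a| ≤ K ^ 2 := by
  have : |∫ e, M.b₁ x a e ^ 2 ∂M.ν| ≤ K ^ 2 := hM.abs_integral_le fun e => by
    rw [abs_pow]
    exact pow_le_pow_left₀ (abs_nonneg _) (h₁ x a e) 2
  rw [halfSecondMoment, abs_mul, abs_of_pos (by norm_num : (0 : ℝ) < 1 / 2)]
  nlinarith [sq_nonneg K]

end

section

variable {M : Data}

/-! ### Telescoping the remainders -/

/-- `∫ (ε^{-δβ_{i-1}/2} δr^{i-1,ε} - r^i)(·,e) ν(de)`. -/
def defect (M : Data) (δβ : ℕ → ℝ) (δV : ℕ → ℝ → ℝ → ℝ) (ρ : ℕ → ℝ → ℝ → M.A → ℝ) (ε : ℝ)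
    (i : ℕ) (t x : ℝ) (a : M.A) : ℝ :=
  ∫ e, (ε ^ (-(lagExp δβ i) / 2) * remainder M δβ δV ρ ε i t x a e - ρ i t x a) ∂M.ν

variable {i₀ : ℕ} {δβ : ℕ → ℝ} {δV : ℕ → ℝ → ℝ → ℝ} {ρ : ℕ → ℝ → ℝ → M.A → ℝ}
  {abar : ℝ → ℝ → ℝ → M.A}

lemma remainder_succ_eq (ε : ℝ) (i : ℕ) (t x : ℝ) (a : M.A) (e : ℝ) :
    remainder M δβ δV ρ ε (i + 1) t x a e =
      (ε⁻¹ * (δV i t (x + M.bEps ε x a e) - δV i t x) - M.b₁ x a e * dx (δV i) t x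
        - 1 / 2 * |M.b₂ x a e| ^ 2 * dxx (δV i) t x)
      + (ε ^ (-(lagExp δβ i) / 2) * remainder M δβ δV ρ ε i t x a e - ρ i t x a) := by
  rw [remainder]
  ring

lemma integrable_remainder (hM : M.Standing) (h : SolvesSystem M i₀ δβ δV ρ abar) {ε : ℝ}
    (hε : ε ∈ Ioo (0 : ℝ) 1) {t : ℝ} (ht : t ∈ Ico 0 M.T) (x : ℝ) (a : M.A) :
    ∀ i ≤ i₀ + 1, Integrable (remainder M δβ δV ρ ε i t x a) M.ν := by
  have := hM.isProbabilityMeasure_ν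
  intro i
  induction i with
  | zero => exact fun _ => integrable_const _
  | succ i ih =>
    intro hi
    have e1 : remainder M δβ δV ρ ε (i + 1) t x a = fun e => _ :=
      funext fun e => remainder_succ_eq ε i t x a e
    rw [e1]
    exact (integrable_jumpError hM hε ((h.isC12 i (by omega)).diff_x t ht).continuous x a).add
      (((ih (by omega)).const_mul _).sub (integrable_const _))

lemma integral_remainder_succ (hM : M.Standing) (h : SolvesSystem M i₀ δβ δV ρ abar) {ε : ℝ}
    (hε : ε ∈ Ioo (0 : ℝ) 1) {t : ℝ} (ht : t ∈ Ico 0 M.T) (x : ℝ) (a : M.A) {i : ℕ} (hi : i ≤ i₀) :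
    ∫ e, remainder M δβ δV ρ ε (i + 1) t x a e ∂M.ν =
      jumpError M ε (δV i) t x a + defect M δβ δV ρ ε i t x a := by
  have := hM.isProbabilityMeasure_ν
  simp_rw [remainder_succ_eq]
  exact integral_add
    (integrable_jumpError hM hε ((h.isC12 i (by omega)).diff_x t ht).continuous x a)
    (((integrable_remainder hM h hε ht x a i (by omega)).const_mul _).sub (integrable_const _))

lemma defect_succ (hM : M.Standing) (h : SolvesSystem M i₀ δβ δV ρ abar) {ε : ℝ}
    (hε : ε ∈ Ioo (0 : ℝ) 1) {t : ℝ} (ht : t ∈ Ico 0 M.T) (x : ℝ) (a : M.A) {i : ℕ} (hi : i < i₀) :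
    defect M δβ δV ρ ε (i + 1) t x a = ε ^ (-(δβ i) / 2) *
      (jumpError M ε (δV i) t x a + defect M δβ δV ρ ε i t x a) - ρ (i + 1) t x a := by
  have := hM.isProbabilityMeasure_ν
  rw [defect, integral_sub ((integrable_remainder hM h hε ht x a (i + 1) (by omega)).const_mul _)
    (integrable_const _), integral_const_mul, integral_remainder_succ hM h hε ht x a hi.le]
  simp [lagExp]

lemma reward_zero (hM : M.Standing) (h : SolvesSystem M i₀ δβ δV ρ abar) {t : ℝ}
    (ht : t ∈ Ico 0 M.T) (x : ℝ) (a : M.A) : ρ 0 t x a = M.r x a := by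
  have := hM.isProbabilityMeasure_ν
  have h1 := h.limits 0 (Nat.zero_le _) t ht x a
  simp only [lagExp, neg_zero, zero_div, Real.rpow_zero, one_mul, remainder, integral_const,
    probReal_univ, one_smul] at h1
  exact tendsto_nhds_unique h1 tendsto_const_nhds

lemma defect_zero (hM : M.Standing) (h : SolvesSystem M i₀ δβ δV ρ abar) (ε : ℝ) {t : ℝ}
    (ht : t ∈ Ico 0 M.T) (x : ℝ) (a : M.A) : defect M δβ δV ρ ε 0 t x a = 0 := by
  simp [defect, lagExp, remainder, reward_zero hM h ht]

lemma partialSum_succ (j : ℕ) : partialSum δβ (j + 1) = partialSum δβ j + δβ j :=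
  Finset.sum_range_succ _ _

lemma partialSum_zero : partialSum δβ 0 = 0 := Finset.sum_range_zero _

lemma partialSum_lt (h : SolvesSystem M i₀ δβ δV ρ abar) {i j : ℕ} (hij : i < j)
    (hj : j ≤ i₀ + 1) : partialSum δβ i < partialSum δβ j := by
  induction j, hij using Nat.le_induction with
  | base =>
    rw [partialSum_succ]
    linarith [(h.exponents i (by omega)).1]
  | succ j hij ih =>
    rw [partialSum_succ]
    linarith [(h.exponents j (by omega)).1, ih (by omega)]

lemma partialSum_nonneg (h : SolvesSystem M i₀ δβ δV ρ abar) {j : ℕ} (hj : j ≤ i₀ + 1) :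
    0 ≤ partialSum δβ j := by
  rcases Nat.eq_zero_or_pos j with rfl | hpos
  · rw [partialSum_zero]
  · have := partialSum_lt h hpos hj
    rw [partialSum_zero] at this
    exact this.le

/-- Iteration of `defect_succ`: the weight ε^{β_n/2} absorbs the factor ε^{-δβ_n/2}, so the nested
divisions unfold into a plain sum. -/
lemma rpow_mul_defect (hM : M.Standing) (h : SolvesSystem M i₀ δβ δV ρ abar) {ε : ℝ}
    (hε : ε ∈ Ioo (0 : ℝ) 1) {t : ℝ} (ht : t ∈ Ico 0 M.T) (x : ℝ) (a : M.A) :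
    ∀ n ≤ i₀, ε ^ (partialSum δβ n / 2) * defect M δβ δV ρ ε n t x a =
      ∑ j ∈ Finset.range n, ε ^ (partialSum δβ j / 2) * jumpError M ε (δV j) t x a
        - ∑ j ∈ Finset.range n, ε ^ (partialSum δβ (j + 1) / 2) * ρ (j + 1) t x a := by
  intro n
  induction n with
  | zero => simp [defect_zero hM h ε ht]
  | succ n ih =>
    intro hn
    rw [Finset.sum_range_succ, Finset.sum_range_succ, defect_succ hM h hε ht x a (by omega)]
    have e1 : ε ^ (partialSum δβ (n + 1) / 2) * ε ^ (-(δβ n) / 2) = ε ^ (partialSum δβ n / 2) := by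
      rw [← Real.rpow_add hε.1, partialSum_succ]
      congr 1
      ring
    have := ih (by omega)
    linear_combination this + (jumpError M ε (δV n) t x a + defect M δβ δV ρ ε n t x a) * e1

lemma exists_abs_defect_le (h : SolvesSystem M i₀ δβ δV ρ abar) :
    ∃ ε₀ ∈ Ioo (0 : ℝ) 1, ∃ C, ∀ ε ∈ Ioo 0 ε₀, ∀ t ∈ Ico 0 M.T, ∀ x a,
      |defect M δβ δV ρ ε i₀ t x a| ≤ C * ε ^ (δβ i₀ / 2) := by
  -- A finite number above the limsup bounds the supremum norm for all small ε.
  obtain ⟨c, hc1, hc2⟩ := exists_between h.rate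
  have hev := eventually_lt_of_limsup_lt hc1
  obtain ⟨u, hu, hu'⟩ := mem_nhdsGT_iff_exists_Ioo_subset.1 hev
  refine ⟨min u (1 / 2), ⟨lt_min hu (by norm_num), (min_le_right _ _).trans_lt (by norm_num)⟩,
    c.toReal, fun ε hε t ht x a => ?_⟩
  have hε' : ε ∈ Ioo 0 u := ⟨hε.1, hε.2.trans_le (min_le_left _ _)⟩
  have h1 : ENNReal.ofReal (ε ^ (-(δβ i₀) / 2)) * ENNReal.ofReal |defect M δβ δV ρ ε i₀ t x a|
      ≤ c := by
    refine le_trans ?_ (le_of_lt (hu' hε'))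
    refine mul_le_mul_right ?_ _
    refine le_iSup₂_of_le t ht (le_iSup_of_le x (le_iSup_of_le a ?_))
    exact le_rfl
  rw [← ENNReal.ofReal_mul (Real.rpow_nonneg hε.1.le _),
    ENNReal.ofReal_le_iff_le_toReal hc2.ne] at h1
  have h2 : 0 < ε ^ (-(δβ i₀) / 2) := Real.rpow_pos_of_pos hε.1 _
  rw [mul_comm, ← le_div_iff₀ h2] at h1
  refine h1.trans_eq ?_
  rw [div_eq_mul_inv, ← Real.rpow_neg hε.1.le]
  congr 2
  ring

/-! ### Boundedness of the correctors -/

lemma exists_abs_dxx_le {T β B : ℝ} {f : ℝ → ℝ → ℝ} (hβ : 0 < β) (hf : IsC12 T f)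
    (hh : IsHolderInSpace T β (dxx f)) (hB : ∀ t ∈ Icc 0 T, ∀ x, |f t x| ≤ B) :
    ∃ C, ∀ t ∈ Ico 0 T, ∀ x, |dxx f t x| ≤ C ∧ |dx f t x| ≤ C := by
  obtain ⟨K, hK⟩ := hh
  exact ⟨4 * B + 2 * K, fun t ht x => abs_deriv_deriv_le (hf.diff_x t ht) (hf.diff_xx t ht) hβ
    (hK t ht) fun y _ => hB t (Ico_subset_Icc_self ht) y⟩

/-- Once the feedback map is inserted, the equation for δV̄^m is linear with bounded coefficients
and source, so the maximum principle applies. -/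
lemma exists_abs_corrector_le (hM : M.Standing) (h : SolvesSystem M i₀ δβ δV ρ abar) {m : ℕ}
    (hm : m ≤ i₀) {G : ℝ} (hG : ∀ t ∈ Ico 0 M.T, ∀ x a, |ρ m t x a| ≤ G) :
    ∃ C, ∀ t ∈ Icc 0 M.T, ∀ x, |δV m t x| ≤ C := by
  obtain ⟨K, hK1, h₁, h₂, -⟩ := hM.exists_bound
  obtain ⟨C, hC⟩ := exists_cubic_growth (h.exponents m hm) (h.isC12 m hm) (h.continuous m hm)
    (h.holder m hm) (h.terminal m hm)
  have h0 : (0 : ℝ) ∈ Ico 0 M.T := ⟨le_rfl, hM.T_pos⟩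
  -- Neither δV̄^m nor r^m depends on ε, so the equation at one value of ε suffices; 1/2 is
  -- arbitrary.
  have hhalf : (1 / 2 : ℝ) ∈ Ioo (0 : ℝ) 1 := by norm_num
  refine ⟨G * M.T, abs_le_mul_of_linear_equation (h.isC12 m hm) (h.continuous m hm)
    (μ := fun t x => M.drift x (abar (1 / 2) t x))
    (s := fun t x => 1 / 2 * M.vol x (abar (1 / 2) t x) ^ 2)
    (g := fun t x => ρ m t x (abar (1 / 2) t x)) (K := K ^ 2) (G := G) (C := C)
    (fun t _ x => ?_) (fun t _ x => ⟨by positivity, ?_⟩) (fun t ht x => hG t ht x _)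
    ((abs_nonneg _).trans (hG 0 h0 0 (abar (1 / 2) 0 0))) hC (fun t ht x => ?_)
    (h.terminal m hm)⟩
  · refine (hM.abs_drift_le h₁ _ _).trans ?_
    nlinarith
  · have := hM.vol_sq_le h₂ x (abar (1 / 2) t x)
    have h3 : 0 ≤ M.vol x (abar (1 / 2) t x) ^ 2 := by positivity
    linarith
  · have := h.equation (1 / 2) hhalf m hm t ht x
    simp only [diffusionOp] at this
    linarith

/-- At each fixed small ε, the unfolded formula for the weighted defect of index i₀ bounds a sum of
powers of ε uniformly in (t,x,a). Separation of powers bounds the group of terms sharing the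
exponent β_{m-1}/2; apart from r^m it contains only terms already under control. -/
lemma exists_abs_reward_le (hM : M.Standing) (h : SolvesSystem M i₀ δβ δV ρ abar) {m : ℕ}
    (hm : m ≤ i₀)
    (ih : ∀ j < m, ∃ C, ∀ t ∈ Ico 0 M.T, ∀ x, |dxx (δV j) t x| ≤ C) :
    ∃ G, ∀ t ∈ Ico 0 M.T, ∀ x a, |ρ m t x a| ≤ G := by
  classical
  obtain ⟨K, hK1, h₁, h₂, h₃⟩ := hM.exists_bound
  obtain ⟨ε₀, hε₀, C, hC⟩ := exists_abs_defect_le h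
  choose! H hH using h.holder
  let S := Ico 0 M.T × ℝ × M.A
  -- Three families: the rewards with exponent β_{j-1}/2, the cross moment terms with an extra 1/2,
  -- and the second moment terms with an extra 1.
  let I : Finset (ℕ ⊕ (ℕ ⊕ ℕ)) := (Finset.range (i₀ + 1)).disjSum
    ((Finset.range i₀).disjSum (Finset.range i₀))
  let p : ℕ ⊕ (ℕ ⊕ ℕ) → ℝ := Sum.elim (fun j => partialSum δβ j / 2)
    (Sum.elim (fun j => partialSum δβ j / 2 + 1 / 2) fun j => partialSum δβ j / 2 + 1)
  let U : ℕ ⊕ (ℕ ⊕ ℕ) → S → ℝ := Sum.elim (fun j s => ρ j s.1 s.2.1 s.2.2)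
    (Sum.elim (fun j s => -(crossMoment M s.2.1 s.2.2 * dxx (δV j) s.1 s.2.1))
      fun j s => -(halfSecondMoment M s.2.1 s.2.2 * dxx (δV j) s.1 s.2.1))
  have hmI : (Sum.inl m : ℕ ⊕ (ℕ ⊕ ℕ)) ∈ I := by
    simp only [I, Finset.inl_mem_disjSum, Finset.mem_range]
    omega
  obtain ⟨B, hB⟩ := bounded_of_sum_rpow' I p U hε₀.1 (fun ε h0 hlt => by
    have hε : ε ∈ Ioo (0 : ℝ) 1 := ⟨h0, hlt.trans hε₀.2⟩
    refine ⟨K + ∑ j ∈ Finset.range i₀, ε ^ (partialSum δβ j / 2) *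
      (H j * (2 * K) ^ (2 + δβ j) * ε ^ (δβ j / 2))
      + ε ^ (partialSum δβ i₀ / 2) * (C * ε ^ (δβ i₀ / 2)), ?_⟩
    rintro ⟨⟨t, ht⟩, x, a⟩
    -- On the right every summand is bounded at fixed ε: r by assumption, the corrected Taylor
    -- errors by the Hölder estimate, the defect by the rate hypothesis.
    have e1 : ∑ i ∈ I, ε ^ p i * U i (⟨t, ht⟩, x, a) = M.r x a
        + ∑ j ∈ Finset.range i₀, ε ^ (partialSum δβ j / 2) * (jumpError M ε (δV j) t x a
          - √ε * crossMoment M x a * dxx (δV j) t x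
          - ε * halfSecondMoment M x a * dxx (δV j) t x)
        - ε ^ (partialSum δβ i₀ / 2) * defect M δβ δV ρ ε i₀ t x a := by
      rw [rpow_mul_defect hM h hε ht x a i₀ le_rfl]
      simp only [I, p, U, Finset.sum_disjSum, Sum.elim_inl, Sum.elim_inr]
      rw [Finset.sum_range_succ', partialSum_zero, zero_div, Real.rpow_zero, one_mul,
        reward_zero hM h ht]
      have e2 : ∑ j ∈ Finset.range i₀, ε ^ (partialSum δβ j / 2) * (jumpError M ε (δV j) t x a
          - √ε * crossMoment M x a * dxx (δV j) t x
          - ε * halfSecondMoment M x a * dxx (δV j) t x) =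
          ∑ j ∈ Finset.range i₀, ε ^ (partialSum δβ j / 2) * jumpError M ε (δV j) t x a
          + ∑ j ∈ Finset.range i₀, ε ^ (partialSum δβ j / 2 + 1 / 2) *
            -(crossMoment M x a * dxx (δV j) t x)
          + ∑ j ∈ Finset.range i₀, ε ^ (partialSum δβ j / 2 + 1) *
            -(halfSecondMoment M x a * dxx (δV j) t x) := by
        rw [← Finset.sum_add_distrib, ← Finset.sum_add_distrib]
        refine Finset.sum_congr rfl fun j _ => ?_
        rw [Real.rpow_add h0, Real.rpow_add h0, Real.rpow_one, Real.sqrt_eq_rpow]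
        ring
      rw [e2]
      ring
    rw [e1]
    refine (abs_sub _ _).trans (add_le_add ((abs_add_le _ _).trans (add_le_add (h₃ x a) ?_)) ?_)
    · refine (Finset.abs_sum_le_sum_abs _ _).trans (Finset.sum_le_sum fun j hj => ?_)
      have hj' : j ≤ i₀ := (Finset.mem_range.1 hj).le
      rw [abs_mul, abs_of_pos (Real.rpow_pos_of_pos h0 _)]
      refine mul_le_mul_of_nonneg_left ?_ (Real.rpow_pos_of_pos h0 _).le
      exact abs_jumpError_sub_le hM hK1 h₁ h₂ hε ((h.isC12 j hj').diff_x t ht)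
        ((h.isC12 j hj').diff_xx t ht) (h.exponents j hj').1 (hH j hj' t ht) x a
    · rw [abs_mul, abs_of_pos (Real.rpow_pos_of_pos h0 _)]
      exact mul_le_mul_of_nonneg_left (hC ε ⟨h0, hlt⟩ t ht x a) (Real.rpow_pos_of_pos h0 _).le)
    (Sum.inl m) hmI
  -- The partial sums of the exponents increase strictly, so a term with a positive extra exponent
  -- can meet β_{m-1}/2 only if its index is below m.
  have hlt_of : ∀ j < i₀, ∀ c : ℝ, 0 < c → partialSum δβ j / 2 + c = partialSum δβ m / 2 →
      j < m := by
    intro j hj c hc he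
    by_contra hcon
    push Not at hcon
    rcases hcon.eq_or_lt with rfl | hcon
    · linarith
    · linarith [partialSum_lt h hcon (by omega)]
  have hrest : ∀ i ∈ (I.filter fun j => p j = p (Sum.inl m)).erase (Sum.inl m),
      ∃ D, ∀ s, |U i s| ≤ D := by
    intro i hi
    obtain ⟨hne, hi⟩ := Finset.mem_erase.1 hi
    obtain ⟨hiI, hip⟩ := Finset.mem_filter.1 hi
    rcases i with j | j | j
    · exfalso
      simp only [I, Finset.inl_mem_disjSum, Finset.mem_range] at hiI
      simp only [p, Sum.elim_inl] at hip
      rcases lt_trichotomy j m with hjm | rfl | hjm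
      · linarith [partialSum_lt h hjm (by omega)]
      · exact hne rfl
      · linarith [partialSum_lt h hjm (by omega)]
    · simp only [I, Finset.inr_mem_disjSum, Finset.inl_mem_disjSum, Finset.mem_range] at hiI
      simp only [p, Sum.elim_inl, Sum.elim_inr] at hip
      obtain ⟨D, hD⟩ := ih j (hlt_of j hiI _ (by norm_num) hip)
      refine ⟨K ^ 2 * D, fun s => ?_⟩
      simp only [U, Sum.elim_inl, Sum.elim_inr, abs_neg, abs_mul]
      exact mul_le_mul (abs_crossMoment_le hM h₁ h₂ _ _) (hD _ s.1.2 _) (abs_nonneg _)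
        (by positivity)
    · simp only [I, Finset.inr_mem_disjSum, Finset.mem_range] at hiI
      simp only [p, Sum.elim_inl, Sum.elim_inr] at hip
      obtain ⟨D, hD⟩ := ih j (hlt_of j hiI _ (by norm_num) hip)
      refine ⟨K ^ 2 * D, fun s => ?_⟩
      simp only [U, Sum.elim_inr, abs_neg, abs_mul]
      exact mul_le_mul (abs_halfSecondMoment_le hM h₁ _ _) (hD _ s.1.2 _) (abs_nonneg _)
        (by positivity)
  choose! D hD using hrest
  refine ⟨B + ∑ i ∈ (I.filter fun j => p j = p (Sum.inl m)).erase (Sum.inl m), D i,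
    fun t ht x a => ?_⟩
  have h4 := hB (⟨t, ht⟩, x, a)
  have hmem : Sum.inl m ∈ I.filter fun j => p j = p (Sum.inl m) :=
    Finset.mem_filter.2 ⟨hmI, rfl⟩
  rw [← Finset.add_sum_erase _ _ hmem] at h4
  have h5 : |∑ i ∈ (I.filter fun j => p j = p (Sum.inl m)).erase (Sum.inl m),
      U i (⟨t, ht⟩, x, a)| ≤ ∑ i ∈ (I.filter fun j => p j = p (Sum.inl m)).erase (Sum.inl m), D i :=
    (Finset.abs_sum_le_sum_abs _ _).trans (Finset.sum_le_sum fun i hi => hD i hi _)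
  have h6 : U (Sum.inl m) (⟨t, ht⟩, x, a) = ρ m t x a := rfl
  rw [h6] at h4
  rw [abs_le] at h4 h5 ⊢
  constructor <;> linarith [h4.1, h4.2, h5.1, h5.2]

/-- Strong induction on the index, in the order: r^m from the earlier second derivatives, δV̄^m by
the maximum principle, its space derivatives by interpolation, its time derivative from the
equation. -/
lemma exists_uniform_bound (hM : M.Standing) (h : SolvesSystem M i₀ δβ δV ρ abar) :
    ∀ m ≤ i₀, ∃ C, (∀ t ∈ Icc 0 M.T, ∀ x, |δV m t x| ≤ C) ∧
      ∀ t ∈ Ico 0 M.T, ∀ x, |dxx (δV m) t x| ≤ C ∧ |dx (δV m) t x| ≤ C ∧ |dt (δV m) t x| ≤ C ∧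
        ∀ a, |ρ m t x a| ≤ C := by
  intro m
  induction m using Nat.strong_induction_on with
  | _ m ih =>
  intro hm
  obtain ⟨K, hK1, h₁, h₂, -⟩ := hM.exists_bound
  obtain ⟨G, hG⟩ := exists_abs_reward_le hM h hm fun j hj => by
    obtain ⟨C, -, hC⟩ := ih j hj (by omega)
    exact ⟨C, fun t ht x => (hC t ht x).1⟩
  obtain ⟨B, hB⟩ := exists_abs_corrector_le hM h hm hG
  obtain ⟨D, hD⟩ := exists_abs_dxx_le (h.exponents m hm).1 (h.isC12 m hm) (h.holder m hm) hB
  have hT0 : (0 : ℝ) ∈ Ico 0 M.T := ⟨le_rfl, hM.T_pos⟩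
  have hD0 : 0 ≤ D := (abs_nonneg _).trans (hD 0 hT0 0).1
  have hG0 : 0 ≤ G := (abs_nonneg _).trans (hG 0 hT0 0 (abar 0 0 0))
  have hB0 : 0 ≤ B := (abs_nonneg _).trans (hB 0 (Ico_subset_Icc_self hT0) 0)
  have hKD : 0 ≤ K * D + K ^ 2 * D := by positivity
  refine ⟨B + D + (K * D + K ^ 2 * D + G), fun t ht x => (hB t ht x).trans (by linarith),
    fun t ht x => ⟨(hD t ht x).1.trans (by linarith), (hD t ht x).2.trans (by linarith), ?_,
      fun a => (hG t ht x a).trans (by linarith)⟩⟩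
  have h4 := h.equation (1 / 2) (by norm_num) m hm t ht x
  set a := abar (1 / 2) t x
  have h5 : |M.drift x a * dx (δV m) t x| ≤ K * D := by
    rw [abs_mul]
    exact mul_le_mul (hM.abs_drift_le h₁ x a) (hD t ht x).2 (abs_nonneg _) (by linarith)
  have h6 : |1 / 2 * M.vol x a ^ 2 * dxx (δV m) t x| ≤ K ^ 2 * D := by
    rw [abs_mul]
    refine mul_le_mul ?_ (hD t ht x).1 (abs_nonneg _) (by positivity)
    have := hM.vol_sq_le h₂ x a
    rw [abs_of_nonneg (by positivity)]
    have : 0 ≤ M.vol x a ^ 2 := by positivity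
    linarith
  have h7 := hG t ht x a
  simp only [diffusionOp] at h4
  rw [abs_le] at h5 h6 h7 ⊢
  constructor <;> linarith [h5.1, h5.2, h6.1, h6.2, h7.1, h7.2]

end

section

variable {M : Data}

/-! ### Test functions for the verification argument -/

/-- `W` is a bounded function vanishing at time `T`, with bounded time derivative `g` on `[0,T]`. -/
structure IsTestPair (T : ℝ) (W g : ℝ → ℝ → ℝ) (B : ℝ) : Prop where
  measurable_fun : Measurable (Function.uncurry W)
  measurable_deriv : Measurable (Function.uncurry g)
  abs_fun_le : ∀ s y, |W s y| ≤ B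
  abs_deriv_le : ∀ s y, |g s y| ≤ B
  sub_eq_integral : ∀ y a b, 0 ≤ a → a ≤ b → b ≤ T → W b y - W a y = ∫ s in a..b, g s y
  terminal : ∀ y, W T y = 0

/-- The running reward plus the action of the time derivative and of the jump generator on the
test function. -/
def driftTerm (M : Data) (ε : ℝ) (W g : ℝ → ℝ → ℝ) (s y : ℝ) (a : M.A) : ℝ :=
  M.r y a + g s y + ε⁻¹ * ∫ e, (W s (y + M.bEps ε y a e) - W s y) ∂M.ν

variable {i₀ : ℕ} {δβ : ℕ → ℝ} {δV : ℕ → ℝ → ℝ → ℝ} {ρ : ℕ → ℝ → ℝ → M.A → ℝ}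
  {abar : ℝ → ℝ → ℝ → M.A}

/-- The time derivative of the expansion on `[0,T)`, extended by `0`. -/
def expansionDt (T : ℝ) (i₀ : ℕ) (δβ : ℕ → ℝ) (δV : ℕ → ℝ → ℝ → ℝ) (ε s y : ℝ) : ℝ :=
  (Ico 0 T).indicator
    (fun s => ∑ j ∈ Finset.range (i₀ + 1), ε ^ (partialSum δβ j / 2) * dt (δV j) s y) s

/-- Clamping time to [0,T] extends the expansion to a function that is continuous and bounded at all
times. -/
lemma clamp_mem_Icc {T : ℝ} (hT : 0 ≤ T) (s : ℝ) : max 0 (min s T) ∈ Icc 0 T :=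
  ⟨le_max_left _ _, max_le hT (min_le_right _ _)⟩

lemma clamp_eq_self {T s : ℝ} (hs : s ∈ Icc 0 T) : max 0 (min s T) = s := by
  rw [min_eq_left hs.2, max_eq_right hs.1]

lemma abs_weighted_sum_le {ε : ℝ} {w : ℕ → ℝ} {φ C : ℕ → ℝ} (hε : 0 < ε)
    (hφ : ∀ j ≤ i₀, |φ j| ≤ C j) :
    |∑ j ∈ Finset.range (i₀ + 1), ε ^ w j * φ j| ≤ ∑ j ∈ Finset.range (i₀ + 1), ε ^ w j * C j := by
  refine (Finset.abs_sum_le_sum_abs _ _).trans (Finset.sum_le_sum fun j hj => ?_)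
  rw [abs_mul, abs_of_pos (Real.rpow_pos_of_pos hε _)]
  exact mul_le_mul_of_nonneg_left (hφ j (Nat.lt_succ_iff.1 (Finset.mem_range.1 hj)))
    (Real.rpow_pos_of_pos hε _).le

lemma exists_isTestPair (hM : M.Standing) (h : SolvesSystem M i₀ δβ δV ρ abar) {ε : ℝ}
    (hε : ε ∈ Ioo (0 : ℝ) 1) :
    ∃ B, IsTestPair M.T (fun s y => expansion i₀ δβ δV ε (max 0 (min s M.T)) y)
      (expansionDt M.T i₀ δβ δV ε) B := by
  have hT := hM.T_pos.le
  choose! C hC₁ hC₂ using exists_uniform_bound hM h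
  have hmj : ∀ j ≤ i₀, Measurable fun p : ℝ × ℝ =>
      (Ico 0 M.T ×ˢ (univ : Set ℝ)).indicator (Function.uncurry (dt (δV j))) p := by
    intro j hj
    have := (h.isC12 j hj).cont_dt
    classical
    rw [← piecewise_eq_indicator]
    exact this.measurable_piecewise continuousOn_const (measurableSet_Ico.prod MeasurableSet.univ)
  have hm : Measurable (Function.uncurry (expansionDt M.T i₀ δβ δV ε)) := by
    have e1 : Function.uncurry (expansionDt M.T i₀ δβ δV ε) = fun p =>
        ∑ j ∈ Finset.range (i₀ + 1), ε ^ (partialSum δβ j / 2) *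
          (Ico 0 M.T ×ˢ (univ : Set ℝ)).indicator (Function.uncurry (dt (δV j))) p := by
      funext ⟨s, y⟩
      by_cases hs : s ∈ Ico 0 M.T
      · simp [expansionDt, Function.uncurry, indicator, hs.1, hs.2]
      · rw [mem_Ico] at hs
        simp [expansionDt, Function.uncurry, indicator, hs]
    rw [e1]
    exact Finset.measurable_sum _ fun j hj =>
      (hmj j (Nat.lt_succ_iff.1 (Finset.mem_range.1 hj))).const_mul _
  set B := ∑ j ∈ Finset.range (i₀ + 1), ε ^ (partialSum δβ j / 2) * C j with hB
  have hgB : ∀ s y, |expansionDt M.T i₀ δβ δV ε s y| ≤ B := by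
    intro s y
    by_cases hs : s ∈ Ico 0 M.T
    · rw [expansionDt, indicator_of_mem hs]
      exact abs_weighted_sum_le hε.1 fun j hj => (hC₂ j hj s hs y).2.2.1
    · rw [expansionDt, indicator_of_notMem hs, abs_zero]
      refine Finset.sum_nonneg fun j hj => mul_nonneg (Real.rpow_pos_of_pos hε.1 _).le ?_
      exact (abs_nonneg _).trans (hC₁ j (Nat.lt_succ_iff.1 (Finset.mem_range.1 hj)) 0 ⟨le_rfl, hT⟩ 0)
  refine ⟨B, ?_, hm, fun s y => ?_, hgB, fun y a b ha hab hb => ?_, fun y => ?_⟩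
  · refine Continuous.measurable ?_
    have e1 : (Function.uncurry fun s y => expansion i₀ δβ δV ε (max 0 (min s M.T)) y) = fun p =>
        ∑ j ∈ Finset.range (i₀ + 1), ε ^ (partialSum δβ j / 2) *
          Function.uncurry (δV j) (max 0 (min p.1 M.T), p.2) := rfl
    rw [e1]
    refine continuous_finsetSum _ fun j hj => continuous_const.mul ?_
    have hc := h.continuous j (Nat.lt_succ_iff.1 (Finset.mem_range.1 hj))
    exact hc.comp_continuous (by fun_prop) fun p => ⟨clamp_mem_Icc hT _, mem_univ _⟩
  · exact abs_weighted_sum_le hε.1 fun j hj => hC₁ j hj _ (clamp_mem_Icc hT s) y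
  · simp only [clamp_eq_self (T := M.T) (s := a) ⟨ha, hab.trans hb⟩,
      clamp_eq_self (T := M.T) (s := b) ⟨ha.trans hab, hb⟩]
    symm
    -- The time derivative need not exist at T. Continuity up to T, right derivatives in the open
    -- interval and the uniform bound on the derivative are enough.
    refine intervalIntegral.integral_eq_sub_of_hasDeriv_right_of_le hab
      (f := fun s => expansion i₀ δβ δV ε s y) ?_ (fun s hs => ?_) ?_
    · simp only [expansion]
      refine continuousOn_finsetSum _ fun j hj => continuousOn_const.mul ?_
      have hc := h.continuous j (Nat.lt_succ_iff.1 (Finset.mem_range.1 hj))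
      exact hc.comp (f := fun s => (s, y)) (by fun_prop)
        fun s hs => ⟨⟨ha.trans hs.1, hs.2.trans hb⟩, mem_univ _⟩
    · have hs' : s ∈ Ico 0 M.T := ⟨ha.trans hs.1.le, hs.2.trans_le hb⟩
      rw [expansionDt, indicator_of_mem hs']
      simp only [expansion]
      refine HasDerivWithinAt.fun_sum fun j hj => ?_
      exact ((((h.isC12 j (Nat.lt_succ_iff.1 (Finset.mem_range.1 hj))).diff_t s hs'
        y).hasDerivWithinAt).mono fun u hu => hs'.1.trans (le_of_lt hu)).const_mul _
    · rw [intervalIntegrable_iff]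
      refine Measure.integrableOn_of_bounded (M := B) (by simp)
        (hm.comp measurable_prodMk_right).aestronglyMeasurable (ae_of_all _ fun s => hgB s y)
  · rw [clamp_eq_self ⟨hT, le_rfl⟩]
    simp only [expansion]
    refine Finset.sum_eq_zero fun j hj => ?_
    rw [h.terminal j (Nat.lt_succ_iff.1 (Finset.mem_range.1 hj)), mul_zero]

lemma diffusionOp_expansion (h : SolvesSystem M i₀ δβ δV ρ abar) (ε : ℝ) {t : ℝ}
    (ht : t ∈ Ico 0 M.T) (x : ℝ) (a : M.A) :
    diffusionOp M (expansion i₀ δβ δV ε) t x a =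
      ∑ j ∈ Finset.range (i₀ + 1), ε ^ (partialSum δβ j / 2) * diffusionOp M (δV j) t x a := by
  have e1 : deriv (expansion i₀ δβ δV ε t) =
      fun x => ∑ j ∈ Finset.range (i₀ + 1), ε ^ (partialSum δβ j / 2) * deriv (δV j t) x := by
    funext x
    refine (HasDerivAt.fun_sum fun j hj => ?_).deriv
    exact (((h.isC12 j (Nat.lt_succ_iff.1 (Finset.mem_range.1 hj))).diff_x t ht
      x).hasDerivAt).const_mul _
  have e2 : deriv (deriv (expansion i₀ δβ δV ε t)) x =
      ∑ j ∈ Finset.range (i₀ + 1), ε ^ (partialSum δβ j / 2) * deriv (deriv (δV j t)) x := by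
    rw [e1]
    refine (HasDerivAt.fun_sum fun j hj => ?_).deriv
    exact (((h.isC12 j (Nat.lt_succ_iff.1 (Finset.mem_range.1 hj))).diff_xx t ht
      x).hasDerivAt).const_mul _
  simp only [diffusionOp, dx, dxx, e2]
  rw [e1, Finset.mul_sum, Finset.mul_sum, ← Finset.sum_add_distrib]
  exact Finset.sum_congr rfl fun j _ => by ring

/-- The weighted equations turn the time derivative into minus the Hamiltonian at ā^ε (`e0`), the
jump generator is the diffusion generator plus Taylor errors (`e1`), and all these errors but the
last combine with r into the expansion reward (`e3`). -/
lemma driftTerm_expansion (hM : M.Standing) (h : SolvesSystem M i₀ δβ δV ρ abar) {ε : ℝ}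
    (hε : ε ∈ Ioo (0 : ℝ) 1) {t : ℝ} (ht : t ∈ Ico 0 M.T) (x : ℝ) (a : M.A) :
    driftTerm M ε (fun s y => expansion i₀ δβ δV ε (max 0 (min s M.T)) y)
      (expansionDt M.T i₀ δβ δV ε) t x a =
    (diffusionOp M (expansion i₀ δβ δV ε) t x a + expansionReward M i₀ δβ ρ ε t x a)
      - (diffusionOp M (expansion i₀ δβ δV ε) t x (abar ε t x)
        + expansionReward M i₀ δβ ρ ε t x (abar ε t x))
      + ε ^ (partialSum δβ i₀ / 2) *
        (jumpError M ε (δV i₀) t x a + defect M δβ δV ρ ε i₀ t x a) := by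
  have e0 : expansionDt M.T i₀ δβ δV ε t x =
      -(diffusionOp M (expansion i₀ δβ δV ε) t x (abar ε t x)
        + expansionReward M i₀ δβ ρ ε t x (abar ε t x)) := by
    rw [expansionDt, indicator_of_mem ht, diffusionOp_expansion h ε ht, expansionReward,
      ← Finset.sum_add_distrib, eq_neg_iff_add_eq_zero, ← Finset.sum_add_distrib]
    refine Finset.sum_eq_zero fun j hj => ?_
    have := h.equation ε hε j (Nat.lt_succ_iff.1 (Finset.mem_range.1 hj)) t ht x
    linear_combination ε ^ (partialSum δβ j / 2) * this
  have e1 : ε⁻¹ * ∫ e, (expansion i₀ δβ δV ε t (x + M.bEps ε x a e)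
      - expansion i₀ δβ δV ε t x) ∂M.ν =
      ∑ j ∈ Finset.range (i₀ + 1), ε ^ (partialSum δβ j / 2) * jumpError M ε (δV j) t x a
        + diffusionOp M (expansion i₀ δβ δV ε) t x a := by
    have := hM.isProbabilityMeasure_ν
    have e2 : ∀ e, expansion i₀ δβ δV ε t (x + M.bEps ε x a e) - expansion i₀ δβ δV ε t x =
        ∑ j ∈ Finset.range (i₀ + 1), ε ^ (partialSum δβ j / 2) *
          (δV j t (x + M.bEps ε x a e) - δV j t x) := fun e => by
      simp only [expansion]
      rw [← Finset.sum_sub_distrib]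
      exact Finset.sum_congr rfl fun j _ => by ring
    simp_rw [e2]
    have hint : ∀ j ∈ Finset.range (i₀ + 1), Integrable (fun e => ε ^ (partialSum δβ j / 2) *
        (δV j t (x + M.bEps ε x a e) - δV j t x)) M.ν := fun j hj =>
      ((hM.integrable_comp_jump hε ((h.isC12 j (Nat.lt_succ_iff.1
        (Finset.mem_range.1 hj))).diff_x t ht).continuous x a).sub (integrable_const _)).const_mul _
    rw [integral_finsetSum _ hint, diffusionOp_expansion h ε ht, ← Finset.sum_add_distrib,
      Finset.mul_sum]
    refine Finset.sum_congr rfl fun j hj => ?_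
    rw [jumpError_eq hM hε
      ((h.isC12 j (Nat.lt_succ_iff.1 (Finset.mem_range.1 hj))).diff_x t ht).continuous,
      integral_const_mul]
    ring
  have e3 : ∑ j ∈ Finset.range (i₀ + 1), ε ^ (partialSum δβ j / 2) * jumpError M ε (δV j) t x a
      + M.r x a = expansionReward M i₀ δβ ρ ε t x a + ε ^ (partialSum δβ i₀ / 2) *
        (jumpError M ε (δV i₀) t x a + defect M δβ δV ρ ε i₀ t x a) := by
    have := rpow_mul_defect hM h hε ht x a i₀ le_rfl
    rw [expansionReward, Finset.sum_range_succ, Finset.sum_range_succ', partialSum_zero, zero_div,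
      Real.rpow_zero, one_mul, reward_zero hM h ht]
    linear_combination -this
  rw [driftTerm]
  simp only [clamp_eq_self (Ico_subset_Icc_self ht)]
  rw [e0, e1]
  linear_combination e3

/-- For small `ε` the drift term of the expansion is at most of order `ε^{β_{i₀}/2}`, and of exactly
this order at the maximisers. -/
theorem exists_driftTerm_bound (hM : M.Standing) (h : SolvesSystem M i₀ δβ δV ρ abar) :
    ∃ ε₀ ∈ Ioo (0 : ℝ) 1, ∃ C, 0 ≤ C ∧ ∀ ε ∈ Ioo 0 ε₀, ∀ t ∈ Ico 0 M.T, ∀ x a,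
      (driftTerm M ε (fun s y => expansion i₀ δβ δV ε (max 0 (min s M.T)) y)
        (expansionDt M.T i₀ δβ δV ε) t x a ≤ C * ε ^ (partialSum δβ (i₀ + 1) / 2)) ∧
      (a ∈ maximisers M i₀ δβ δV ρ ε t x →
        -(C * ε ^ (partialSum δβ (i₀ + 1) / 2)) ≤
          driftTerm M ε (fun s y => expansion i₀ δβ δV ε (max 0 (min s M.T)) y)
            (expansionDt M.T i₀ δβ δV ε) t x a) := by
  obtain ⟨K, hK1, h₁, h₂, h₃⟩ := hM.exists_bound
  obtain ⟨ε₀, hε₀, C, hC⟩ := exists_abs_defect_le h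
  obtain ⟨B, -, hB⟩ := exists_uniform_bound hM h i₀ le_rfl
  obtain ⟨H, hH⟩ := h.holder i₀ le_rfl
  have hβ := h.exponents i₀ le_rfl
  have hT0 : (0 : ℝ) ∈ Ico 0 M.T := ⟨le_rfl, hM.T_pos⟩
  have hB0 : 0 ≤ B := (abs_nonneg _).trans (hB 0 hT0 0).1
  have hbound : ∀ ε ∈ Ioo 0 ε₀, ∀ t ∈ Ico 0 M.T, ∀ x a,
      |jumpError M ε (δV i₀) t x a + defect M δβ δV ρ ε i₀ t x a| ≤
        (2 * (K ^ 2 * B) + |H| * (2 * K) ^ (2 + δβ i₀) + |C|) * ε ^ (δβ i₀ / 2) := by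
    intro ε hε t ht x a
    have hε1 : ε ∈ Ioo (0 : ℝ) 1 := ⟨hε.1, hε.2.trans hε₀.2⟩
    have h4 := abs_jumpError_sub_le hM hK1 h₁ h₂ hε1 ((h.isC12 i₀ le_rfl).diff_x t ht)
      ((h.isC12 i₀ le_rfl).diff_xx t ht) hβ.1 (hH t ht) x a
    have h5 := hC ε hε t ht x a
    have hp : 0 < ε ^ (δβ i₀ / 2) := Real.rpow_pos_of_pos hε.1 _
    -- This uses δβ_{i₀} ≤ 1: the moment terms are no larger than the Hölder remainder.
    have hs1 : √ε ≤ ε ^ (δβ i₀ / 2) := by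
      rw [Real.sqrt_eq_rpow]
      exact Real.rpow_le_rpow_of_exponent_ge hε.1 hε1.2.le (by linarith [hβ.2])
    have hs2 : ε ≤ ε ^ (δβ i₀ / 2) := by
      conv_lhs => rw [← Real.rpow_one ε]
      exact Real.rpow_le_rpow_of_exponent_ge hε.1 hε1.2.le (by linarith [hβ.2])
    have h6 : |√ε * crossMoment M x a * dxx (δV i₀) t x| ≤ ε ^ (δβ i₀ / 2) * (K ^ 2 * B) := by
      rw [mul_assoc, abs_mul, abs_mul, abs_of_nonneg (Real.sqrt_nonneg _)]
      exact mul_le_mul hs1 (mul_le_mul (abs_crossMoment_le hM h₁ h₂ x a) (hB t ht x).1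
        (abs_nonneg _) (by positivity)) (by positivity) hp.le
    have h7 : |ε * halfSecondMoment M x a * dxx (δV i₀) t x| ≤ ε ^ (δβ i₀ / 2) * (K ^ 2 * B) := by
      rw [mul_assoc, abs_mul, abs_mul, abs_of_pos hε.1]
      exact mul_le_mul hs2 (mul_le_mul (abs_halfSecondMoment_le hM h₁ x a) (hB t ht x).1
        (abs_nonneg _) (by positivity)) (by positivity) hp.le
    have h8 : H * (2 * K) ^ (2 + δβ i₀) * ε ^ (δβ i₀ / 2) ≤
        |H| * (2 * K) ^ (2 + δβ i₀) * ε ^ (δβ i₀ / 2) := by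
      gcongr
      exact le_abs_self H
    have h9 : C * ε ^ (δβ i₀ / 2) ≤ |C| * ε ^ (δβ i₀ / 2) := by
      gcongr
      exact le_abs_self C
    rw [abs_le] at h4 h5 h6 h7 ⊢
    constructor <;> linarith [h4.1, h4.2, h5.1, h5.2, h6.1, h6.2, h7.1, h7.2]
  refine ⟨ε₀, hε₀, 2 * (K ^ 2 * B) + |H| * (2 * K) ^ (2 + δβ i₀) + |C|, by positivity,
    fun ε hε t ht x a => ?_⟩
  have hε1 : ε ∈ Ioo (0 : ℝ) 1 := ⟨hε.1, hε.2.trans hε₀.2⟩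
  have hp : 0 < ε ^ (partialSum δβ i₀ / 2) := Real.rpow_pos_of_pos hε.1 _
  have h4 := mul_le_mul_of_nonneg_left (hbound ε hε t ht x a) hp.le
  have h5 : ε ^ (partialSum δβ i₀ / 2) * ε ^ (δβ i₀ / 2) = ε ^ (partialSum δβ (i₀ + 1) / 2) := by
    rw [← Real.rpow_add hε.1, partialSum_succ]
    congr 1
    ring
  rw [mul_left_comm, h5] at h4
  nth_rewrite 1 [← abs_of_pos hp] at h4
  rw [← abs_mul, abs_le] at h4
  rw [driftTerm_expansion hM h hε1 ht]
  refine ⟨?_, fun ha => ?_⟩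
  · have := h.abar_mem ε hε1 t ht x a
    linarith [h4.2]
  · have := ha (abar ε t x)
    linarith [h4.1]

end

section

/-! ### The exponential law: density equals rate times survival function -/

lemma expMeasure_Ici {r : ℝ} (hr : 0 < r) {u : ℝ} (hu : 0 ≤ u) :
    expMeasure r (Ici u) = ENNReal.ofReal (Real.exp (-(r * u))) := by
  have := isProbabilityMeasure_expMeasure hr
  have hac : expMeasure r ≪ volume := withDensity_absolutelyContinuous _ _
  have h0 : expMeasure r {u} = 0 := hac (by simp)
  have h1 : expMeasure r (Iic u) = ENNReal.ofReal (1 - Real.exp (-(r * u))) := by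
    rw [← ofReal_cdf, cdf_expMeasure_eq hr, if_pos hu]
  have h2 : expMeasure r (Ici u) = expMeasure r (Ioi u) := by
    refine le_antisymm ?_ (measure_mono Ioi_subset_Ici_self)
    rw [← Ioi_union_left]
    refine (measure_union_le _ _).trans ?_
    rw [h0, add_zero]
  rw [h2, ← compl_Iic, prob_compl_eq_one_sub measurableSet_Iic, h1, ← ENNReal.ofReal_one,
    ← ENNReal.ofReal_sub _ (by
      rw [sub_nonneg, Real.exp_le_one_iff]
      have := mul_nonneg hr.le hu
      linarith)]
  congr 1
  ring

lemma lintegral_expMeasure {r : ℝ} (hr : 0 < r) {G : ℝ → ENNReal} (hG : Measurable G) :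
    ∫⁻ u, G u ∂expMeasure r =
      ENNReal.ofReal r * ∫⁻ u in Ioi 0, expMeasure r (Ici u) * G u := by
  have e0 : expMeasure r = volume.withDensity (exponentialPDF r) := rfl
  have hm : Measurable (exponentialPDF r) := (measurable_exponentialPDFReal r).ennreal_ofReal
  conv_lhs => rw [e0]
  rw [lintegral_withDensity_eq_lintegral_mul _ hm hG, ← lintegral_const_mul' _ _ ENNReal.ofReal_ne_top,
    ← lintegral_indicator measurableSet_Ioi]
  refine lintegral_congr_ae ?_
  have h0 : ∀ᵐ u : ℝ, u ≠ 0 := by simp [ae_iff]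
  filter_upwards [h0] with u hu
  rcases lt_or_gt_of_ne hu with hu | hu
  · simp [Pi.mul_apply, exponentialPDF_of_neg hu, not_lt.2 hu.le]
  · rw [indicator_of_mem (mem_Ioi.2 hu), Pi.mul_apply, exponentialPDF_of_nonneg hu.le,
      expMeasure_Ici hr hu.le, ENNReal.ofReal_mul hr.le, mul_assoc]

/-! ### Arrival times and the past of an outcome -/

/-- The time of the `n`-th jump, with `arrival 0 = 0`. -/
def arrival (n : ℕ) (ω : Outcome) : ℝ := ∑ k ∈ Finset.range n, (ω k).1

/-- The outcome stopped after its first `n` coordinates. -/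
def trunc (n : ℕ) (ω : Outcome) : Outcome := fun k => if k < n then ω k else 0

lemma jumpTime_eq_arrival (n : ℕ) (ω : Outcome) : jumpTime n ω = arrival (n + 1) ω := rfl

lemma arrival_zero (ω : Outcome) : arrival 0 ω = 0 := Finset.sum_range_zero _

lemma arrival_succ (n : ℕ) (ω : Outcome) : arrival (n + 1) ω = arrival n ω + (ω n).1 :=
  Finset.sum_range_succ _ _

lemma measurable_arrival (n : ℕ) : Measurable (arrival n) := by
  unfold arrival
  fun_prop

lemma measurable_trunc (n : ℕ) : Measurable (trunc n) := by
  refine measurable_pi_lambda _ fun k => ?_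
  by_cases hk : k < n
  · simpa only [trunc, hk, if_true] using measurable_pi_apply k
  · simpa only [trunc, hk, if_false] using measurable_const

lemma arrival_trunc {k n : ℕ} (h : k ≤ n) (ω : Outcome) : arrival k (trunc n ω) = arrival k ω := by
  refine Finset.sum_congr rfl fun i hi => ?_
  rw [trunc, if_pos ((Finset.mem_range.1 hi).trans_le h)]

lemma trunc_trunc {k n : ℕ} (h : k ≤ n) (ω : Outcome) : trunc k (trunc n ω) = trunc k ω := by
  funext i
  by_cases hi : i < k
  · simp [trunc, hi, hi.trans_le h]
  · simp [trunc, hi]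

variable {ν : Measure ℝ} [IsProbabilityMeasure ν] {ε : ℝ}

lemma intensity_pos (hε : 0 < ε) : 0 < intensity ε := inv_pos.2 hε

lemma isProbabilityMeasure_jumpLaw (ν : Measure ℝ) [IsProbabilityMeasure ν] (hε : 0 < ε) :
    IsProbabilityMeasure (jumpLaw ν ε) := by
  have := isProbabilityMeasure_expMeasure (intensity_pos hε)
  unfold jumpLaw
  infer_instance

/-- Independence of the coordinates, with the finite past padded by zeros to remain an outcome. -/
lemma map_trunc_prod (ν : Measure ℝ) [IsProbabilityMeasure ν] (hε : 0 < ε) (n : ℕ) :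
    (jumpLaw ν ε).map (fun ω => (trunc n ω, ω n)) =
      ((jumpLaw ν ε).map (trunc n)).prod ((expMeasure (intensity ε)).prod ν) := by
  have := isProbabilityMeasure_expMeasure (intensity_pos hε)
  have hP := isProbabilityMeasure_jumpLaw ν hε
  have h1 : iIndepFun (fun (i : ℕ) (ω : Outcome) => ω i) (jumpLaw ν ε) :=
    iIndepFun_infinitePi (P := fun _ : ℕ => (expMeasure (intensity ε)).prod ν)
      (X := fun _ y => y) (fun _ => measurable_id)
  have h2 := h1.indepFun_finset (Finset.range n) {n} (by simp) (fun i => measurable_pi_apply i)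
  have h3 : IndepFun (trunc n) (fun ω : Outcome => ω n) (jumpLaw ν ε) := by
    let φ : ((Finset.range n) → ℝ × ℝ) → Outcome := fun y k =>
      if hk : k < n then y ⟨k, Finset.mem_range.2 hk⟩ else 0
    have hφ : Measurable φ := by
      refine measurable_pi_lambda _ fun k => ?_
      by_cases hk : k < n
      · simpa only [φ, hk, dite_true] using measurable_pi_apply _
      · simpa only [φ, hk, dite_false] using measurable_const
    have h4 := h2.comp hφ (measurable_pi_apply (⟨n, by simp⟩ : ({n} : Finset ℕ)))
    have h5 : trunc n = φ ∘ fun (ω : Outcome) (i : Finset.range n) => ω i := by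
      funext ω k
      by_cases hk : k < n <;> simp [trunc, φ, hk]
    rw [h5]
    exact h4
  rw [(indepFun_iff_map_prod_eq_prod_map_map (measurable_trunc n).aemeasurable
    (measurable_pi_apply n).aemeasurable).1 h3]
  congr 1
  exact Measure.infinitePi_map_eval (fun _ : ℕ => (expMeasure (intensity ε)).prod ν) n

/-! ### The compensation formula -/

/-- The set of `(s, ω)` with `s` between the `n`-th and the `(n+1)`-st jump. -/
def slab (n : ℕ) : Set (ℝ × Outcome) := {p | arrival n p.2 < p.1 ∧ p.1 ≤ arrival (n + 1) p.2}

lemma measurableSet_slab (n : ℕ) : MeasurableSet (slab n) :=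
  (measurableSet_lt ((measurable_arrival n).comp measurable_snd) measurable_fst).inter
    (measurableSet_le measurable_fst ((measurable_arrival (n + 1)).comp measurable_snd))

/-- Given the first n jumps, the next waiting time has density λ times its survival function. The
survival probability at s is that of finding no further jump before s, so integrating against it
amounts to integrating ds ⊗ P over the slab. -/
lemma lintegral_jump (hε : 0 < ε) (n : ℕ) {H : ℝ × Outcome × ℝ → ENNReal} (hH : Measurable H) :
    ∫⁻ ω, H (arrival (n + 1) ω, trunc n ω, (ω n).2) ∂jumpLaw ν ε =
      ENNReal.ofReal (intensity ε) * ∫⁻ p in slab n, ∫⁻ e, H (p.1, trunc n p.2, e) ∂ν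
        ∂(volume.prod (jumpLaw ν ε)) := by
  have hP := isProbabilityMeasure_jumpLaw ν hε
  have hr := intensity_pos hε
  have hE := isProbabilityMeasure_expMeasure hr
  set P := jumpLaw ν ε
  set Q := P.map (trunc n) with hQ
  have hQP : IsProbabilityMeasure Q := Measure.isProbabilityMeasure_map (measurable_trunc n).aemeasurable
  have hpair : Measurable fun ω : Outcome => (trunc n ω, ω n) :=
    (measurable_trunc n).prodMk (measurable_pi_apply n)
  have ha := measurable_arrival n
  -- joint law of the past and the next waiting time and mark
  have key : ∀ F : Outcome × ℝ × ℝ → ENNReal, Measurable F →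
      ∫⁻ ω, F (trunc n ω, ω n) ∂P =
        ∫⁻ η, ∫⁻ u, ∫⁻ e, F (η, u, e) ∂ν ∂expMeasure (intensity ε) ∂Q := by
    intro F hF
    rw [← lintegral_map hF hpair, map_trunc_prod ν hε n, lintegral_prod _ hF.aemeasurable]
    exact lintegral_congr fun η =>
      lintegral_prod (fun y => F (η, y)) (hF.comp measurable_prodMk_left).aemeasurable
  set G : ℝ × Outcome → ENNReal := fun p => ∫⁻ e, H (p.1, p.2, e) ∂ν with hG
  have hGm : Measurable G := by
    have : Measurable fun q : (ℝ × Outcome) × ℝ => H (q.1.1, q.1.2, q.2) := hH.comp (by fun_prop)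
    exact this.lintegral_prod_right'
  have hL : ∫⁻ ω, H (arrival (n + 1) ω, trunc n ω, (ω n).2) ∂P =
      ∫⁻ η, ∫⁻ u, G (arrival n η + u, η) ∂expMeasure (intensity ε) ∂Q := by
    rw [← key (fun q => H (arrival n q.1 + q.2.1, q.1, q.2.2)) (hH.comp (by fun_prop))]
    refine lintegral_congr fun ω => ?_
    simp only [arrival_succ, arrival_trunc le_rfl]
  -- At fixed s, averaging over the next waiting time turns the slab indicator into the survival
  -- function at s minus the last jump time.
  have hI : ∀ s, ∫⁻ ω, (slab n).indicator (fun p => G (p.1, trunc n p.2)) (s, ω) ∂P =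
      ∫⁻ η, (Ioi (arrival n η)).indicator
        (fun s => expMeasure (intensity ε) (Ici (s - arrival n η)) * G (s, η)) s ∂Q := by
    intro s
    set S : Set (Outcome × ℝ × ℝ) := {q | arrival n q.1 < s ∧ s ≤ arrival n q.1 + q.2.1} with hS
    have hSm : MeasurableSet S := by
      have h1 : Measurable fun q : Outcome × ℝ × ℝ => arrival n q.1 := ha.comp measurable_fst
      have h2 : Measurable fun q : Outcome × ℝ × ℝ => arrival n q.1 + q.2.1 := by fun_prop
      exact (measurableSet_lt h1 measurable_const).inter (measurableSet_le measurable_const h2)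
    have hG1 : Measurable fun q : Outcome × ℝ × ℝ => G (s, q.1) := hGm.comp (by fun_prop)
    have e1 := key (S.indicator fun q => G (s, q.1)) (hG1.indicator hSm)
    have e2 : ∀ ω, (slab n).indicator (fun p => G (p.1, trunc n p.2)) (s, ω) =
        S.indicator (fun q => G (s, q.1)) (trunc n ω, ω n) := by
      intro ω
      simp only [indicator, slab, hS, mem_ofPred_eq, arrival_succ, arrival_trunc le_rfl]
    simp_rw [e2]
    rw [e1]
    refine lintegral_congr fun η => ?_
    by_cases hs : arrival n η < s
    · rw [indicator_of_mem (mem_Ioi.2 hs)]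
      have e3 : ∀ u e, S.indicator (fun q => G (s, q.1)) (η, u, e) =
          (Ici (s - arrival n η)).indicator (fun _ => G (s, η)) u := by
        intro u e
        simp only [indicator, hS, mem_ofPred_eq, hs, true_and, mem_Ici, sub_le_iff_le_add']
      simp_rw [e3]
      simp only [lintegral_const, measure_univ, mul_one]
      rw [lintegral_indicator_const measurableSet_Ici, mul_comm]
    · rw [indicator_of_notMem (by simpa using hs)]
      have e3 : ∀ u e, S.indicator (fun q => G (s, q.1)) (η, u, e) = 0 := by
        intro u e
        simp only [indicator, hS, mem_ofPred_eq, hs, false_and, if_false]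
      simp [e3]
  have hKm : Measurable fun q : ℝ × Outcome => (Ioi (arrival n q.2)).indicator
      (fun s => expMeasure (intensity ε) (Ici (s - arrival n q.2)) * G (s, q.2)) q.1 := by
    have h1 : Antitone fun u => expMeasure (intensity ε) (Ici u) :=
      fun u v huv => measure_mono (Ici_subset_Ici.2 huv)
    have h2 : Measurable fun q : ℝ × Outcome =>
        expMeasure (intensity ε) (Ici (q.1 - arrival n q.2)) * G (q.1, q.2) :=
      (h1.measurable.comp (by fun_prop)).mul hGm
    exact h2.indicator (measurableSet_lt (ha.comp measurable_snd) measurable_fst)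
  rw [hL, ← lintegral_indicator (measurableSet_slab n), lintegral_prod _ (by
    refine Measurable.aemeasurable (Measurable.indicator ?_ (measurableSet_slab n))
    exact hGm.comp (measurable_fst.prodMk ((measurable_trunc n).comp measurable_snd)))]
  have hI' : ∫⁻ s, ∫⁻ ω, (slab n).indicator (fun p => ∫⁻ e, H (p.1, trunc n p.2, e) ∂ν) (s, ω) ∂P =
      ∫⁻ s, ∫⁻ η, (Ioi (arrival n η)).indicator
        (fun s => expMeasure (intensity ε) (Ici (s - arrival n η)) * G (s, η)) s ∂Q :=
    lintegral_congr hI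
  have hswap := lintegral_lintegral_swap (μ := volume) (ν := Q)
    (f := fun s η => (Ioi (arrival n η)).indicator
      (fun s => expMeasure (intensity ε) (Ici (s - arrival n η)) * G (s, η)) s) hKm.aemeasurable
  rw [hI', hswap, ← lintegral_const_mul' _ _ ENNReal.ofReal_ne_top]
  refine lintegral_congr fun η => ?_
  rw [lintegral_expMeasure hr (G := fun u => G (arrival n η + u, η)) (hGm.comp (by fun_prop)),
    ← lintegral_add_left_eq_self (μ := volume) _ (arrival n η), ← lintegral_indicator measurableSet_Ioi]
  congr 1
  refine lintegral_congr fun u => ?_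
  by_cases hu : 0 < u
  · rw [indicator_of_mem (mem_Ioi.2 hu), indicator_of_mem (by simpa using hu), add_sub_cancel_left]
  · rw [indicator_of_notMem (by simpa using hu), indicator_of_notMem (by simpa using hu)]

/-- The restriction of `ds ⊗ P` to a slab. -/
def slabMeasure (ν : Measure ℝ) (ε : ℝ) (n : ℕ) : Measure (ℝ × Outcome) :=
  (volume.prod (jumpLaw ν ε)).restrict (slab n)

lemma lintegral_jump' (hε : 0 < ε) (n : ℕ) {H : ℝ × Outcome × ℝ → ENNReal} (hH : Measurable H) :
    ∫⁻ ω, H (arrival (n + 1) ω, trunc n ω, (ω n).2) ∂jumpLaw ν ε =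
      ENNReal.ofReal (intensity ε) * ∫⁻ p, ∫⁻ e, H (p.1, trunc n p.2, e) ∂ν ∂slabMeasure ν ε n :=
  lintegral_jump hε n hH

/-- The compensation formula with integrand 1: the mean waiting time is 1/λ. In particular slabs
have finite mass. -/
lemma slabMeasure_univ (hε : 0 < ε) (n : ℕ) :
    ENNReal.ofReal (intensity ε) * slabMeasure ν ε n univ = 1 := by
  have hP := isProbabilityMeasure_jumpLaw ν hε
  have := lintegral_jump' (ν := ν) hε n (H := fun _ => 1) measurable_const
  simpa using this.symm

lemma isFiniteMeasure_slabMeasure (ν : Measure ℝ) [IsProbabilityMeasure ν] (hε : 0 < ε) (n : ℕ) :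
    IsFiniteMeasure (slabMeasure ν ε n) := by
  refine ⟨lt_top_iff_ne_top.2 fun h => ?_⟩
  have := slabMeasure_univ (ν := ν) hε n
  rw [h, ENNReal.mul_top (by simpa using intensity_pos hε)] at this
  simp at this

lemma integral_jump (hε : 0 < ε) (n : ℕ) {Φ : ℝ × Outcome × ℝ → ℝ} (hΦ : Measurable Φ) {C : ℝ}
    (hC : ∀ q, |Φ q| ≤ C) :
    ∫ ω, Φ (arrival (n + 1) ω, trunc n ω, (ω n).2) ∂jumpLaw ν ε =
      intensity ε * ∫ p, ∫ e, Φ (p.1, trunc n p.2, e) ∂ν ∂slabMeasure ν ε n := by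
  have hP := isProbabilityMeasure_jumpLaw ν hε
  have hF := isFiniteMeasure_slabMeasure ν hε n
  have hr := intensity_pos hε
  have hm1 : Measurable fun ω : Outcome => (arrival (n + 1) ω, trunc n ω, (ω n).2) :=
    (measurable_arrival _).prodMk ((measurable_trunc n).prodMk (by fun_prop))
  have hm2 : Measurable fun q : (ℝ × Outcome) × ℝ => (q.1.1, trunc n q.1.2, q.2) :=
    (by fun_prop : Measurable fun q : (ℝ × Outcome) × ℝ => q.1.1).prodMk
      (((measurable_trunc n).comp (by fun_prop)).prodMk measurable_snd)
  have hlaw : (jumpLaw ν ε).map (fun ω : Outcome => (arrival (n + 1) ω, trunc n ω, (ω n).2)) =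
      ENNReal.ofReal (intensity ε) • ((slabMeasure ν ε n).prod ν).map
        (fun q : (ℝ × Outcome) × ℝ => (q.1.1, trunc n q.1.2, q.2)) := by
    refine Measure.ext_of_lintegral _ fun H hH => ?_
    rw [lintegral_map hH hm1, lintegral_smul_measure, lintegral_map hH hm2,
      lintegral_prod (fun q : (ℝ × Outcome) × ℝ => H (q.1.1, trunc n q.1.2, q.2)) (hH.comp hm2).aemeasurable,
      lintegral_jump' hε n hH, smul_eq_mul]
  rw [← integral_map hm1.aemeasurable hΦ.aestronglyMeasurable, hlaw, integral_smul_measure,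
    integral_map hm2.aemeasurable hΦ.aestronglyMeasurable, integral_prod, ENNReal.toReal_ofReal hr.le,
    smul_eq_mul]
  exact Integrable.of_bound (hΦ.comp hm2).aestronglyMeasurable C (ae_of_all _ fun q => hC _)

/-! ### Non-explosion -/

/-- Outcomes with positive waiting times and without accumulation of jumps. -/
def regularOutcomes : Set Outcome :=
  {ω | (∀ k, 0 < (ω k).1) ∧ ∀ N : ℕ, ∃ n, (N : ℝ) < arrival n ω}

lemma measurableSet_regularOutcomes : MeasurableSet regularOutcomes := by
  have h1 : regularOutcomes = (⋂ k : ℕ, {ω : Outcome | 0 < (ω k).1}) ∩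
      ⋂ N : ℕ, ⋃ n : ℕ, {ω : Outcome | (N : ℝ) < arrival n ω} := by
    ext ω
    simp [regularOutcomes]
  rw [h1]
  exact (MeasurableSet.iInter fun k => measurableSet_lt measurable_const (by fun_prop)).inter
    (MeasurableSet.iInter fun N => MeasurableSet.iUnion fun n =>
      measurableSet_lt measurable_const (measurable_arrival n))

lemma strictMono_arrival {ω : Outcome} (h : ω ∈ regularOutcomes) :
    StrictMono fun n => arrival n ω :=
  strictMono_nat_of_lt_succ fun n => by
    rw [arrival_succ]
    linarith [h.1 n]

lemma exists_lt_arrival {ω : Outcome} (h : ω ∈ regularOutcomes) (c : ℝ) : ∃ n, c < arrival n ω := by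
  obtain ⟨N, hN⟩ := exists_nat_gt c
  obtain ⟨n, hn⟩ := h.2 N
  exact ⟨n, hN.trans hn⟩

lemma tendsto_arrival {ω : Outcome} (h : ω ∈ regularOutcomes) :
    Tendsto (fun n => arrival n ω) atTop atTop :=
  tendsto_atTop_atTop_of_monotone (strictMono_arrival h).monotone fun c => by
    obtain ⟨n, hn⟩ := exists_lt_arrival h c
    exact ⟨n, hn.le⟩

lemma ae_pos_waiting (hε : 0 < ε) : ∀ᵐ ω ∂jumpLaw ν ε, ∀ k, 0 < (ω k).1 := by
  have hr := intensity_pos hε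
  have hE := isProbabilityMeasure_expMeasure hr
  rw [ae_all_iff]
  intro k
  have h1 := Measure.infinitePi_map_eval (fun _ : ℕ => (expMeasure (intensity ε)).prod ν) k
  have h2 : ∀ᵐ y ∂(expMeasure (intensity ε)).prod ν, 0 < y.1 := by
    have h3 : ∀ᵐ u ∂expMeasure (intensity ε), 0 < u := by
      have h4 : expMeasure (intensity ε) {u | ¬0 < u} = 0 := by
        have h5 := lintegral_expMeasure hr (G := (Iic (0 : ℝ)).indicator 1)
          (measurable_one.indicator measurableSet_Iic)
        rw [lintegral_indicator_one measurableSet_Iic] at h5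
        have h6 : ∫⁻ u in Ioi (0 : ℝ), expMeasure (intensity ε) (Ici u) *
            (Iic (0 : ℝ)).indicator 1 u = 0 := by
          rw [setLIntegral_congr_fun measurableSet_Ioi (g := fun _ => 0), lintegral_zero]
          intro u hu
          rw [mem_Ioi] at hu
          simp [hu]
        rw [h6, mul_zero] at h5
        convert h5 using 2
        ext u
        simp
      exact h4
    exact Measure.quasiMeasurePreserving_fst.ae h3
  rw [← h1] at h2
  exact ae_of_ae_map (measurable_pi_apply k).aemeasurable h2

lemma disjoint_slab {ω : Outcome} (h : ∀ k, 0 < (ω k).1) {m n : ℕ} (hmn : m ≠ n) (s : ℝ)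
    (hm : (s, ω) ∈ slab m) (hn : (s, ω) ∈ slab n) : False := by
  have hmono : Monotone fun n => arrival n ω := monotone_nat_of_le_succ fun n => by
    rw [arrival_succ]
    linarith [h n]
  rcases lt_or_gt_of_ne hmn with hlt | hlt
  · exact absurd (hm.2.trans (hmono (Nat.succ_le_of_lt hlt))) (not_le.2 hn.1)
  · exact absurd (hn.2.trans (hmono (Nat.succ_le_of_lt hlt))) (not_le.2 hm.1)

/-- The slabs are almost surely disjoint, so together they cannot exceed the length of the time
interval. Both non-explosion and the summability of rewards rest on this. -/
lemma tsum_slabMeasure_le (hε : 0 < ε) (a b : ℝ) :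
    ∑' n, slabMeasure ν ε n (Ioc a b ×ˢ univ) ≤ ENNReal.ofReal (b - a) := by
  have hP := isProbabilityMeasure_jumpLaw ν hε
  have hm : ∀ n, MeasurableSet ((Ioc a b ×ˢ (univ : Set Outcome)) ∩ slab n) := fun n =>
    (measurableSet_Ioc.prod MeasurableSet.univ).inter (measurableSet_slab n)
  have h1 : ∀ n, slabMeasure ν ε n (Ioc a b ×ˢ univ) =
      (volume.prod (jumpLaw ν ε)) ((Ioc a b ×ˢ (univ : Set Outcome)) ∩ slab n) := fun n =>
    Measure.restrict_apply (measurableSet_Ioc.prod MeasurableSet.univ)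
  simp_rw [h1]
  rw [← measure_iUnion₀ (fun m n hmn => ?_) fun n => (hm n).nullMeasurableSet]
  · refine (measure_mono (iUnion_subset fun n => inter_subset_left)).trans ?_
    rw [Measure.prod_prod]
    simp
  · have h2 : ∀ᵐ p ∂(volume : Measure ℝ).prod (jumpLaw ν ε), ∀ k, 0 < (p.2 k).1 :=
      Measure.quasiMeasurePreserving_snd.ae (ae_pos_waiting (ν := ν) hε)
    refine measure_mono_null (show _ ⊆ {p | ¬∀ k, 0 < (p.2 k).1} from fun p hp hp' => ?_) h2
    exact disjoint_slab hp' hmn p.1 hp.1.2 hp.2.2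

/-- By the compensation formula the probabilities that the successive jumps fall in (0,N] have a
finite sum; Borel–Cantelli then leaves finitely many jumps in each such interval. -/
lemma ae_mem_regularOutcomes (hε : 0 < ε) : ∀ᵐ ω ∂jumpLaw ν ε, ω ∈ regularOutcomes := by
  have hP := isProbabilityMeasure_jumpLaw ν hε
  have h1 : ∀ N : ℕ, ∀ᵐ ω ∂jumpLaw ν ε, ∀ᶠ n in atTop, arrival (n + 1) ω ∉ Ioc 0 (N : ℝ) := by
    intro N
    have h2 : ∀ n, jumpLaw ν ε {ω | arrival (n + 1) ω ∈ Ioc 0 (N : ℝ)} =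
        ENNReal.ofReal (intensity ε) * slabMeasure ν ε n (Ioc 0 (N : ℝ) ×ˢ univ) := by
      intro n
      have h3 := lintegral_jump' (ν := ν) hε n
        (H := (Prod.fst ⁻¹' Ioc 0 (N : ℝ) : Set (ℝ × Outcome × ℝ)).indicator 1)
        (measurable_one.indicator (measurable_fst measurableSet_Ioc))
      have h4 : ∀ ω, (Prod.fst ⁻¹' Ioc 0 (N : ℝ) : Set (ℝ × Outcome × ℝ)).indicator
          (1 : ℝ × Outcome × ℝ → ENNReal) (arrival (n + 1) ω, trunc n ω, (ω n).2) =
          (arrival (n + 1) ⁻¹' Ioc 0 (N : ℝ)).indicator 1 ω := fun ω => by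
        simp [indicator]
      have h5 : ∀ p : ℝ × Outcome, ∫⁻ e, (Prod.fst ⁻¹' Ioc 0 (N : ℝ) :
          Set (ℝ × Outcome × ℝ)).indicator (1 : ℝ × Outcome × ℝ → ENNReal) (p.1, trunc n p.2, e) ∂ν =
          (Ioc 0 (N : ℝ) ×ˢ (univ : Set Outcome)).indicator 1 p := fun p => by
        simp [indicator]
      simp_rw [h4, h5] at h3
      rwa [lintegral_indicator_one (measurable_arrival _ measurableSet_Ioc),
        lintegral_indicator_one (measurableSet_Ioc.prod MeasurableSet.univ)] at h3
    have h3 := measure_limsup_atTop_eq_zero (μ := jumpLaw ν ε)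
      (s := fun n => {ω | arrival (n + 1) ω ∈ Ioc 0 (N : ℝ)}) (by
        simp_rw [h2]
        rw [ENNReal.tsum_mul_left]
        exact ENNReal.mul_ne_top ENNReal.ofReal_ne_top
          ((tsum_slabMeasure_le hε 0 N).trans_lt ENNReal.ofReal_lt_top).ne)
    have h4 : ∀ᵐ ω ∂jumpLaw ν ε,
        ω ∉ limsup (fun n => {ω | arrival (n + 1) ω ∈ Ioc 0 (N : ℝ)}) atTop :=
      measure_eq_zero_iff_ae_notMem.1 h3
    filter_upwards [h4] with ω hω
    rw [mem_limsup_iff_frequently_mem, not_frequently] at hω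
    exact hω
  filter_upwards [ae_pos_waiting (ν := ν) hε, ae_all_iff.2 h1] with ω h2 h3
  refine ⟨h2, fun N => ?_⟩
  obtain ⟨n, hn⟩ := (h3 N).exists
  refine ⟨n + 1, not_le.1 fun hle => hn ⟨?_, hle⟩⟩
  exact Finset.sum_pos (fun k _ => h2 k) (by simp)

end

section

/-! ### The jump measure as a sum over arrivals -/

lemma jumpMeasure_apply (ω : Outcome) {C : Set (ℝ × ℝ)} (hC : MeasurableSet C) :
    jumpMeasure ω C = ∑' k, C.indicator (1 : ℝ × ℝ → ENNReal) (arrival (k + 1) ω, (ω k).2) := by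
  simp only [jumpMeasure, Measure.sum_apply _ hC, Measure.dirac_apply' _ hC, jumpTime_eq_arrival,
    mark]

lemma jumpMeasure_apply_eq_sum {ω : Outcome} (hω : ω ∈ regularOutcomes) {C : Set (ℝ × ℝ)}
    (hC : MeasurableSet C) {s : ℝ} (hCs : ∀ z ∈ C, z.1 ≤ s) {n : ℕ} (hn : s < arrival (n + 1) ω) :
    jumpMeasure ω C = ∑ k ∈ Finset.range n,
      C.indicator (1 : ℝ × ℝ → ENNReal) (arrival (k + 1) ω, (ω k).2) := by
  rw [jumpMeasure_apply ω hC]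
  refine tsum_eq_sum fun k hk => indicator_of_notMem (fun hmem => ?_) _
  have h1 := hCs _ hmem
  have h2 : arrival (n + 1) ω ≤ arrival (k + 1) ω :=
    (strictMono_arrival hω).monotone (by simpa using hk)
  simp only at h1
  linarith

lemma jumpMeasure_restrict_eq_sum {ω : Outcome} (hω : ω ∈ regularOutcomes) {C : Set (ℝ × ℝ)}
    (hC : MeasurableSet C) {s : ℝ} (hCs : ∀ z ∈ C, z.1 ≤ s) {n : ℕ} (hn : s < arrival (n + 1) ω) :
    (jumpMeasure ω).restrict C = ∑ k ∈ Finset.range n,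
      (Measure.dirac (arrival (k + 1) ω, (ω k).2)).restrict C := by
  ext D hD
  rw [Measure.restrict_apply hD, jumpMeasure_apply_eq_sum hω (hD.inter hC) (fun z hz => hCs z hz.2) hn,
    Measure.finsetSum_apply]
  refine Finset.sum_congr rfl fun k _ => ?_
  rw [Measure.restrict_apply hD, Measure.dirac_apply' _ (hD.inter hC)]

lemma setIntegral_jumpMeasure {ω : Outcome} (hω : ω ∈ regularOutcomes) (φ : ℝ × ℝ → ℝ) (t : ℝ)
    {s : ℝ} {n : ℕ} (hn : s < arrival (n + 1) ω) :
    ∫ z in Ioc t s ×ˢ (univ : Set ℝ), φ z ∂jumpMeasure ω =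
      ∑ k ∈ Finset.range n, if t < arrival (k + 1) ω ∧ arrival (k + 1) ω ≤ s then
        φ (arrival (k + 1) ω, (ω k).2) else 0 := by
  have hC : MeasurableSet (Ioc t s ×ˢ (univ : Set ℝ)) := measurableSet_Ioc.prod MeasurableSet.univ
  have hd : ∀ z : ℝ × ℝ, Integrable φ ((Measure.dirac z).restrict (Ioc t s ×ˢ univ)) := fun z =>
    (integrable_dirac (by simp)).restrict
  rw [jumpMeasure_restrict_eq_sum hω hC (fun z hz => hz.1.2) hn,
    integral_finsetSum_measure fun k _ => hd _]
  refine Finset.sum_congr rfl fun k _ => ?_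
  classical
  rw [setIntegral_dirac]
  simp

/-! ### Predictable processes between two jumps -/

variable {ν : Measure ℝ} [IsProbabilityMeasure ν] {ε t : ℝ}

/-- When s₀ < s ≤ `arrival (n + 1)`, the jumps up to s₀ are among the first n, so the generating
counts depend on the truncated outcome only. The strict inequality excludes a further jump exactly
at s₀. Null events are replaced by the empty set. -/
lemma exists_past_set_of_filt (hε : 0 < ε) (s₀ : Ici t) {E : Set Outcome}
    (hE : MeasurableSet[filt ν ε t s₀] E) :
    ∃ Q : ℕ → Set Outcome, (∀ n, MeasurableSet (Q n)) ∧ ∀ᵐ ω ∂jumpLaw ν ε, ∀ n, ∀ s : ℝ,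
      s₀ < s → s ≤ arrival (n + 1) ω → (ω ∈ E ↔ trunc n ω ∈ Q n) := by
  induction E, hE using MeasurableSpace.generateFrom_induction with
  | hC E hE _ =>
    rcases hE with ⟨u, hu, B, hB, D, hD, rfl⟩ | ⟨hE, h0⟩
    · have hC : MeasurableSet (Ioc t u ×ˢ B) := measurableSet_Ioc.prod hB
      refine ⟨fun n => {η | ∑ k ∈ Finset.range n, (Ioc t u ×ˢ B).indicator (1 : ℝ × ℝ → ENNReal)
        (arrival (k + 1) η, (η k).2) ∈ D}, fun n => ?_, ?_⟩
      · refine measurableSet_preimage (f := fun η : Outcome => ∑ k ∈ Finset.range n,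
          (Ioc t u ×ˢ B).indicator (1 : ℝ × ℝ → ENNReal) (arrival (k + 1) η, (η k).2)) ?_ hD
        exact Finset.measurable_sum _ fun k _ => (measurable_one.indicator hC).comp
          ((measurable_arrival _).prodMk (by fun_prop))
      · filter_upwards [ae_mem_regularOutcomes (ν := ν) hε] with ω hω n s hs hsn
        rw [mem_preimage, jumpMeasure_apply_eq_sum hω hC (fun z hz => hz.1.2)
          ((hu.trans_lt hs).trans_le hsn)]
        have h1 : ∀ k ∈ Finset.range n, (Ioc t u ×ˢ B).indicator (1 : ℝ × ℝ → ENNReal)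
            (arrival (k + 1) ω, (ω k).2) = (Ioc t u ×ˢ B).indicator (1 : ℝ × ℝ → ENNReal)
            (arrival (k + 1) (trunc n ω), (trunc n ω k).2) := fun k hk => by
          have hk' := Finset.mem_range.1 hk
          rw [arrival_trunc (Nat.succ_le_of_lt hk'), trunc, if_pos hk']
        rw [Finset.sum_congr rfl h1]
    · refine ⟨fun _ => ∅, fun _ => MeasurableSet.empty, ?_⟩
      filter_upwards [measure_eq_zero_iff_ae_notMem.1 h0] with ω hω n s _ _
      simp [hω]
  | empty => exact ⟨fun _ => ∅, fun _ => MeasurableSet.empty, by simp⟩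
  | compl E _ ih =>
    obtain ⟨Q, hQ, h⟩ := ih
    refine ⟨fun n => (Q n)ᶜ, fun n => (hQ n).compl, ?_⟩
    filter_upwards [h] with ω hω n s h1 h2
    simp [hω n s h1 h2]
  | iUnion E _ ih =>
    choose Q hQ h using ih
    refine ⟨fun n => ⋃ i, Q i n, fun n => MeasurableSet.iUnion fun i => hQ i n, ?_⟩
    filter_upwards [ae_all_iff.2 h] with ω hω n s h1 h2
    simp only [mem_iUnion]
    exact exists_congr fun i => hω i n s h1 h2

lemma exists_past_set_of_predictable (hε : 0 < ε) {E : Set (Ici t × Outcome)}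
    (hE : MeasurableSet[(filt ν ε t).predictable] E) :
    ∃ Q : ℕ → Set (ℝ × Outcome), (∀ n, MeasurableSet (Q n)) ∧ ∀ᵐ ω ∂jumpLaw ν ε, ∀ n, ∀ s : Ici t,
      t < s → s ≤ arrival (n + 1) ω → ((s, ω) ∈ E ↔ ((s : ℝ), trunc n ω) ∈ Q n) := by
  induction E, hE using MeasurableSpace.generateFrom_induction with
  | hC E hE _ =>
    rcases hE with ⟨A, hA, rfl⟩ | ⟨s₀, A, hA, rfl⟩
    -- Generators carried by the initial time are invisible at times s > t.
    · refine ⟨fun _ => ∅, fun _ => MeasurableSet.empty, ae_of_all _ fun ω n s hs _ => ?_⟩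
      have : s ≠ ⊥ := fun h => by
        rw [h] at hs
        exact lt_irrefl _ hs
      simp [this]
    · obtain ⟨Q, hQ, h⟩ := exists_past_set_of_filt hε s₀ hA
      refine ⟨fun n => Ioi (s₀ : ℝ) ×ˢ Q n, fun n => measurableSet_Ioi.prod (hQ n), ?_⟩
      filter_upwards [h] with ω hω n s hs hsn
      simp only [mem_prod, mem_Ioi, Subtype.coe_lt_coe]
      refine and_congr_right fun hlt => hω n s hlt hsn
  | empty => exact ⟨fun _ => ∅, fun _ => MeasurableSet.empty, by simp⟩
  | compl E _ ih =>
    obtain ⟨Q, hQ, h⟩ := ih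
    refine ⟨fun n => (Q n)ᶜ, fun n => (hQ n).compl, ?_⟩
    filter_upwards [h] with ω hω n s h1 h2
    simp [hω n s h1 h2]
  | iUnion E _ ih =>
    choose Q hQ h using ih
    refine ⟨fun n => ⋃ i, Q i n, fun n => MeasurableSet.iUnion fun i => hQ i n, ?_⟩
    filter_upwards [ae_all_iff.2 h] with ω hω n s h1 h2
    simp only [mem_iUnion]
    exact exists_congr fun i => hω i n s h1 h2

/-- Rebuilds a real number from its rational lower cut; the supremum is taken in the extended reals
so that it is always defined and measurable. -/
lemma iSup_rat_lt (y : ℝ) (p : ℚ → Prop) [DecidablePred p] (hp : ∀ q, p q ↔ (q : ℝ) < y) :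
    ⨆ q : ℚ, (if p q then ((q : ℝ) : EReal) else ⊥) = y := by
  refine le_antisymm (iSup_le fun q => ?_) (le_of_forall_lt fun c hc => ?_)
  · split_ifs with h
    · exact EReal.coe_le_coe_iff.2 ((hp q).1 h).le
    · exact bot_le
  · obtain ⟨q, hq1, hq2⟩ := EReal.lt_iff_exists_rat_btwn.1 hc
    refine hq1.trans_le (le_iSup_of_le q ?_)
    rw [if_pos ((hp q).2 (by exact_mod_cast hq2))]

/-- Between two jumps a predictable process is a deterministic function of time and of the past. -/
lemma exists_past_control {A : Set ℝ} (hA : MeasurableSet A) [Nonempty A] (hε : 0 < ε)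
    {α : ℝ → Outcome → A} (hα : IsStronglyPredictable (filt ν ε t) fun s : Ici t => α s) :
    ∃ a : ℕ → ℝ × Outcome → A, (∀ n, Measurable (a n)) ∧ ∀ᵐ ω ∂jumpLaw ν ε, ∀ n, ∀ s,
      t < s → s ≤ arrival (n + 1) ω → α s ω = a n (s, trunc n ω) := by
  classical
  have hm : Measurable[(filt ν ε t).predictable] (Function.uncurry fun s : Ici t => α s) :=
    StronglyMeasurable.measurable hα
  have h1 : ∀ q : ℚ, MeasurableSet[(filt ν ε t).predictable]
      {p : Ici t × Outcome | (q : ℝ) < (α p.1 p.2 : ℝ)} := fun q =>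
    hm (measurable_subtype_coe measurableSet_Ioi)
  choose Q hQ h using fun q => exists_past_set_of_predictable hε (h1 q)
  -- A measurable retraction onto `A` keeps the rebuilt value admissible off the good event as well.
  obtain ⟨g, hg, hg'⟩ := (MeasurableEmbedding.subtype_coe hA).exists_measurable_extend
    (measurable_id (α := A)) (fun _ => inferInstance)
  refine ⟨fun n p => g (⨆ q : ℚ, (if p ∈ Q q n then ((q : ℝ) : EReal) else ⊥)).toReal,
    fun n => hg.comp (Measurable.ereal_toReal (Measurable.iSup fun q =>
      Measurable.ite (hQ q n) measurable_const measurable_const)), ?_⟩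
  filter_upwards [ae_all_iff.2 h] with ω hω n s hs hsn
  have h2 := iSup_rat_lt (α s ω) (fun q => (s, trunc n ω) ∈ Q q n)
    fun q => (hω q n ⟨s, hs.le⟩ hs hsn).symm
  rw [h2, EReal.toReal_coe]
  exact (congrFun hg' (α s ω)).symm

/-! ### The state after `n` jumps -/

variable {M : Data} {x : ℝ}

/-- The state on `[arrival n, arrival (n+1))` when the control is `a n (s, past)` on
`(arrival n, arrival (n+1)]`; jumps up to time `t` are ignored. -/
def stateSeq (M : Data) (ε t x : ℝ) (a : ℕ → ℝ × Outcome → M.A) : ℕ → Outcome → ℝ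
  | 0, _ => x
  | n + 1, ω => stateSeq M ε t x a n ω + if t < arrival (n + 1) ω then
      M.bEps ε (stateSeq M ε t x a n ω) (a n (arrival (n + 1) ω, trunc n ω)) (ω n).2 else 0

lemma stateSeq_trunc (a : ℕ → ℝ × Outcome → M.A) {k n : ℕ} (h : k ≤ n) (ω : Outcome) :
    stateSeq M ε t x a k (trunc n ω) = stateSeq M ε t x a k ω := by
  induction k with
  | zero => rfl
  | succ k ih =>
    have h1 : trunc n ω k = ω k := if_pos h
    simp only [stateSeq, ih (by omega), arrival_trunc h, trunc_trunc (by omega : k ≤ n), h1]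

lemma measurable_stateSeq (hM : M.Standing) {a : ℕ → ℝ × Outcome → M.A}
    (ha : ∀ n, Measurable (a n)) (n : ℕ) : Measurable (stateSeq M ε t x a n) := by
  induction n with
  | zero => exact measurable_const
  | succ n ih =>
    refine ih.add (Measurable.ite (measurableSet_lt measurable_const (measurable_arrival _)) ?_
      measurable_const)
    exact (hM.measurable_bEps ε).comp (ih.prodMk (((ha n).comp ((measurable_arrival _).prodMk
      (measurable_trunc n))).prodMk (by fun_prop)))

lemma before_eq_of_forall {X : ℝ → Outcome → ℝ} {ω : Outcome} {c s y : ℝ} (hc : c < s)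
    (h : ∀ u ∈ Ioo c s, X u ω = y) : before X s ω = y := by
  refine leftLim_eq_of_tendsto (tendsto_const_nhds.congr' ?_)
  filter_upwards [Ioo_mem_nhdsLT hc] with u hu using (h u hu).symm

/-- On a regular outcome the integral equation is a finite recursion over jumps. Any solution is
constant between jumps, and its left limits obey the recursion defining `stateSeq`. -/
lemma state_eq_stateSeq {α : ℝ → Outcome → M.A} {X : ℝ → Outcome → ℝ} {ω : Outcome}
    (hω : ω ∈ regularOutcomes)
    (hX : ∀ s, t ≤ s → X s ω = x + ∫ z in Ioc t s ×ˢ (univ : Set ℝ),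
      M.bEps ε (before X z.1 ω) (α z.1 ω) z.2 ∂jumpMeasure ω)
    {a : ℕ → ℝ × Outcome → M.A}
    (ha : ∀ n, ∀ s, t < s → s ≤ arrival (n + 1) ω → arrival n ω < s → α s ω = a n (s, trunc n ω))
    (n : ℕ) {s : ℝ} (hts : t < s) (hs : arrival n ω < s) (hs' : s ≤ arrival (n + 1) ω) :
    before X s ω = stateSeq M ε t x a n ω := by
  have hmono := strictMono_arrival hω
  let y : ℕ → ℝ := fun n => x + ∑ k ∈ Finset.range n, if t < arrival (k + 1) ω then
    M.bEps ε (before X (arrival (k + 1) ω) ω) (α (arrival (k + 1) ω) ω) (ω k).2 else 0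
  have hXy : ∀ n u, t ≤ u → arrival n ω ≤ u → u < arrival (n + 1) ω → X u ω = y n := by
    intro n u htu hu hu'
    rw [hX u htu, setIntegral_jumpMeasure hω _ t hu']
    congr 1
    refine Finset.sum_congr rfl fun k hk => ?_
    have : arrival (k + 1) ω ≤ u :=
      (hmono.monotone (Nat.succ_le_of_lt (Finset.mem_range.1 hk))).trans hu
    simp only [this, and_true]
  have hby : ∀ n u, t < u → arrival n ω < u → u ≤ arrival (n + 1) ω → before X u ω = y n := by
    intro n u htu hu hu'
    refine before_eq_of_forall (max_lt htu hu) fun v hv => ?_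
    exact hXy n v ((le_max_left _ _).trans hv.1.le) ((le_max_right _ _).trans hv.1.le)
      (hv.2.trans_le hu')
  have hy : ∀ n, y n = stateSeq M ε t x a n ω := by
    intro n
    induction n with
    | zero => simp [y, stateSeq]
    | succ n ih =>
      have h1 : y (n + 1) = y n + if t < arrival (n + 1) ω then
          M.bEps ε (before X (arrival (n + 1) ω) ω) (α (arrival (n + 1) ω) ω) (ω n).2 else 0 := by
        simp only [y, Finset.sum_range_succ, add_assoc]
      rw [h1, stateSeq, ← ih]
      congr 1
      have h2 := hmono (Nat.lt_succ_self n)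
      split_ifs with hlt
      · rw [hby n _ hlt h2 le_rfl, ha n _ hlt le_rfl h2]
      · rfl
  rw [hby n s hts hs hs', hy]

end

section

/-! ### The verification argument -/

variable {M : Data} {ε t x : ℝ}

lemma sum_slabMeasure_real_le {ν : Measure ℝ} [IsProbabilityMeasure ν] (hε : 0 < ε) {a b : ℝ}
    (hab : a ≤ b) (m : ℕ) :
    ∑ n ∈ Finset.range m, (slabMeasure ν ε n).real (Ioc a b ×ˢ univ) ≤ b - a := by
  have hF := fun n => isFiniteMeasure_slabMeasure ν hε n
  have h1 : ∑ n ∈ Finset.range m, slabMeasure ν ε n (Ioc a b ×ˢ univ) ≤ ENNReal.ofReal (b - a) :=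
    (ENNReal.sum_le_tsum _).trans (tsum_slabMeasure_le hε a b)
  have h2 := ENNReal.toReal_mono ENNReal.ofReal_ne_top h1
  rw [ENNReal.toReal_ofReal (by linarith), ENNReal.toReal_sum fun n _ => measure_ne_top _ _] at h2
  exact h2

lemma integral_jump_indicator {ν : Measure ℝ} [IsProbabilityMeasure ν] (hε : 0 < ε) (a b K : ℝ)
    (n : ℕ) :
    ∫ ω, (if arrival (n + 1) ω ∈ Ioc a b then K else 0) ∂jumpLaw ν ε =
      intensity ε * (K * (slabMeasure ν ε n).real (Ioc a b ×ˢ univ)) := by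
  have h1 := integral_jump (ν := ν) hε n (Φ := (Prod.fst ⁻¹' Ioc a b).indicator fun _ => K)
    (measurable_const.indicator (measurable_fst measurableSet_Ioc)) (C := |K|) fun q => by
      by_cases hq : q ∈ (Prod.fst ⁻¹' Ioc a b : Set (ℝ × Outcome × ℝ))
      · rw [indicator_of_mem hq]
      · rw [indicator_of_notMem hq, abs_zero]
        exact abs_nonneg K
  have h2 : ∀ p : ℝ × Outcome, ∫ e, (Prod.fst ⁻¹' Ioc a b : Set (ℝ × Outcome × ℝ)).indicator
      (fun _ => K) (p.1, trunc n p.2, e) ∂ν = (Ioc a b ×ˢ (univ : Set Outcome)).indicator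
        (fun _ => K) p := fun p => by
    simp [indicator]
  simp_rw [h2] at h1
  rw [integral_indicator_const _ (measurableSet_Ioc.prod MeasurableSet.univ), smul_eq_mul,
    mul_comm _ K] at h1
  rw [← h1]
  refine integral_congr_ae (ae_of_all _ fun ω => ?_)
  simp only [indicator, mem_preimage]

lemma clamp_mem_Ioc_iff {T a b s : ℝ} :
    s ∈ Ioc (max t (min a T)) (max t (min b T)) ↔ s ∈ Ioc a b ∧ s ∈ Ioc t T := by
  simp only [mem_Ioc, max_lt_iff, le_max_iff, le_min_iff, min_lt_iff]
  constructor
  · rintro ⟨⟨h1, h2⟩, h3⟩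
    rcases h3 with h3 | h3
    · linarith
    · rcases h2 with h2 | h2
      · exact ⟨⟨h2, h3.1⟩, h1, h3.2⟩
      · linarith [h3.2]
  · rintro ⟨⟨h1, h2⟩, h3, h4⟩
    exact ⟨⟨h3, Or.inl h1⟩, Or.inr ⟨h2, h4⟩⟩

section

variable (M) (ε t x) (a : ℕ → ℝ × Outcome → M.A) (W g : ℝ → ℝ → ℝ)

/-- The reward collected at the `(n+1)`-st jump. -/
def jumpReward (n : ℕ) (ω : Outcome) : ℝ :=
  if arrival (n + 1) ω ∈ Ioc t M.T then
    M.r (stateSeq M ε t x a n ω) (a n (arrival (n + 1) ω, trunc n ω)) else 0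

/-- The test function along the state, at the `n`-th jump time clamped to `[t,T]`. -/
def testValue (n : ℕ) (ω : Outcome) : ℝ :=
  W (max t (min (arrival n ω) M.T)) (stateSeq M ε t x a n ω)

/-- The reward and the increment of the test function at a jump at time `s` with mark `e`. -/
def jumpIncrement (n : ℕ) (q : ℝ × Outcome × ℝ) : ℝ :=
  if q.1 ∈ Ioc t M.T then
    ε * M.r (stateSeq M ε t x a n q.2.1) (a n (q.1, q.2.1)) +
      (W q.1 (stateSeq M ε t x a n q.2.1 +
          M.bEps ε (stateSeq M ε t x a n q.2.1) (a n (q.1, q.2.1)) q.2.2)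
        - W q.1 (stateSeq M ε t x a n q.2.1)) else 0

/-- The time derivative of the test function along the state. -/
def timeIncrement (n : ℕ) (p : ℝ × Outcome) : ℝ :=
  if p.1 ∈ Ioc t M.T then g p.1 (stateSeq M ε t x a n p.2) else 0

end

variable {a : ℕ → ℝ × Outcome → M.A} {W g : ℝ → ℝ → ℝ} {B : ℝ}

/-- Between the two jumps the state is frozen and `W` varies through its time derivative; at the
jump only the state moves. Clamping discards whatever happens outside (t,T]. -/
lemma testValue_succ (hW : IsTestPair M.T W g B) (ht : t ∈ Icc 0 M.T) {ω : Outcome}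
    (hω : ω ∈ regularOutcomes) (n : ℕ) :
    testValue M ε t x a W (n + 1) ω + ε * jumpReward M ε t x a n ω - testValue M ε t x a W n ω =
      jumpIncrement M ε t x a W n (arrival (n + 1) ω, trunc n ω, (ω n).2) +
        ∫ s, (slab n).indicator (timeIncrement M ε t x a g n) (s, ω) := by
  have hab : arrival n ω < arrival (n + 1) ω := strictMono_arrival hω (Nat.lt_succ_self n)
  set y := stateSeq M ε t x a n ω with hy
  have h1 : ∫ s, (slab n).indicator (timeIncrement M ε t x a g n) (s, ω) =
      W (max t (min (arrival (n + 1) ω) M.T)) y - W (max t (min (arrival n ω) M.T)) y := by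
    have hle : max t (min (arrival n ω) M.T) ≤ max t (min (arrival (n + 1) ω) M.T) :=
      max_le_max le_rfl (min_le_min hab.le le_rfl)
    rw [hW.sub_eq_integral y _ _ (ht.1.trans (le_max_left _ _)) hle
      (max_le ht.2 (min_le_right _ _)), intervalIntegral.integral_of_le hle,
      ← integral_indicator measurableSet_Ioc]
    refine integral_congr_ae (ae_of_all _ fun s => ?_)
    have h2 := clamp_mem_Ioc_iff (t := t) (T := M.T) (a := arrival n ω) (b := arrival (n + 1) ω)
      (s := s)
    simp only [indicator, slab, mem_ofPred_eq, timeIncrement, h2, mem_Ioc]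
    split_ifs <;> first | rfl | tauto
  rw [h1]
  have hy' : stateSeq M ε t x a n (trunc n ω) = y := stateSeq_trunc a le_rfl ω
  simp only [testValue, jumpReward, jumpIncrement, hy', ← hy, stateSeq]
  by_cases hT : arrival (n + 1) ω ≤ M.T
  · by_cases htl : t < arrival (n + 1) ω
    · rw [if_pos htl, if_pos ⟨htl, hT⟩, if_pos ⟨htl, hT⟩, min_eq_left hT, max_eq_right htl.le]
      ring
    · have : arrival (n + 1) ω ∉ Ioc t M.T := fun h => htl h.1
      rw [if_neg htl, if_neg this, if_neg this]
      simp
  -- After T the recursion still moves the state, but `W` vanishes at T, so this has no effect.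
  · have : arrival (n + 1) ω ∉ Ioc t M.T := fun h => hT h.2
    rw [if_neg this, if_neg this, min_eq_right (not_le.1 hT).le, max_eq_right ht.2, hW.terminal,
      hW.terminal]
    ring

lemma measurable_jumpIncrement (hM : M.Standing) (ha : ∀ n, Measurable (a n))
    (hW : IsTestPair M.T W g B) (n : ℕ) :
    Measurable (jumpIncrement M ε t x a W n) := by
  have hy : Measurable fun q : ℝ × Outcome × ℝ => stateSeq M ε t x a n q.2.1 :=
    (measurable_stateSeq hM ha n).comp (by fun_prop)
  have ha' : Measurable fun q : ℝ × Outcome × ℝ => a n (q.1, q.2.1) := (ha n).comp (by fun_prop)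
  have hb : Measurable fun q : ℝ × Outcome × ℝ =>
      M.bEps ε (stateSeq M ε t x a n q.2.1) (a n (q.1, q.2.1)) q.2.2 :=
    (hM.measurable_bEps ε).comp (hy.prodMk (ha'.prodMk (by fun_prop)))
  refine Measurable.ite (measurable_fst measurableSet_Ioc) ?_ measurable_const
  refine ((hM.continuous_r.measurable.comp (hy.prodMk ha')).const_mul ε).add (Measurable.sub ?_ ?_)
  · exact hW.measurable_fun.comp (measurable_fst.prodMk (hy.add hb))
  · exact hW.measurable_fun.comp (measurable_fst.prodMk hy)

lemma abs_jumpIncrement_le {K : ℝ} (hr : ∀ x a, |M.r x a| ≤ K) (hε : 0 < ε)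
    (hW : IsTestPair M.T W g B) (n : ℕ) (q : ℝ × Outcome × ℝ) :
    |jumpIncrement M ε t x a W n q| ≤ ε * K + (B + B) := by
  have h0 : ∀ y b, 0 ≤ ε * K + (B + B) := fun y b => by
    have := (abs_nonneg _).trans (hr y b)
    have := (abs_nonneg _).trans (hW.abs_fun_le 0 0)
    positivity
  rw [jumpIncrement]
  split_ifs
  · refine (abs_add_le _ _).trans (add_le_add ?_ ((abs_sub _ _).trans
      (add_le_add (hW.abs_fun_le _ _) (hW.abs_fun_le _ _))))
    rw [abs_mul, abs_of_pos hε]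
    exact mul_le_mul_of_nonneg_left (hr _ _) hε.le
  · rw [abs_zero]
    exact h0 0 (a 0 (0, 0))

lemma measurable_timeIncrement (hM : M.Standing) (ha : ∀ n, Measurable (a n))
    (hW : IsTestPair M.T W g B) (n : ℕ) :
    Measurable (timeIncrement M ε t x a g n) :=
  Measurable.ite (measurable_fst measurableSet_Ioc) (hW.measurable_deriv.comp
    (measurable_fst.prodMk ((measurable_stateSeq hM ha n).comp measurable_snd))) measurable_const

lemma abs_timeIncrement_le (hW : IsTestPair M.T W g B) (n : ℕ) (p : ℝ × Outcome) :
    |timeIncrement M ε t x a g n p| ≤ B := by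
  rw [timeIncrement]
  split_ifs
  · exact hW.abs_deriv_le _ _
  · rw [abs_zero]
    exact (abs_nonneg _).trans (hW.abs_deriv_le 0 0)

lemma measurable_jumpReward (hM : M.Standing) (ha : ∀ n, Measurable (a n)) (n : ℕ) :
    Measurable (jumpReward M ε t x a n) :=
  Measurable.ite (measurable_arrival _ measurableSet_Ioc) (hM.continuous_r.measurable.comp
    ((measurable_stateSeq hM ha n).prodMk ((ha n).comp
      ((measurable_arrival _).prodMk (measurable_trunc n))))) measurable_const

lemma abs_jumpReward_le {K : ℝ} (hr : ∀ x a, |M.r x a| ≤ K) (n : ℕ) (ω : Outcome) :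
    |jumpReward M ε t x a n ω| ≤ if arrival (n + 1) ω ∈ Ioc t M.T then K else 0 := by
  rw [jumpReward]
  split_ifs
  · exact hr _ _
  · simp

lemma measurable_testValue (hM : M.Standing) (ha : ∀ n, Measurable (a n))
    (hW : IsTestPair M.T W g B) (n : ℕ) :
    Measurable (testValue M ε t x a W n) :=
  hW.measurable_fun.comp ((by have := measurable_arrival n; fun_prop :
    Measurable fun ω => max t (min (arrival n ω) M.T)).prodMk (measurable_stateSeq hM ha n))

/-- The drift of the test function plus reward between two jumps. -/
def slabDrift (M : Data) (ε t x : ℝ) (a : ℕ → ℝ × Outcome → M.A) (W g : ℝ → ℝ → ℝ) (n : ℕ)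
    (p : ℝ × Outcome) : ℝ :=
  intensity ε * ∫ e, jumpIncrement M ε t x a W n (p.1, trunc n p.2, e) ∂M.ν
    + timeIncrement M ε t x a g n p

lemma slabDrift_eq (hM : M.Standing) (hε : 0 < ε) (hW : IsTestPair M.T W g B) (n : ℕ)
    (p : ℝ × Outcome) : slabDrift M ε t x a W g n p = if p.1 ∈ Ioc t M.T then
      driftTerm M ε W g p.1 (stateSeq M ε t x a n p.2) (a n (p.1, trunc n p.2)) else 0 := by
  have := hM.isProbabilityMeasure_ν
  rw [slabDrift, timeIncrement]
  simp only [jumpIncrement, stateSeq_trunc a le_rfl]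
  split_ifs with h
  · set y := stateSeq M ε t x a n p.2
    set b := a n (p.1, trunc n p.2)
    have hm : Measurable fun e => W p.1 (y + M.bEps ε y b e) - W p.1 y :=
      (hW.measurable_fun.comp (measurable_const.prodMk
        ((hM.measurable_bEps_mark ε y b).const_add y))).sub measurable_const
    have hint : Integrable (fun e => W p.1 (y + M.bEps ε y b e) - W p.1 y) M.ν :=
      hM.integrable_of_abs_le hm (C := B + B) fun e => (abs_sub _ _).trans
        (add_le_add (hW.abs_fun_le _ _) (hW.abs_fun_le _ _))
    rw [integral_add (integrable_const _) hint, integral_const, probReal_univ, one_smul, driftTerm,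
      intensity]
    field_simp
    ring
  · simp

lemma integrable_slabDrift (hM : M.Standing) (ha : ∀ n, Measurable (a n)) (hε : 0 < ε)
    (hW : IsTestPair M.T W g B) (n : ℕ) :
    Integrable (fun p : ℝ × Outcome => ∫ e, jumpIncrement M ε t x a W n (p.1, trunc n p.2, e) ∂M.ν)
      (slabMeasure M.ν ε n) ∧
    Integrable (timeIncrement M ε t x a g n) (slabMeasure M.ν ε n) := by
  have := hM.isProbabilityMeasure_ν
  have hF := isFiniteMeasure_slabMeasure M.ν hε n
  obtain ⟨K, -, -, -, hr⟩ := hM.exists_bound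
  constructor
  · have hm : Measurable fun q : (ℝ × Outcome) × ℝ =>
        jumpIncrement M ε t x a W n (q.1.1, trunc n q.1.2, q.2) :=
      (measurable_jumpIncrement hM ha hW n).comp
        ((by fun_prop : Measurable fun q : (ℝ × Outcome) × ℝ => q.1.1).prodMk
          (((measurable_trunc n).comp (by fun_prop)).prodMk measurable_snd))
    exact Integrable.of_bound hm.stronglyMeasurable.integral_prod_right'.aestronglyMeasurable
      (ε * K + (B + B)) (ae_of_all _ fun p => hM.abs_integral_le fun e =>
        abs_jumpIncrement_le hr hε hW n _)
  · exact Integrable.of_bound (measurable_timeIncrement hM ha hW n).aestronglyMeasurable B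
      (ae_of_all _ fun p => abs_timeIncrement_le hW n p)

/-- Expectation of the pathwise identity: the compensation formula moves the jump part onto the
slab, and Fubini does the same for the time part. -/
lemma integral_testValue_succ (hM : M.Standing) (ha : ∀ n, Measurable (a n)) (hε : 0 < ε)
    (hW : IsTestPair M.T W g B) (ht : t ∈ Icc 0 M.T) (n : ℕ) :
    ∫ ω, testValue M ε t x a W (n + 1) ω ∂jumpLaw M.ν ε
      + ε * ∫ ω, jumpReward M ε t x a n ω ∂jumpLaw M.ν ε
      - ∫ ω, testValue M ε t x a W n ω ∂jumpLaw M.ν ε =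
    ∫ p, slabDrift M ε t x a W g n p ∂slabMeasure M.ν ε n := by
  have := hM.isProbabilityMeasure_ν
  have hP := isProbabilityMeasure_jumpLaw M.ν hε
  obtain ⟨K, hK1, -, -, hr⟩ := hM.exists_bound
  obtain ⟨i1, i2⟩ := integrable_slabDrift (t := t) (x := x) hM ha hε hW n
  have hV : ∀ m, Integrable (testValue M ε t x a W m) (jumpLaw M.ν ε) := fun m =>
    Integrable.of_bound (measurable_testValue hM ha hW m).aestronglyMeasurable B
      (ae_of_all _ fun ω => hW.abs_fun_le _ _)
  have hR : Integrable (jumpReward M ε t x a n) (jumpLaw M.ν ε) :=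
    Integrable.of_bound (measurable_jumpReward hM ha n).aestronglyMeasurable K
      (ae_of_all _ fun ω => (abs_jumpReward_le hr n ω).trans (by split_ifs <;> linarith))
  have hJ : Integrable (fun ω => jumpIncrement M ε t x a W n
      (arrival (n + 1) ω, trunc n ω, (ω n).2)) (jumpLaw M.ν ε) :=
    Integrable.of_bound ((measurable_jumpIncrement hM ha hW n).comp ((measurable_arrival _).prodMk
      ((measurable_trunc n).prodMk (by fun_prop)))).aestronglyMeasurable (ε * K + (B + B))
      (ae_of_all _ fun ω => abs_jumpIncrement_le hr hε hW n _)
  have i3 : Integrable ((slab n).indicator (timeIncrement M ε t x a g n))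
      (volume.prod (jumpLaw M.ν ε)) := (integrable_indicator_iff (measurableSet_slab n)).2 i2
  have e1 : ∫ ω, (testValue M ε t x a W (n + 1) ω + ε * jumpReward M ε t x a n ω
      - testValue M ε t x a W n ω) ∂jumpLaw M.ν ε =
      ∫ ω, (jumpIncrement M ε t x a W n (arrival (n + 1) ω, trunc n ω, (ω n).2) +
        ∫ s, (slab n).indicator (timeIncrement M ε t x a g n) (s, ω)) ∂jumpLaw M.ν ε := by
    refine integral_congr_ae ?_
    filter_upwards [ae_mem_regularOutcomes (ν := M.ν) hε] with ω hω using testValue_succ hW ht hω n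
  have q1 := integral_sub ((hV (n + 1)).add (hR.const_mul ε)) (hV n)
  have q2 := integral_add (hV (n + 1)) (hR.const_mul ε)
  simp only [Pi.add_apply] at q1
  rw [q1, q2, integral_const_mul, integral_add hJ i3.integral_prod_right,
    ← integral_prod_symm _ i3, integral_indicator (measurableSet_slab n),
    integral_jump hε n (measurable_jumpIncrement hM ha hW n)
      (fun q => abs_jumpIncrement_le hr hε hW n q)] at e1
  rw [e1, ← integral_const_mul]
  exact (integral_add (i1.const_mul _) i2).symm

/-- Verification: if the drift term of a test pair stays between `lo ≤ 0` and `hi ≥ 0` along a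
controlled state, then the gain differs from the test function by at most `lo (T-t)` and
`hi (T-t)`. -/
theorem gain_sub_mem_Icc (hM : M.Standing) (hε : 0 < ε) (ht : t ∈ Icc 0 M.T)
    (hW : IsTestPair M.T W g B) {α : ℝ → Outcome → M.A} {X : ℝ → Outcome → ℝ}
    (hα : IsControl M ε t α) (hX : IsState M ε t x α X) {lo hi : ℝ} (hlo : lo ≤ 0) (hhi : 0 ≤ hi)
    (hdrift : ∀ᵐ ω ∂jumpLaw M.ν ε, ∀ s ∈ Ioo t M.T,
      driftTerm M ε W g s (before X s ω) (α s ω) ∈ Icc lo hi) :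
    gain M ε t α X - W t x ∈ Icc (lo * (M.T - t)) (hi * (M.T - t)) := by
  have := hM.isProbabilityMeasure_ν
  have hP := isProbabilityMeasure_jumpLaw M.ν hε
  have : Nonempty M.A := ⟨α 0 fun _ => 0⟩
  obtain ⟨K, hK1, -, -, hr⟩ := hM.exists_bound
  obtain ⟨a, ha, hαa⟩ := exists_past_control hM.isCompact_A.measurableSet hε hα
  -- identification of the state
  have hstate : ∀ᵐ ω ∂jumpLaw M.ν ε, ∀ n s, t < s → arrival n ω < s → s ≤ arrival (n + 1) ω →
      before X s ω = stateSeq M ε t x a n ω ∧ α s ω = a n (s, trunc n ω) := by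
    filter_upwards [hX, hαa, ae_mem_regularOutcomes (ν := M.ν) hε] with ω h1 h2 h3 n s h4 h5 h6
    exact ⟨state_eq_stateSeq h3 h1 (fun n s h7 h8 _ => h2 n s h7 h8) n h4 h5 h6, h2 n s h4 h6⟩
  set R := jumpReward M ε t x a with hR
  set V := testValue M ε t x a W with hV
  set m : ℕ → ℝ := fun n => (slabMeasure M.ν ε n).real (Ioc t M.T ×ˢ univ) with hm
  have hm0 : ∀ n, 0 ≤ m n := fun n => measureReal_nonneg
  have hmsum : ∀ k, ∑ n ∈ Finset.range k, m n ≤ M.T - t := fun k =>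
    sum_slabMeasure_real_le hε ht.2 k
  have hstep : ∀ n, ∫ p, slabDrift M ε t x a W g n p ∂slabMeasure M.ν ε n ∈
      Icc (lo * m n) (hi * m n) := by
    intro n
    have hF := isFiniteMeasure_slabMeasure M.ν hε n
    obtain ⟨i1, i2⟩ := integrable_slabDrift (t := t) (x := x) hM ha hε hW n
    have hint : Integrable (slabDrift M ε t x a W g n) (slabMeasure M.ν ε n) :=
      (i1.const_mul _).add i2
    have hC : MeasurableSet (Ioc t M.T ×ˢ (univ : Set Outcome)) :=
      measurableSet_Ioc.prod MeasurableSet.univ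
    have hc : ∀ c : ℝ, ∫ p, (Ioc t M.T ×ˢ (univ : Set Outcome)).indicator (fun _ => c) p
        ∂slabMeasure M.ν ε n = c * m n := fun c => by
      rw [integral_indicator_const _ hC, smul_eq_mul, mul_comm]
    have hci : ∀ c : ℝ, Integrable ((Ioc t M.T ×ˢ (univ : Set Outcome)).indicator fun _ => c)
        (slabMeasure M.ν ε n) := fun c => (integrable_const c).indicator hC
    have hae : ∀ᵐ p ∂slabMeasure M.ν ε n, p.1 ∈ Ioc t M.T →
        slabDrift M ε t x a W g n p ∈ Icc lo hi := by
      -- The drift is controlled only before T; the slice at time T has measure zero.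
      have h1 : ∀ᵐ p ∂(volume : Measure ℝ).prod (jumpLaw M.ν ε), p.1 ≠ M.T :=
        Measure.quasiMeasurePreserving_fst.ae (p := fun s => s ≠ M.T) (by simp [ae_iff])
      have h2 : ∀ᵐ p ∂(volume : Measure ℝ).prod (jumpLaw M.ν ε), _ :=
        Measure.quasiMeasurePreserving_snd.ae (hstate.and hdrift)
      filter_upwards [ae_restrict_of_ae h1, ae_restrict_of_ae h2,
        ae_restrict_mem (measurableSet_slab n)] with p h3 h4 h5 h6
      rw [slabDrift_eq hM hε hW, if_pos h6]
      obtain ⟨h7, h8⟩ := h4.1 n p.1 h6.1 h5.1 h5.2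
      rw [← h7, ← h8]
      exact h4.2 p.1 ⟨h6.1, lt_of_le_of_ne h6.2 h3⟩
    constructor
    · rw [← hc lo]
      refine integral_mono_ae (hci lo) hint ?_
      filter_upwards [hae] with p hp
      by_cases h : p.1 ∈ Ioc t M.T
      · have hmem : p ∈ Ioc t M.T ×ˢ (univ : Set Outcome) := ⟨h, mem_univ _⟩
        rw [indicator_of_mem hmem]
        exact (hp h).1
      · rw [indicator_of_notMem (fun h' => h h'.1), slabDrift_eq hM hε hW, if_neg h]
    · rw [← hc hi]
      refine integral_mono_ae hint (hci hi) ?_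
      filter_upwards [hae] with p hp
      by_cases h : p.1 ∈ Ioc t M.T
      · have hmem : p ∈ Ioc t M.T ×ˢ (univ : Set Outcome) := ⟨h, mem_univ _⟩
        rw [indicator_of_mem hmem]
        exact (hp h).2
      · rw [indicator_of_notMem (fun h' => h h'.1), slabDrift_eq hM hε hW, if_neg h]
  -- telescoping
  have hV0 : ∫ ω, V 0 ω ∂jumpLaw M.ν ε = W t x := by
    have : ∀ ω, V 0 ω = W t x := fun ω => by
      simp only [hV, testValue, stateSeq, arrival_zero]
      rw [min_eq_left (ht.1.trans ht.2), max_eq_left ht.1]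
    simp [this]
  have htel : ∀ k, ∫ ω, V k ω ∂jumpLaw M.ν ε
      + ε * ∑ n ∈ Finset.range k, ∫ ω, R n ω ∂jumpLaw M.ν ε - W t x ∈
      Icc (lo * (M.T - t)) (hi * (M.T - t)) := by
    intro k
    have e1 : ∫ ω, V k ω ∂jumpLaw M.ν ε
        + ε * ∑ n ∈ Finset.range k, ∫ ω, R n ω ∂jumpLaw M.ν ε - W t x =
        ∑ n ∈ Finset.range k, ∫ p, slabDrift M ε t x a W g n p ∂slabMeasure M.ν ε n := by
      induction k with
      | zero => simp [hV0]
      | succ k ih =>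
        rw [Finset.sum_range_succ, Finset.sum_range_succ, ← ih,
          ← integral_testValue_succ hM ha hε hW ht k]
        ring
    rw [e1]
    constructor
    · calc lo * (M.T - t) ≤ lo * ∑ n ∈ Finset.range k, m n :=
            mul_le_mul_of_nonpos_left (hmsum k) hlo
        _ = ∑ n ∈ Finset.range k, lo * m n := Finset.mul_sum _ _ _
        _ ≤ _ := Finset.sum_le_sum fun n _ => (hstep n).1
    · calc _ ≤ ∑ n ∈ Finset.range k, hi * m n := Finset.sum_le_sum fun n _ => (hstep n).2
        _ = hi * ∑ n ∈ Finset.range k, m n := (Finset.mul_sum _ _ _).symm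
        _ ≤ _ := mul_le_mul_of_nonneg_left (hmsum k) hhi
  -- passage to the limit
  have hlimV : Tendsto (fun k => ∫ ω, V k ω ∂jumpLaw M.ν ε) atTop (𝓝 0) := by
    have h1 := tendsto_integral_of_dominated_convergence (μ := jumpLaw M.ν ε) (F := V)
      (f := fun _ => (0 : ℝ)) (fun _ => B)
      (fun k => (measurable_testValue hM ha hW k).aestronglyMeasurable) (integrable_const B)
      (fun k => ae_of_all _ fun ω => hW.abs_fun_le _ _) (by
        filter_upwards [ae_mem_regularOutcomes (ν := M.ν) hε] with ω hω
        refine tendsto_const_nhds.congr' ?_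
        filter_upwards [(tendsto_arrival hω).eventually_ge_atTop M.T] with k hk
        simp only [hV, testValue]
        rw [min_eq_right hk, max_eq_right ht.2, hW.terminal])
    simpa using h1
  have hRint : ∀ n, Integrable (R n) (jumpLaw M.ν ε) := fun n =>
    Integrable.of_bound (measurable_jumpReward hM ha n).aestronglyMeasurable K
      (ae_of_all _ fun ω => (abs_jumpReward_le hr n ω).trans (by split_ifs <;> linarith))
  -- By compensation the n-th expected reward is at most λK times the slab mass in (t,T], and these
  -- masses are summable.
  have hRsum : Summable fun n => ∫ ω, ‖R n ω‖ ∂jumpLaw M.ν ε := by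
    have h1 : Summable m := summable_of_sum_range_le hm0 hmsum
    refine Summable.of_nonneg_of_le (fun n => integral_nonneg fun ω => norm_nonneg _) (fun n => ?_)
      ((h1.mul_left K).mul_left (intensity ε))
    rw [← integral_jump_indicator hε]
    refine integral_mono (hRint n).norm ?_ fun ω => abs_jumpReward_le hr n ω
    exact Integrable.of_bound (Measurable.ite (measurable_arrival _ measurableSet_Ioc)
      measurable_const measurable_const).aestronglyMeasurable K (ae_of_all _ fun ω => by
        rw [Real.norm_eq_abs, abs_of_nonneg (by split_ifs <;> linarith)]
        split_ifs <;> linarith)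
  have hlimR := (hasSum_integral_of_summable_integral_norm hRint hRsum).tendsto_sum_nat
  have hgain : gain M ε t α X = ε * ∫ ω, ∑' n, R n ω ∂jumpLaw M.ν ε := by
    rw [gain, intensity, inv_inv]
    congr 1
    refine integral_congr_ae ?_
    filter_upwards [hstate, ae_mem_regularOutcomes (ν := M.ν) hε] with ω h1 hω
    obtain ⟨k, hk⟩ := exists_lt_arrival hω M.T
    have hk' : M.T < arrival (k + 1) ω := hk.trans (strictMono_arrival hω (Nat.lt_succ_self k))
    rw [setIntegral_jumpMeasure hω (fun z => M.r (before X z.1 ω) (α z.1 ω)) t hk',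
      tsum_eq_sum (s := Finset.range k)]
    · refine Finset.sum_congr rfl fun n _ => ?_
      simp only [hR, jumpReward, mem_Ioc]
      split_ifs with h2
      · obtain ⟨h3, h4⟩ := h1 n _ h2.1 (strictMono_arrival hω (Nat.lt_succ_self n)) le_rfl
        rw [h3, h4]
      · rfl
    · intro n hn
      simp only [hR, jumpReward]
      rw [if_neg]
      rintro ⟨-, h2⟩
      have h3 : arrival (k + 1) ω ≤ arrival (n + 1) ω :=
        (strictMono_arrival hω).monotone (by simpa using hn)
      linarith
  have hlim : Tendsto (fun k => ∫ ω, V k ω ∂jumpLaw M.ν ε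
      + ε * ∑ n ∈ Finset.range k, ∫ ω, R n ω ∂jumpLaw M.ν ε - W t x) atTop
      (𝓝 (gain M ε t α X - W t x)) := by
    rw [hgain]
    have := (hlimV.add (hlimR.const_mul ε)).sub_const (W t x)
    rwa [zero_add] at this
  exact isClosed_Icc.mem_of_tendsto hlim (Eventually.of_forall htel)

end

section

/-! ### Integrals against a measurable family of finite measures -/

/-- A finite kernel needs a uniform mass bound. Dividing each measure by one plus its mass provides
it, and the factor is restored after integration. -/
lemma measurable_integral_of_isFiniteMeasure {Ω E : Type*} [MeasurableSpace Ω] [MeasurableSpace E]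
    {κ : Ω → Measure E} (hκ : Measurable κ) (hfin : ∀ ω, IsFiniteMeasure (κ ω)) {f : Ω × E → ℝ}
    (hf : Measurable f) : Measurable fun ω => ∫ z, f (ω, z) ∂κ ω := by
  have hm : Measurable fun ω => κ ω univ := Measure.measurable_measure.1 hκ _ MeasurableSet.univ
  let η : Kernel Ω E := ⟨fun ω => (1 + κ ω univ)⁻¹ • κ ω, by
    refine Measure.measurable_of_measurable_coe _ fun B hB => ?_
    simp only [Measure.smul_apply, smul_eq_mul]
    exact (measurable_const.add hm).inv.mul (Measure.measurable_measure.1 hκ _ hB)⟩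
  have hη : IsFiniteKernel η := ⟨1, ENNReal.one_lt_top, fun ω => by
    change (1 + κ ω univ)⁻¹ * κ ω univ ≤ 1
    rw [mul_comm, ← div_eq_mul_inv]
    exact ENNReal.div_le_of_le_mul (by rw [one_mul]; exact le_add_self)⟩
  have h1 : ∀ ω, ∫ z, f (ω, z) ∂κ ω = (1 + κ ω univ).toReal * ∫ z, f (ω, z) ∂η ω := by
    intro ω
    have := hfin ω
    change _ = _ * ∫ z, f (ω, z) ∂((1 + κ ω univ)⁻¹ • κ ω)
    rw [integral_smul_measure, smul_eq_mul, ← mul_assoc, ← ENNReal.toReal_mul,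
      ENNReal.mul_inv_cancel (by simp) (by finiteness), ENNReal.toReal_one, one_mul]
  simp_rw [h1]
  exact (measurable_const.add hm).ennreal_toReal.mul
    (hf.stronglyMeasurable.integral_kernel_prod_right (κ := η) (f := fun ω z => f (ω, z))).measurable

lemma measurable_measure_of_prod {Ω : Type*} [MeasurableSpace Ω] {κ : Ω → Measure (ℝ × ℝ)}
    (hfin : ∀ ω, IsFiniteMeasure (κ ω))
    (h : ∀ u B, MeasurableSet B → Measurable fun ω => κ ω (Iic u ×ˢ B))
    (huniv : Measurable fun ω => κ ω univ) : Measurable κ := by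
  refine Measurable.measure_of_isPiSystem (S := image2 (· ×ˢ ·) (range Iic) {B : Set ℝ | MeasurableSet B})
    ?_ (isPiSystem_Iic.prod MeasurableSpace.isPiSystem_measurableSet) ?_ huniv
  · refine (generateFrom_eq_prod ?_ MeasurableSpace.generateFrom_measurableSet ?_
      isCountablySpanning_measurableSet).symm
    · rw [← borel_eq_generateFrom_Iic ℝ]
      exact (BorelSpace.measurable_eq (α := ℝ)).symm
    · refine ⟨fun n : ℕ => Iic (n : ℝ), fun n => ⟨_, rfl⟩, ?_⟩
      exact iUnion_eq_univ_iff.2 fun x => exists_nat_ge x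
  · rintro _ ⟨_, ⟨u, rfl⟩, B, hB, rfl⟩
    exact h u B hB

/-! ### The jump measure on a bounded time interval -/

variable {ν : Measure ℝ} [IsProbabilityMeasure ν] {ε t : ℝ}

/-- The jump measure, replaced by zero on irregular outcomes. -/
def regularJumpMeasure : Outcome → Measure (ℝ × ℝ) := regularOutcomes.indicator jumpMeasure

lemma isFiniteMeasure_restrict_regularJumpMeasure (t q : ℝ) (ω : Outcome) :
    IsFiniteMeasure ((regularJumpMeasure ω).restrict (Ioc t q ×ˢ univ)) := by
  by_cases hω : ω ∈ regularOutcomes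
  · rw [regularJumpMeasure, indicator_of_mem hω]
    have hC : MeasurableSet (Ioc t q ×ˢ (univ : Set ℝ)) := measurableSet_Ioc.prod MeasurableSet.univ
    obtain ⟨n, hn⟩ := exists_lt_arrival hω q
    refine ⟨?_⟩
    rw [Measure.restrict_apply_univ, jumpMeasure_apply_eq_sum hω hC (fun z hz => hz.1.2)
      (hn.trans (strictMono_arrival hω (Nat.lt_succ_self n)))]
    refine ENNReal.sum_lt_top.2 fun k _ => ?_
    by_cases hk : (arrival (k + 1) ω, (ω k).2) ∈ Ioc t q ×ˢ (univ : Set ℝ)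
    · rw [indicator_of_mem hk]
      exact ENNReal.one_lt_top
    · rw [indicator_of_notMem hk]
      exact ENNReal.zero_lt_top
  · rw [regularJumpMeasure, indicator_of_notMem hω, Measure.restrict_zero]
    infer_instance

/-- Augmentation by null sets is what permits discarding irregular outcomes at every time. -/
lemma measurableSet_filt_regularOutcomes (hε : 0 < ε) (q : Ici t) :
    MeasurableSet[filt ν ε t q] regularOutcomes := by
  have h : MeasurableSet[filt ν ε t q] regularOutcomesᶜ :=
    MeasurableSpace.measurableSet_generateFrom
      (Or.inr ⟨measurableSet_regularOutcomes.compl, ae_mem_regularOutcomes (ν := ν) hε⟩)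
  have := h.compl
  rwa [compl_compl] at this

lemma measurable_filt_regularJumpMeasure (hε : 0 < ε) (q : Ici t) {u : ℝ} (hu : u ≤ q) {B : Set ℝ}
    (hB : MeasurableSet B) :
    Measurable[filt ν ε t q] fun ω => regularJumpMeasure ω (Ioc t u ×ˢ B) := by
  have h1 : Measurable[filt ν ε t q] fun ω => jumpMeasure ω (Ioc t u ×ˢ B) := fun D hD =>
    MeasurableSpace.measurableSet_generateFrom (Or.inl ⟨u, hu, B, hB, D, hD, rfl⟩)
  have h2 : (fun ω => regularJumpMeasure ω (Ioc t u ×ˢ B)) =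
      regularOutcomes.indicator fun ω => jumpMeasure ω (Ioc t u ×ˢ B) := by
    funext ω
    by_cases hω : ω ∈ regularOutcomes <;> simp [regularJumpMeasure, hω]
  rw [h2]
  exact h1.indicator (measurableSet_filt_regularOutcomes hε q)

lemma measurable_filt_integral (hε : 0 < ε) (q : Ici t) {f : Outcome × (ℝ × ℝ) → ℝ}
    (hf : Measurable[(filt ν ε t q).prod inferInstance] f) :
    Measurable[filt ν ε t q] fun ω =>
      ∫ z in Ioc t (q : ℝ) ×ˢ univ, f (ω, z) ∂regularJumpMeasure ω := by
  have hfin := isFiniteMeasure_restrict_regularJumpMeasure t q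
  refine @measurable_integral_of_isFiniteMeasure _ _ (filt ν ε t q) _ _ ?_ hfin _ hf
  refine @measurable_measure_of_prod _ (filt ν ε t q) _ hfin (fun u B hB => ?_) ?_
  · have h1 : ∀ ω, (regularJumpMeasure ω).restrict (Ioc t (q : ℝ) ×ˢ univ) (Iic u ×ˢ B) =
        regularJumpMeasure ω (Ioc t (min u q) ×ˢ B) := fun ω => by
      rw [Measure.restrict_apply (measurableSet_Iic.prod hB), prod_inter_prod, inter_univ,
        inter_comm, Ioc_inter_Iic, min_comm]
    simp_rw [h1]
    exact measurable_filt_regularJumpMeasure hε q (min_le_right _ _) hB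
  · simp_rw [Measure.restrict_apply_univ]
    exact measurable_filt_regularJumpMeasure hε q le_rfl MeasurableSet.univ

/-! ### The Euler scheme -/

variable {M : Data} {x : ℝ} {a : ℝ → ℝ → M.A}

/-- The grid of mesh `1/(m+1)` starting at `t`. -/
def gridTime (t : ℝ) (m k : ℕ) : ℝ := t + k / (m + 1)

lemma le_gridTime (t : ℝ) (m k : ℕ) : t ≤ gridTime t m k := by
  have : (0 : ℝ) ≤ k / (m + 1) := by positivity
  rw [gridTime]
  linarith

lemma gridTime_zero (t : ℝ) (m : ℕ) : gridTime t m 0 = t := by simp [gridTime]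

lemma gridTime_succ (t : ℝ) (m k : ℕ) : gridTime t m (k + 1) = gridTime t m k + 1 / (m + 1) := by
  simp only [gridTime]
  push_cast
  ring

lemma mem_Ioc_gridTime_iff {m k : ℕ} {s : ℝ} :
    s ∈ Ioc (gridTime t m k) (gridTime t m (k + 1)) ↔ ⌈(s - t) * (m + 1)⌉₊ = k + 1 := by
  have hm : (0 : ℝ) < m + 1 := by positivity
  rw [Nat.ceil_eq_iff (by omega), mem_Ioc, gridTime, gridTime, ← lt_sub_iff_add_lt',
    ← sub_le_iff_le_add', div_lt_iff₀ hm, le_div_iff₀ hm, Nat.add_sub_cancel]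

/-- The Euler scheme for the controlled state: on each grid interval the feedback is evaluated at
the state at the left end of the interval. -/
def eulerSeq (M : Data) (ε t x : ℝ) (a : ℝ → ℝ → M.A) (m : ℕ) : ℕ → Outcome → ℝ
  | 0, _ => x
  | k + 1, ω => eulerSeq M ε t x a m k ω +
      ∫ z in Ioc t (gridTime t m (k + 1)) ×ˢ (univ : Set ℝ),
        (if gridTime t m k < z.1 then
          M.bEps ε (eulerSeq M ε t x a m k ω) (a z.1 (eulerSeq M ε t x a m k ω)) z.2 else 0)
        ∂regularJumpMeasure ω

/-- The scheme at a grid time uses only jumps up to that time. The σ-algebra at that time must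
therefore be kept throughout, including in the measurability of the integral. -/
lemma measurable_eulerSeq (hM : M.Standing) (hε : 0 < ε) (ha : Measurable (Function.uncurry a))
    (m k : ℕ) : Measurable[filt M.ν ε t ⟨gridTime t m k, le_gridTime t m k⟩]
      (eulerSeq M ε t x a m k) := by
  have := hM.isProbabilityMeasure_ν
  induction k with
  | zero => exact measurable_const
  | succ k ih =>
    have hle : (⟨gridTime t m k, le_gridTime t m k⟩ : Ici t) ≤
        ⟨gridTime t m (k + 1), le_gridTime t m (k + 1)⟩ := by
      change gridTime t m k ≤ gridTime t m (k + 1)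
      rw [gridTime_succ]
      have : (0 : ℝ) ≤ 1 / (m + 1) := by positivity
      linarith
    have h1 := ih.mono ((filt M.ν ε t).mono hle) le_rfl
    refine h1.add (measurable_filt_integral hε ⟨gridTime t m (k + 1), le_gridTime t m (k + 1)⟩
      (f := fun p => if gridTime t m k < p.2.1 then
          M.bEps ε (eulerSeq M ε t x a m k p.1) (a p.2.1 (eulerSeq M ε t x a m k p.1)) p.2.2 else 0) ?_)
    let : MeasurableSpace Outcome := filt M.ν ε t ⟨gridTime t m (k + 1), le_gridTime t m (k + 1)⟩
    have h2 : Measurable fun p : Outcome × (ℝ × ℝ) => eulerSeq M ε t x a m k p.1 :=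
      h1.comp measurable_fst
    have h3 : Measurable fun p : Outcome × (ℝ × ℝ) => p.2.1 := measurable_fst.comp measurable_snd
    have h4 : Measurable fun p : Outcome × (ℝ × ℝ) => p.2.2 := measurable_snd.comp measurable_snd
    refine Measurable.ite (measurableSet_lt measurable_const h3) ?_ measurable_const
    exact (hM.measurable_bEps ε).comp (h2.prodMk ((ha.comp (h3.prodMk h2)).prodMk h4))

/-- The left-continuous piecewise constant process of the Euler scheme. -/
def eulerProcess (M : Data) (ε t x : ℝ) (a : ℝ → ℝ → M.A) (m : ℕ) (s : ℝ) (ω : Outcome) : ℝ :=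
  eulerSeq M ε t x a m (⌈(s - t) * (m + 1)⌉₊ - 1) ω

/-- On each half-open grid interval the process equals a variable known at its left end, so
preimages are countable unions of predictable rectangles. At s = t the ceiling is 0 and truncated
subtraction returns index 0, the initial state. -/
lemma measurable_eulerProcess (hM : M.Standing) (hε : 0 < ε) (ha : Measurable (Function.uncurry a))
    (m : ℕ) : Measurable[(filt M.ν ε t).predictable]
      fun p : Ici t × Outcome => eulerProcess M ε t x a m p.1 p.2 := by
  intro S hS
  have h1 : (fun p : Ici t × Outcome => eulerProcess M ε t x a m p.1 p.2) ⁻¹' S =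
      ({⊥} ×ˢ (eulerSeq M ε t x a m 0 ⁻¹' S)) ∪
      ⋃ k : ℕ, (Ioc (⟨gridTime t m k, le_gridTime t m k⟩ : Ici t)
        ⟨gridTime t m (k + 1), le_gridTime t m (k + 1)⟩) ×ˢ (eulerSeq M ε t x a m k ⁻¹' S) := by
    ext ⟨s, ω⟩
    have h2 : ∀ k, s ∈ Ioc (⟨gridTime t m k, le_gridTime t m k⟩ : Ici t)
        ⟨gridTime t m (k + 1), le_gridTime t m (k + 1)⟩ ↔ ⌈((s : ℝ) - t) * (m + 1)⌉₊ = k + 1 :=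
      fun k => mem_Ioc_gridTime_iff
    have h3 : s = ⊥ ↔ ⌈((s : ℝ) - t) * (m + 1)⌉₊ = 0 := by
      have hm : (0 : ℝ) < m + 1 := by positivity
      rw [Nat.ceil_eq_zero, ← le_bot_iff]
      change (s : ℝ) ≤ t ↔ _
      rw [← sub_nonpos]
      constructor
      · intro h
        exact mul_nonpos_of_nonpos_of_nonneg h hm.le
      · intro h
        exact nonpos_of_mul_nonpos_left h hm
    simp only [mem_union, mem_iUnion, mem_prod, h2, mem_singleton_iff, h3, mem_preimage,
      eulerProcess]
    rcases Nat.eq_zero_or_pos ⌈((s : ℝ) - t) * (m + 1)⌉₊ with h0 | h0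
    · simp [h0]
    · obtain ⟨k, hk⟩ := Nat.exists_eq_succ_of_ne_zero h0.ne'
      rw [hk]
      simp
  rw [h1]
  refine MeasurableSet.union ?_ (MeasurableSet.iUnion fun k => ?_)
  · refine measurableSet_predictable_singleton_bot_prod ?_
    exact measurable_const hS
  · exact measurableSet_predictable_Ioc_prod _ _ (measurable_eulerSeq hM hε ha m k hS)

end

section

/-! ### The state in feedback form -/

variable {M : Data} {ε t x : ℝ} {a : ℝ → ℝ → M.A} {ω : Outcome}

/-- The state after `n` jumps under the feedback control `a`; jumps up to time `t` are ignored. -/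
def feedbackSeq (M : Data) (ε t x : ℝ) (a : ℝ → ℝ → M.A) : ℕ → Outcome → ℝ
  | 0, _ => x
  | n + 1, ω => feedbackSeq M ε t x a n ω + if t < arrival (n + 1) ω then
      M.bEps ε (feedbackSeq M ε t x a n ω) (a (arrival (n + 1) ω) (feedbackSeq M ε t x a n ω)) (ω n).2
      else 0

lemma feedbackSeq_of_le (hω : ω ∈ regularOutcomes) {n : ℕ} (hn : arrival n ω ≤ t) :
    feedbackSeq M ε t x a n ω = x := by
  induction n with
  | zero => rfl
  | succ n ih =>
    rw [feedbackSeq, if_neg (not_lt.2 hn), add_zero,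
      ih ((strictMono_arrival hω (Nat.lt_succ_self n)).le.trans hn)]

/-- The number of jumps strictly before time `s`. -/
def jumpsBefore (s : ℝ) (ω : Outcome) : ℕ := sInf {n | s ≤ arrival (n + 1) ω}

/-- The number of jumps up to time `s`. -/
def jumpsUpTo (s : ℝ) (ω : Outcome) : ℕ := sInf {n | s < arrival (n + 1) ω}

lemma jumpsBefore_spec (hω : ω ∈ regularOutcomes) {s : ℝ} (hs : 0 < s) :
    arrival (jumpsBefore s ω) ω < s ∧ s ≤ arrival (jumpsBefore s ω + 1) ω := by
  have hne : {n | s ≤ arrival (n + 1) ω}.Nonempty := by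
    obtain ⟨n, hn⟩ := exists_lt_arrival hω s
    exact ⟨n, hn.le.trans (strictMono_arrival hω (Nat.lt_succ_self n)).le⟩
  refine ⟨?_, Nat.sInf_mem hne⟩
  rcases h : jumpsBefore s ω with _ | n
  · rwa [arrival_zero]
  · have : n ∉ {n | s ≤ arrival (n + 1) ω} := Nat.notMem_of_lt_sInf (by
      rw [← jumpsBefore, h]
      exact Nat.lt_succ_self n)
    exact not_le.1 this

lemma jumpsUpTo_spec (hω : ω ∈ regularOutcomes) {s : ℝ} (hs : 0 ≤ s) :
    arrival (jumpsUpTo s ω) ω ≤ s ∧ s < arrival (jumpsUpTo s ω + 1) ω := by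
  have hne : {n | s < arrival (n + 1) ω}.Nonempty := by
    obtain ⟨n, hn⟩ := exists_lt_arrival hω s
    exact ⟨n, hn.trans (strictMono_arrival hω (Nat.lt_succ_self n))⟩
  refine ⟨?_, Nat.sInf_mem hne⟩
  rcases h : jumpsUpTo s ω with _ | n
  · rwa [arrival_zero]
  · have : n ∉ {n | s < arrival (n + 1) ω} := Nat.notMem_of_lt_sInf (by
      rw [← jumpsUpTo, h]
      exact Nat.lt_succ_self n)
    exact not_lt.1 this

lemma jumpsBefore_eq (hω : ω ∈ regularOutcomes) {s : ℝ} {n : ℕ} (hs : 0 < s) (h1 : arrival n ω < s)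
    (h2 : s ≤ arrival (n + 1) ω) : jumpsBefore s ω = n := by
  have h := jumpsBefore_spec hω hs
  have hmono := strictMono_arrival hω
  have h3 := hmono.lt_iff_lt.1 (h.1.trans_le h2)
  have h4 := hmono.lt_iff_lt.1 (h1.trans_le h.2)
  omega

lemma jumpsUpTo_eq (hω : ω ∈ regularOutcomes) {s : ℝ} {n : ℕ} (hs : 0 ≤ s) (h1 : arrival n ω ≤ s)
    (h2 : s < arrival (n + 1) ω) : jumpsUpTo s ω = n := by
  have h := jumpsUpTo_spec hω hs
  have hmono := strictMono_arrival hω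
  have h3 := hmono.lt_iff_lt.1 (h.1.trans_lt h2)
  have h4 := hmono.lt_iff_lt.1 (h1.trans_lt h.2)
  omega

/-- The state process of the feedback control. -/
def feedbackState (M : Data) (ε t x : ℝ) (a : ℝ → ℝ → M.A) (s : ℝ) (ω : Outcome) : ℝ :=
  feedbackSeq M ε t x a (jumpsUpTo s ω) ω

open Classical in
/-- The state process of the feedback control just before time `s`, for `s > t` and regular
outcomes. -/
def feedbackLeft (M : Data) (ε t x : ℝ) (a : ℝ → ℝ → M.A) (s : ℝ) (ω : Outcome) : ℝ :=
  if ω ∈ regularOutcomes ∧ t < s then feedbackSeq M ε t x a (jumpsBefore s ω) ω else x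

lemma before_feedbackState (hω : ω ∈ regularOutcomes) (ht : 0 ≤ t) {s : ℝ} (hs : t < s) :
    before (feedbackState M ε t x a) s ω = feedbackSeq M ε t x a (jumpsBefore s ω) ω := by
  have h := jumpsBefore_spec hω (ht.trans_lt hs)
  refine before_eq_of_forall (max_lt hs h.1) fun u hu => ?_
  rw [feedbackState, jumpsUpTo_eq hω (ht.trans ((le_max_left _ _).trans hu.1.le))
    ((le_max_right _ _).trans hu.1.le) (hu.2.trans_le h.2)]

lemma feedbackState_eq (hω : ω ∈ regularOutcomes) (ht : 0 ≤ t) {s : ℝ} (hs : t ≤ s) :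
    feedbackState M ε t x a s ω = x + ∫ z in Ioc t s ×ˢ (univ : Set ℝ),
      M.bEps ε (before (feedbackState M ε t x a) z.1 ω) (a z.1 (feedbackLeft M ε t x a z.1 ω)) z.2
        ∂jumpMeasure ω := by
  have h := jumpsUpTo_spec hω (ht.trans hs)
  have hmono := strictMono_arrival hω
  rw [setIntegral_jumpMeasure hω _ t h.2, feedbackState]
  have h1 : ∀ n, feedbackSeq M ε t x a n ω = x + ∑ k ∈ Finset.range n,
      if t < arrival (k + 1) ω then M.bEps ε (feedbackSeq M ε t x a k ω)
        (a (arrival (k + 1) ω) (feedbackSeq M ε t x a k ω)) (ω k).2 else 0 := by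
    intro n
    induction n with
    | zero => simp [feedbackSeq]
    | succ n ih => rw [feedbackSeq, Finset.sum_range_succ, ← add_assoc, ← ih]
  rw [h1]
  congr 1
  refine Finset.sum_congr rfl fun k hk => ?_
  have h2 : arrival (k + 1) ω ≤ s :=
    (hmono.monotone (Nat.succ_le_of_lt (Finset.mem_range.1 hk))).trans h.1
  by_cases h3 : t < arrival (k + 1) ω
  · rw [if_pos h3, if_pos ⟨h3, h2⟩, before_feedbackState hω ht h3, feedbackLeft, if_pos ⟨hω, h3⟩,
      jumpsBefore_eq hω (ht.trans_lt h3) (hmono (Nat.lt_succ_self k)) le_rfl]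
  · rw [if_neg h3, if_neg fun h => h3 h.1]

/-- A mesh below all relevant waiting times allows at most one jump per grid interval; freezing the
state at the left end is then exact. -/
lemma eulerSeq_eq_feedbackSeq (hω : ω ∈ regularOutcomes) (ht : 0 ≤ t) {m n : ℕ}
    (hm : ∀ i ≤ n, (1 : ℝ) / (m + 1) < (ω i).1) (k : ℕ)
    (hk : gridTime t m k < arrival (n + 1) ω) :
    eulerSeq M ε t x a m k ω = feedbackSeq M ε t x a (jumpsUpTo (gridTime t m k) ω) ω := by
  have hpos : (0 : ℝ) < 1 / (m + 1) := by positivity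
  have hmono := strictMono_arrival hω
  induction k with
  | zero =>
    rw [feedbackSeq_of_le hω, eulerSeq]
    have := (jumpsUpTo_spec hω (ht.trans (le_gridTime t m 0))).1
    rwa [gridTime_zero] at this ⊢
  | succ k ih =>
    have hgs := gridTime_succ t m k
    have ih' := ih (by linarith)
    have hj := jumpsUpTo_spec hω (ht.trans (le_gridTime t m k))
    have hj' := jumpsUpTo_spec hω (ht.trans (le_gridTime t m (k + 1)))
    set j := jumpsUpTo (gridTime t m k) ω with hjd
    set j' := jumpsUpTo (gridTime t m (k + 1)) ω with hjd'
    have hjn : j' < n + 1 := hmono.lt_iff_lt.1 (hj'.1.trans_lt hk)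
    have hjj : j < j' + 1 := hmono.lt_iff_lt.1 (hj.1.trans_lt (by linarith [hj'.2]))
    rw [eulerSeq, regularJumpMeasure, indicator_of_mem hω, setIntegral_jumpMeasure hω _ t hj'.2, ih']
    have hlow : ∀ i < j, ¬ gridTime t m k < arrival (i + 1) ω := fun i hi =>
      not_lt.2 ((hmono.monotone (Nat.succ_le_of_lt hi)).trans hj.1)
    have htk := le_gridTime t m k
    -- Either exactly one jump lies in the grid interval, or none does.
    rcases Nat.lt_succ_iff_lt_or_eq.1 hjj with hlt | heq
    · have hj1 : j' = j + 1 := by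
        by_contra hne
        have h1 : arrival (j + 2) ω ≤ arrival j' ω := hmono.monotone (by omega)
        have h2 := arrival_succ (j + 1) ω
        have h3 := hm (j + 1) (by omega)
        linarith [hj.2, hj'.1]
      rw [hj1, Finset.sum_range_succ, Finset.sum_eq_zero, zero_add, feedbackSeq]
      · have h1 : gridTime t m k < arrival (j + 1) ω := hj.2
        have h2 : t < arrival (j + 1) ω := htk.trans_lt h1
        have h3 : arrival (j + 1) ω ≤ gridTime t m (k + 1) := by
          rw [← hj1]
          exact hj'.1
        rw [if_pos ⟨h2, h3⟩, if_pos h1, if_pos h2]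
      · intro i hi
        simp only [if_neg (hlow i (Finset.mem_range.1 hi)), ite_self]
    · rw [← heq, Finset.sum_eq_zero, add_zero]
      intro i hi
      simp only [if_neg (hlow i (Finset.mem_range.1 hi)), ite_self]

/-- Path by path the sequence is eventually constant; the convergence holds for every outcome,
irregular ones included, as the limit of predictable processes requires. -/
lemma tendsto_eulerProcess (ht : 0 ≤ t) {s : ℝ} (hs : t ≤ s) (ω : Outcome) :
    Tendsto (fun m => eulerProcess M ε t x a m s ω) atTop (𝓝 (feedbackLeft M ε t x a s ω)) := by
  rcases hs.eq_or_lt with rfl | hs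
  · rw [feedbackLeft, if_neg (by simp)]
    simp [eulerProcess, eulerSeq]
  by_cases hω : ω ∈ regularOutcomes
  · rw [feedbackLeft, if_pos ⟨hω, hs⟩]
    have hn := jumpsBefore_spec hω (ht.trans_lt hs)
    set n := jumpsBefore s ω with hnd
    have h1 : ∀ c : ℝ, 0 < c → ∀ᶠ m : ℕ in atTop, (1 : ℝ) / (m + 1) < c := fun c hc =>
      tendsto_one_div_add_atTop_nhds_zero_nat.eventually_lt_const hc
    have h2 : ∀ᶠ m : ℕ in atTop, ∀ i ∈ Finset.range (n + 1), (1 : ℝ) / (m + 1) < (ω i).1 :=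
      (Finset.eventually_all _).2 fun i _ => h1 _ (hω.1 i)
    refine tendsto_const_nhds.congr' ?_
    -- The first condition places the last grid point before s after the last jump before s; the
    -- second separates the jumps.
    filter_upwards [h1 (s - arrival n ω) (sub_pos.2 hn.1), h2] with m hm1 hm2
    have hc : 0 < ⌈(s - t) * (m + 1)⌉₊ := by
      rw [Nat.ceil_pos]
      have := sub_pos.2 hs
      positivity
    obtain ⟨k, hk⟩ := Nat.exists_eq_succ_of_ne_zero hc.ne'
    have hsk := mem_Ioc_gridTime_iff.2 hk
    have hgs := gridTime_succ t m k
    rw [eulerProcess, hk, Nat.succ_sub_one, eulerSeq_eq_feedbackSeq hω ht (n := n)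
      (fun i hi => hm2 i (by simpa [Nat.lt_succ_iff] using hi)) k (hsk.1.trans_le hn.2)]
    rw [jumpsUpTo_eq hω (ht.trans (le_gridTime t m k)) (n := n) (by linarith [hsk.2])
      (hsk.1.trans_le hn.2)]
  · rw [feedbackLeft, if_neg fun h => hω h.1]
    have : ∀ m k, eulerSeq M ε t x a m k ω = x := by
      intro m k
      induction k with
      | zero => rfl
      | succ k ih => simp [eulerSeq, ih, regularJumpMeasure, hω]
    simp [eulerProcess, this]

lemma measurable_time_predictable {ν : Measure ℝ} :
    Measurable[(filt ν ε t).predictable] fun p : Ici t × Outcome => (p.1 : ℝ) := by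
  let : MeasurableSpace (Ici t × Outcome) := (filt ν ε t).predictable
  refine measurable_of_Ioi fun c => ?_
  rcases lt_or_ge c t with hc | hc
  · have : (fun p : Ici t × Outcome => (p.1 : ℝ)) ⁻¹' Ioi c = univ :=
      eq_univ_of_forall fun p => hc.trans_le p.1.2
    rw [this]
    exact MeasurableSet.univ
  · have : (fun p : Ici t × Outcome => (p.1 : ℝ)) ⁻¹' Ioi c = Ioi (⟨c, hc⟩ : Ici t) ×ˢ univ := by
      ext p
      simp only [mem_preimage, mem_Ioi, mem_prod, mem_univ, and_true]
      exact Iff.rfl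
    rw [this]
    exact measurableSet_predictable_Ioi_prod MeasurableSet.univ

/-- The state can be built jump by jump. Its left-limit version is predictable as a pointwise limit
of Euler processes, and composing with the Borel map gives the control. -/
lemma exists_isFeedbackPair (hM : M.Standing) (hε : 0 < ε) (ht : 0 ≤ t) (x : ℝ)
    (ha : Measurable (Function.uncurry a)) : ∃ α X, IsFeedbackPair M ε t x a α X := by
  have := hM.isProbabilityMeasure_ν
  have hreg := ae_mem_regularOutcomes (ν := M.ν) hε
  refine ⟨fun s ω => a s (feedbackLeft M ε t x a s ω), feedbackState M ε t x a, ?_, ?_, ?_⟩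
  · have h1 : Measurable[(filt M.ν ε t).predictable]
        fun p : Ici t × Outcome => feedbackLeft M ε t x a p.1 p.2 :=
      @measurable_of_tendsto_metrizable _ _ (filt M.ν ε t).predictable _ _ _ _ _ _
        (fun m => measurable_eulerProcess hM hε ha m)
        (tendsto_pi_nhds.2 fun p => tendsto_eulerProcess ht p.1.2 p.2)
    have h2 : Measurable[(filt M.ν ε t).predictable]
        fun p : Ici t × Outcome => a p.1 (feedbackLeft M ε t x a p.1 p.2) :=
      ha.comp (measurable_time_predictable.prodMk h1)
    exact h2.stronglyMeasurable
  · filter_upwards [hreg] with ω hω s hs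
    exact feedbackState_eq hω ht hs
  · filter_upwards [hreg] with ω hω s hs
    rw [before_feedbackState hω ht hs.1, feedbackLeft, if_pos ⟨hω, hs.1⟩]

end

section

/-! ### Comparison of gains with the expansion -/

variable {M : Data} {ε t x : ℝ} {i₀ : ℕ} {δβ : ℕ → ℝ} {δV : ℕ → ℝ → ℝ → ℝ}
  {ρ : ℕ → ℝ → ℝ → M.A → ℝ} {abar : ℝ → ℝ → ℝ → M.A}

/-- Verification with the zero test function, whose drift is the reward itself. -/
lemma abs_gain_le (hM : M.Standing) {K : ℝ} (hK : ∀ x a, |M.r x a| ≤ K) (hε : 0 < ε)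
    (ht : t ∈ Icc 0 M.T) {α : ℝ → Outcome → M.A} {X : ℝ → Outcome → ℝ} (hα : IsControl M ε t α)
    (hX : IsState M ε t x α X) : |gain M ε t α X| ≤ K * (M.T - t) := by
  have hK0 : 0 ≤ K := (abs_nonneg _).trans (hK 0 (α 0 0))
  have hW : IsTestPair M.T (fun _ _ => 0) (fun _ _ => 0) 0 :=
    ⟨measurable_const, measurable_const, by simp, by simp, by simp, by simp⟩
  have h := gain_sub_mem_Icc hM hε ht hW hα hX (neg_nonpos.2 hK0) hK0
    (ae_of_all _ fun ω s _ => by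
      simp only [driftTerm, sub_self, integral_zero, mul_zero, add_zero]
      exact abs_le.1 (hK _ _))
  rw [sub_zero, neg_mul] at h
  exact abs_le.2 h

/-- A crude bound, allowed to blow up in ε. Verification asks for both bounds on the drift, and this
one fills the side whose conclusion is discarded. -/
lemma exists_abs_driftTerm_le (hM : M.Standing) {W g : ℝ → ℝ → ℝ} {B : ℝ} (hε : 0 < ε)
    (hW : IsTestPair M.T W g B) :
    ∃ L, 0 ≤ L ∧ ∀ s y a, |driftTerm M ε W g s y a| ≤ L := by
  obtain ⟨K, hK1, -, -, hK⟩ := hM.exists_bound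
  have hB : 0 ≤ B := (abs_nonneg _).trans (hW.abs_fun_le 0 0)
  refine ⟨K + B + ε⁻¹ * (B + B), by positivity, fun s y a => ?_⟩
  refine (abs_add_le _ _).trans (add_le_add ((abs_add_le _ _).trans
    (add_le_add (hK y a) (hW.abs_deriv_le s y))) ?_)
  rw [abs_mul, abs_of_pos (inv_pos.2 hε)]
  refine mul_le_mul_of_nonneg_left (hM.abs_integral_le fun e => ?_) (inv_pos.2 hε).le
  exact (abs_sub _ _).trans (add_le_add (hW.abs_fun_le _ _) (hW.abs_fun_le _ _))

lemma exists_gain_bounds (hM : M.Standing) (h : SolvesSystem M i₀ δβ δV ρ abar) :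
    ∃ ε₀ ∈ Ioo (0 : ℝ) 1, ∃ C, 0 ≤ C ∧ ∀ ε ∈ Ioo 0 ε₀, ∀ t ∈ Icc 0 M.T, ∀ x,
      (∀ α X, IsControl M ε t α → IsState M ε t x α X →
        gain M ε t α X ≤ expansion i₀ δβ δV ε t x + C * ε ^ (partialSum δβ (i₀ + 1) / 2)) ∧
      ∀ a : ℝ → ℝ → M.A, (∀ t ∈ Ico 0 M.T, ∀ x, a t x ∈ maximisers M i₀ δβ δV ρ ε t x) →
        ∀ α X, IsFeedbackPair M ε t x a α X →
          expansion i₀ δβ δV ε t x - C * ε ^ (partialSum δβ (i₀ + 1) / 2) ≤ gain M ε t α X := by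
  obtain ⟨ε₀, hε₀, C, hC, hdrift⟩ := exists_driftTerm_bound hM h
  have hT := hM.T_pos
  refine ⟨ε₀, hε₀, C * M.T, by positivity, fun ε hε t ht x => ?_⟩
  obtain ⟨B, hW⟩ := exists_isTestPair hM h (ε := ε) ⟨hε.1, hε.2.trans hε₀.2⟩
  obtain ⟨L, hL0, hL⟩ := exists_abs_driftTerm_le hM hε.1 hW
  set η := C * ε ^ (partialSum δβ (i₀ + 1) / 2) with hη
  have hη0 : 0 ≤ η := mul_nonneg hC (Real.rpow_nonneg hε.1.le _)
  have hηT : η * (M.T - t) ≤ C * M.T * ε ^ (partialSum δβ (i₀ + 1) / 2) := by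
    calc η * (M.T - t) ≤ η * M.T := mul_le_mul_of_nonneg_left (by linarith [ht.1]) hη0
      _ = _ := by rw [hη]; ring
  refine ⟨fun α X hα hX => ?_, fun a ha α X hp => ?_⟩
  · have h1 := (gain_sub_mem_Icc hM hε.1 ht hW hα hX (neg_nonpos.2 hL0) hη0
      (ae_of_all _ fun ω s hs => ⟨(abs_le.1 (hL _ _ _)).1,
        (hdrift ε hε s ⟨ht.1.trans hs.1.le, hs.2⟩ _ _).1⟩)).2
    simp only [clamp_eq_self ht] at h1
    linarith
  · obtain ⟨hα, hX, hfb⟩ := hp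
    have h1 := (gain_sub_mem_Icc hM hε.1 ht hW hα hX (neg_nonpos.2 hη0) hL0 (by
      filter_upwards [hfb] with ω hω s hs
      have hs' : s ∈ Ico 0 M.T := ⟨ht.1.trans hs.1.le, hs.2⟩
      refine ⟨(hdrift ε hε s hs' _ _).2 ?_, (abs_le.1 (hL _ _ _)).2⟩
      rw [hω s ⟨hs.1, hs.2.le⟩]
      exact ha s hs' _)).1
    simp only [clamp_eq_self ht] at h1
    linarith

lemma gain_le_value (hM : M.Standing) (hε : 0 < ε) (ht : t ∈ Icc 0 M.T)
    {α : ℝ → Outcome → M.A} {X : ℝ → Outcome → ℝ} (hα : IsControl M ε t α)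
    (hX : IsState M ε t x α X) : gain M ε t α X ≤ value M ε t x := by
  obtain ⟨K, -, -, -, hK⟩ := hM.exists_bound
  refine le_csSup ⟨K * (M.T - t), ?_⟩ ⟨α, X, hα, hX, rfl⟩
  rintro _ ⟨α', X', hα', hX', rfl⟩
  exact (abs_le.1 (abs_gain_le hM hK hε ht hα' hX')).2

/-- The map `a` only shows that some gain exists; the supremum of an empty set of reals would be the
default value 0. -/
lemma value_le {a : ℝ → ℝ → M.A} (ha : Measurable (Function.uncurry a)) (hM : M.Standing)
    (hε : 0 < ε) (ht : 0 ≤ t) {c : ℝ}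
    (h : ∀ α X, IsControl M ε t α → IsState M ε t x α X → gain M ε t α X ≤ c) :
    value M ε t x ≤ c := by
  obtain ⟨α, X, hα, hX, -⟩ := exists_isFeedbackPair hM hε ht x ha
  refine csSup_le ⟨_, α, X, hα, hX, rfl⟩ ?_
  rintro _ ⟨α', X', hα', hX', rfl⟩
  exact h α' X' hα' hX'

end

end PureJump

end

/-! ### Proof of the main theorem -/

theorem mainTheorem5 (M : PureJump.Data) (hM : M.Standing)
    (i₀ : ℕ) (δβ : ℕ → ℝ) (δV : ℕ → ℝ → ℝ → ℝ) (ρ : ℕ → ℝ → ℝ → M.A → ℝ)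
    (abar : ℝ → ℝ → ℝ → M.A)
    (h : PureJump.SolvesSystem M i₀ δβ δV ρ abar) :
    (∀ t ∈ Icc 0 M.T, ∀ x : ℝ,
      limsup (fun ε : ℝ => ENNReal.ofReal (ε ^ (-(PureJump.partialSum δβ (i₀ + 1)) / 2) *
        |PureJump.value M ε t x - PureJump.expansion i₀ δβ δV ε t x|)) (𝓝[>] 0) < ⊤) ∧
    ∃ C > 0, ∀ ε ∈ Ioo (0 : ℝ) 1, ∀ acheck : ℝ → ℝ → M.A,
      Measurable (Function.uncurry acheck) →
      (∀ t ∈ Ico 0 M.T, ∀ x, acheck t x ∈ PureJump.maximisers M i₀ δβ δV ρ ε t x) →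
      ∀ t ∈ Icc 0 M.T, ∀ x : ℝ,
        (∃ α X, PureJump.IsFeedbackPair M ε t x acheck α X) ∧
        ∀ α X, PureJump.IsFeedbackPair M ε t x acheck α X →
          PureJump.value M ε t x - C * ε ^ (PureJump.partialSum δβ (i₀ + 1) / 2) ≤
            PureJump.gain M ε t α X := by
  obtain ⟨ε₀, hε₀, C, hC, hbd⟩ := PureJump.exists_gain_bounds hM h
  obtain ⟨K, hK1, -, -, hK⟩ := hM.exists_bound
  have hT := hM.T_pos
  set β := PureJump.partialSum δβ (i₀ + 1) / 2 with hβ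
  have hβ0 : 0 ≤ β := div_nonneg (PureJump.partialSum_nonneg h le_rfl) zero_le_two
  refine ⟨fun t ht x => ?_, ?_⟩
  · refine lt_of_le_of_lt ?_ (ENNReal.ofReal_lt_top (r := C))
    refine limsup_le_of_le (by isBoundedDefault) ?_
    filter_upwards [Ioo_mem_nhdsGT hε₀.1] with ε hε
    have hε1 : ε ∈ Ioo (0 : ℝ) 1 := ⟨hε.1, hε.2.trans hε₀.2⟩
    obtain ⟨hup, hlow⟩ := hbd ε hε t ht x
    have hma := h.measurable_abar ε hε1
    obtain ⟨α, X, hp⟩ := PureJump.exists_isFeedbackPair hM hε.1 ht.1 x hma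
    have h1 := PureJump.value_le hma hM hε.1 ht.1 hup
    have h2 := (hlow _ (h.abar_mem ε hε1) α X hp).trans (PureJump.gain_le_value hM hε.1 ht hp.1 hp.2.1)
    refine ENNReal.ofReal_le_ofReal ?_
    calc ε ^ (-(PureJump.partialSum δβ (i₀ + 1)) / 2) * |PureJump.value M ε t x - PureJump.expansion i₀ δβ δV ε t x|
        ≤ ε ^ (-(PureJump.partialSum δβ (i₀ + 1)) / 2) * (C * ε ^ β) :=
          mul_le_mul_of_nonneg_left (abs_le.2 ⟨by linarith, by linarith⟩)
            (Real.rpow_nonneg hε.1.le _)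
      _ = C * ε ^ (-(PureJump.partialSum δβ (i₀ + 1)) / 2 + β) := by
          rw [Real.rpow_add hε.1]
          ring
      _ = C := by
          rw [hβ, neg_div, neg_add_cancel, Real.rpow_zero, mul_one]
  · have hε₀β : 0 < ε₀ ^ β := Real.rpow_pos_of_pos hε₀.1 _
    -- For ε < ε₀ the upper and lower estimates cost C each. For ε ≥ ε₀ both the value and the gain
    -- are trivially controlled by KT, and the factor (ε₀^β)⁻¹ ε^β is at least 1.
    refine ⟨2 * C + 2 * (K * M.T) * (ε₀ ^ β)⁻¹, by positivity,
      fun ε hε a hma ha t ht x => ⟨PureJump.exists_isFeedbackPair hM hε.1 ht.1 x hma, fun α X hp => ?_⟩⟩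
    have hεβ : 0 ≤ ε ^ β := Real.rpow_nonneg hε.1.le _
    have hKT : 0 ≤ K * M.T := by positivity
    rcases lt_or_ge ε ε₀ with hlt | hge
    · obtain ⟨hup, hlow⟩ := hbd ε ⟨hε.1, hlt⟩ t ht x
      have h1 := PureJump.value_le hma hM hε.1 ht.1 hup
      have h2 := hlow a ha α X hp
      have h3 : 0 ≤ 2 * (K * M.T) * (ε₀ ^ β)⁻¹ * ε ^ β := by positivity
      linarith
    · have hKt : K * (M.T - t) ≤ K * M.T :=
        mul_le_mul_of_nonneg_left (by linarith [ht.1]) (by linarith)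
      have h1 : PureJump.value M ε t x ≤ K * M.T := PureJump.value_le hma hM hε.1 ht.1 fun α' X' hα' hX' =>
        ((abs_le.1 (PureJump.abs_gain_le hM hK hε.1 ht hα' hX')).2).trans hKt
      have h2 := (abs_le.1 (PureJump.abs_gain_le hM hK hε.1 ht hp.1 hp.2.1)).1
      have h3 : 1 ≤ (ε₀ ^ β)⁻¹ * ε ^ β := by
        rw [inv_mul_eq_div, one_le_div hε₀β]
        exact Real.rpow_le_rpow hε₀.1.le hge hβ0
      have h4 := mul_le_mul_of_nonneg_left h3 (by positivity : 0 ≤ 2 * (K * M.T))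
      have h5 := mul_nonneg hC hεβ
      linarith
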